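/- Let $\Bbbk=\mathbb R$ or $\mathbb C$, let $p,q\ge 0$ and $k=p+q$. Manifolds are finite-dimensional, smooth, without boundary, Hausdorff and second countable; all maps are smooth. Let $\langle v,w\rangle=-\sum_{i\le p}\bar v_iw_i+\sum_{p<i\le k}\bar v_iw_i$ be the standard $(p,q)$-inner product on $\Bbbk^k$, let $O(\Bbbk,(p,q))\subset GL(k,\Bbbk)$ be the real Lie group of matrices preserving it, let $SO(\Bbbk,(p,q))$ be its subgroup of elements of determinant $1$, and let $\lambda$ denote the standard action of either group on $\Bbbk^k$. For an effective smooth action $\mu$ of a Lie group $G$ on a manifold $S$, a $(G,\mu)$-fibre bundle is a smooth fibre bundle $F\to M$ with fibre $S$ together with a maximal atlas of smooth local trivialisations whose transition maps have the form $(m,s)\mapsto(m,\mu(g(m),s))$ with $g$ smooth and $G$-valued; a morphism is a bundle map $F\to F'$ over an arbitrary smooth map $h:M\to M'$ which in trivialisations of the atlases has the form $(m,s)\mapsto(h(m),\mu(a(m),s))$ with $a$ smooth and $G$-valued. These form the category $FB^{\mu}$; the category of principal $G$-bundles is $PB^G=FB^L$, where $L$ is left multiplication of $G$ on itself. Let $MVB^k_{\Bbbk,(p,q)}$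 be the category of rank-$k$ smooth $\Bbbk$-vector bundles with a smooth, fibrewise non-degenerate symmetric (for $\Bbbk=\mathbb C$: Hermitian sesquilinear) form of negative index $p$ and positive index $q$; its morphisms are the bundle maps (over arbitrary smooth maps of base manifolds) that are linear and isometric on fibres. An orientation of a rank-$k$ bundle is a choice, on each fibre, of a class of ordered bases, two bases being equivalent if their change of basis has determinant in $\mathbb R_{>0}$, such that near each point there is a smooth local frame belonging to the chosen classes (for $\Bbbk=\mathbb R$ and $k\ge 1$ this is the usual notion). Let $OMVB^k_{\Bbbk,(p,q)}$ be the category of oriented metrised bundles, with the orientation-preserving morphisms of $MVB^k_{\Bbbk,(p,q)}$. Then: 1. There is an isomorphism of categories $D:MVB^k_{\Bbbk,(p,q)}\to FB^{\lambda}$, where $\lambda$ is the standard action of $O(\Bbbk,(p,q))$. It leaves the underlying fibre bundles and the underlying bundle maps unchanged, and the atlas of $D(V,g)$ consists of all smooth local trivialisations that are linear isometries from each fibre onto $(\Bbbk^k,\langle\cdot,\cdot\rangle)$. 2. There is an equivalence of categories $\Phi:MVB^k_{\Bbbk,(p,q)}\simeq PB^{O(\Bbbk,(p,q))}$. It is given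 by orthonormal frames: it is compatible with the base-space functors up to a natural isomorphism, and there are smooth maps $\Phi(V)\times\Bbbk^k\to V$, natural in $V$, $(a,v)\mapsto a(v)$, such that (up to that isomorphism of base spaces) each $a\in\Phi(V)$ over $m$ gives a linear isometry $\Bbbk^k\to V_m$, and $(a\cdot h)(v)=a(hv)$ for $h\in O(\Bbbk,(p,q))$. 3. There is an equivalence of categories $OMVB^k_{\Bbbk,(p,q)}\simeq PB^{SO(\Bbbk,(p,q))}$, given in the same sense by the positively oriented orthonormal frames. -/

import Mathlib

open scoped Manifold ContDiff Topology Matrix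
open CategoryTheory

universe u

namespace LinLie

open Set

section

variable {A : Type} [NormedRing A] [NormedAlgebra ℝ A] [CompleteSpace A]

/-- The exponential as a unit of the algebra. -/
noncomputable def expUnit (X : A) : Aˣ :=
  letI : NormedAlgebra ℚ A := NormedAlgebra.restrictScalars ℚ ℝ A
  { val := NormedSpace.exp X
    inv := NormedSpace.exp (-X)
    val_inv := by
      rw [← NormedSpace.exp_add_of_commute (Commute.neg_right (Commute.refl X)), add_neg_cancel,
        NormedSpace.exp_zero]
    inv_val := by
      rw [← NormedSpace.exp_add_of_commute (Commute.neg_left (Commute.refl X)), neg_add_cancel,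
        NormedSpace.exp_zero] }

@[simp] theorem expUnit_val (X : A) : ((expUnit X : Aˣ) : A) = NormedSpace.exp X := rfl

theorem contDiff_exp : ContDiff ℝ ω (NormedSpace.exp : A → A) :=
  contDiff_iff_contDiffAt.2 fun x => (NormedSpace.exp_analytic (𝕂 := ℝ) x).contDiffAt

variable (H : Subgroup Aˣ) (L : Submodule ℝ A)

/-- `L` is the Lie algebra of `H`, in the sense that the exponential maps `L` to `H` and that near
`0` only elements of `L` are mapped to `H`. -/
def IsExpModel : Prop :=
  (∀ X ∈ L, expUnit X ∈ H) ∧ ∀ᶠ X in 𝓝 (0 : A), expUnit X ∈ H → X ∈ L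

/-- The choices that go into the exponential charts of `H`: a local inverse of the exponential and
a projection onto the Lie algebra. -/
structure ExpData where
  φ : OpenPartialHomeomorph A A
  zero_mem : (0 : A) ∈ φ.source
  φ_eq : ∀ X, φ X = NormedSpace.exp X
  smooth_symm : ContDiffOn ℝ ∞ φ.symm φ.target
  mem_iff : ∀ X ∈ φ.source, expUnit X ∈ H → X ∈ L
  exp_mem : ∀ X ∈ L, expUnit X ∈ H
  P : A →L[ℝ] L
  P_left : ∀ X : L, P (X : A) = X

variable {H L}

theorem exists_local_log {W : Set A} (hW : W ∈ 𝓝 (0 : A)) :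
    ∃ φ : OpenPartialHomeomorph A A, (0 : A) ∈ φ.source ∧ φ.source ⊆ W ∧
      (∀ X, φ X = NormedSpace.exp X) ∧ ContDiffOn ℝ ∞ φ.symm φ.target := by
  have hd : HasFDerivAt (NormedSpace.exp : A → A)
      ((ContinuousLinearEquiv.refl ℝ A : A ≃L[ℝ] A) : A →L[ℝ] A) 0 :=
    (hasStrictFDerivAt_exp_zero (𝕂 := ℝ) (𝔸 := A)).hasFDerivAt
  have hc : ContDiffAt ℝ ω (NormedSpace.exp : A → A) 0 := contDiff_exp.contDiffAt
  have hn : (ω : WithTop ℕ∞) ≠ 0 := by simp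
  set ψ := hc.toOpenPartialHomeomorph _ hd hn with hψ
  have h0 : (0 : A) ∈ ψ.source := hc.mem_toOpenPartialHomeomorph_source hd hn
  have hinv : ContDiffAt ℝ ω ψ.symm (NormedSpace.exp (0 : A)) := hc.to_localInverse hd hn
  have hev : ∀ᶠ y in 𝓝 (NormedSpace.exp (0 : A)), ContDiffAt ℝ ω ψ.symm y :=
    hinv.eventually (by simp)
  have hcont : Continuous (NormedSpace.exp : A → A) := contDiff_exp.continuous
  have hpre : ∀ᶠ X in 𝓝 (0 : A), ContDiffAt ℝ ω ψ.symm (NormedSpace.exp X) :=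
    hcont.continuousAt.eventually hev
  obtain ⟨U, hU, hUo, hU0⟩ := mem_nhds_iff.1 (Filter.inter_mem hW hpre)
  refine ⟨ψ.restrOpen U hUo, ⟨h0, hU0⟩, fun X hX => (hU hX.2).1, fun X => rfl, ?_⟩
  intro y hy
  have hys : (ψ.restrOpen U hUo).symm y ∈ (ψ.restrOpen U hUo).source :=
    (ψ.restrOpen U hUo).map_target hy
  have h2 := (hU hys.2).2
  have h3 : NormedSpace.exp ((ψ.restrOpen U hUo).symm y) = y :=
    (ψ.restrOpen U hUo).right_inv hy
  have h4 : ContDiffAt ℝ ω ψ.symm y := by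
    have h2' : ContDiffAt ℝ ω ψ.symm (NormedSpace.exp ((ψ.restrOpen U hUo).symm y)) := h2
    rwa [h3] at h2'
  exact (h4.of_le le_top).contDiffWithinAt

theorem nonempty_expData [FiniteDimensional ℝ A] (h : IsExpModel H L) :
    Nonempty (ExpData H L) := by
  obtain ⟨φ, h0, hs, he, hsm⟩ := exists_local_log h.2
  obtain ⟨g, hg⟩ := L.subtype.exists_leftInverse_of_injective
    (LinearMap.ker_eq_bot.2 L.injective_subtype)
  exact ⟨⟨φ, h0, he, hsm, fun X hX => hs hX, h.1, LinearMap.toContinuousLinearMap g,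
    fun X => LinearMap.congr_fun hg X⟩⟩

namespace ExpData

variable (D : ExpData H L)

theorem one_mem : (1 : A) ∈ D.φ.target := by
  have := D.φ.map_source D.zero_mem
  rwa [D.φ_eq, NormedSpace.exp_zero] at this

/-- The element of `H` with a given logarithm. -/
noncomputable def expH (X : L) : H := ⟨expUnit (X : A), D.exp_mem X X.2⟩

theorem expH_val (X : L) : ((D.expH X : Aˣ) : A) = NormedSpace.exp (X : A) := rfl

theorem symm_mem {h : H} (hh : ((h : Aˣ) : A) ∈ D.φ.target) :
    D.φ.symm ((h : Aˣ) : A) ∈ L := by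
  refine D.mem_iff _ (D.φ.map_target hh) ?_
  have : expUnit (D.φ.symm ((h : Aˣ) : A)) = (h : Aˣ) := by
    ext
    rw [expUnit_val, ← D.φ_eq, D.φ.right_inv hh]
  rw [this]
  exact h.2

theorem val_P_symm {h : H} (hh : ((h : Aˣ) : A) ∈ D.φ.target) :
    ((D.P (D.φ.symm ((h : Aˣ) : A)) : L) : A) = D.φ.symm ((h : Aˣ) : A) := by
  have := D.P_left ⟨_, D.symm_mem hh⟩
  exact congrArg Subtype.val this

theorem continuous_expH : Continuous D.expH := by
  refine Continuous.subtype_mk ?_ _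
  refine Units.continuous_iff.2 ⟨?_, ?_⟩
  · exact (contDiff_exp (A := A)).continuous.comp continuous_subtype_val
  · exact (contDiff_exp (A := A)).continuous.comp continuous_subtype_val.neg

theorem continuous_coe {R : Type} [NormedRing R] {K : Subgroup Rˣ} :
    Continuous fun h : K => ((h : Rˣ) : R) :=
  Units.continuous_val.comp continuous_subtype_val

/-- The exponential chart around `h₀`: it sends `h₀ * exp X` to `X`. -/
noncomputable def chart (h₀ : H) : OpenPartialHomeomorph H L where
  toFun h := D.P (D.φ.symm (((h₀⁻¹ * h : H) : Aˣ) : A))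
  invFun X := h₀ * D.expH X
  source := {h | (((h₀⁻¹ * h : H) : Aˣ) : A) ∈ D.φ.target}
  target := {X | (X : A) ∈ D.φ.source}
  map_source' h hh := by
    simp only [mem_ofPred_eq] at hh ⊢
    rw [D.val_P_symm hh]
    exact D.φ.map_target hh
  map_target' X hX := by
    simp only [mem_ofPred_eq, inv_mul_cancel_left] at hX ⊢
    rw [D.expH_val, ← D.φ_eq]
    exact D.φ.map_source hX
  left_inv' h hh := by
    have : D.expH (D.P (D.φ.symm (((h₀⁻¹ * h : H) : Aˣ) : A))) = h₀⁻¹ * h := by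
      apply Subtype.ext
      apply Units.ext
      rw [D.expH_val, D.val_P_symm hh, ← D.φ_eq, D.φ.right_inv hh]
    rw [this, mul_inv_cancel_left]
  right_inv' X hX := by
    rw [inv_mul_cancel_left, D.expH_val, ← D.φ_eq, D.φ.left_inv hX, D.P_left]
  open_source := D.φ.open_target.preimage
    (continuous_coe.comp (continuous_const.mul continuous_id))
  open_target := D.φ.open_source.preimage continuous_subtype_val
  continuousOn_toFun := by
    refine D.P.continuous.comp_continuousOn ?_
    refine D.φ.continuousOn_symm.comp
      (continuous_coe.comp (continuous_const.mul continuous_id)).continuousOn ?_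
    intro h hh
    exact hh
  continuousOn_invFun := (continuous_const.mul D.continuous_expH).continuousOn

theorem mem_chart_source (h : H) : h ∈ (D.chart h).source := by
  change (((h⁻¹ * h : H) : Aˣ) : A) ∈ D.φ.target
  rw [inv_mul_cancel]
  exact D.one_mem

/-- The exponential charts as an atlas. -/
@[reducible] noncomputable def chartedSpace : ChartedSpace L H where
  atlas := range D.chart
  chartAt := D.chart
  mem_chart_source := D.mem_chart_source
  chart_mem_atlas h := ⟨h, rfl⟩

theorem contDiff_val_symm (h₀ : H) :
    ContDiff ℝ ∞ fun X : L => ((((D.chart h₀).symm X : H) : Aˣ) : A) := by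
  have : (fun X : L => ((((D.chart h₀).symm X : H) : Aˣ) : A)) =
      fun X : L => ((h₀ : Aˣ) : A) * NormedSpace.exp (X : A) := rfl
  rw [this]
  exact contDiff_const.mul (((contDiff_exp (A := A)).of_le le_top).comp L.subtypeL.contDiff)

theorem isManifold : letI := D.chartedSpace; IsManifold 𝓘(ℝ, L) ∞ H := by
  let _ := D.chartedSpace
  refine isManifold_of_contDiffOn _ _ _ ?_
  rintro _ _ ⟨h₀, rfl⟩ ⟨h₁, rfl⟩
  have key : ContDiffOn ℝ ∞ (fun X : L => D.P (D.φ.symm (((h₁⁻¹ : H) : Aˣ) *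
      ((((D.chart h₀).symm X : H) : Aˣ) : A)))) ((D.chart h₀).symm ≫ₕ D.chart h₁).source := by
    refine D.P.contDiff.comp_contDiffOn ?_
    refine D.smooth_symm.comp (contDiff_const.mul (D.contDiff_val_symm h₀)).contDiffOn ?_
    intro X hX
    exact hX.2
  exact key.mono fun X hX => hX.1

theorem contMDiff_coe : letI := D.chartedSpace
    ContMDiff 𝓘(ℝ, L) 𝓘(ℝ, A) ∞ fun h : H => ((h : Aˣ) : A) := by
  let _ := D.chartedSpace
  have := D.isManifold
  intro h
  rw [contMDiffAt_iff]
  refine ⟨continuous_coe.continuousAt, ?_⟩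
  exact (D.contDiff_val_symm h).contDiffAt.contDiffWithinAt

/-- A map into `H` is smooth as soon as it is smooth as a map into the algebra. -/
theorem contMDiff_of_coe {E N : Type*} [NormedAddCommGroup E] [NormedSpace ℝ E]
    {K : Type*} [TopologicalSpace K] {J : ModelWithCorners ℝ E K}
    [TopologicalSpace N] [ChartedSpace K N] {f : N → H} :
    let _ := D.chartedSpace
    ContMDiff J 𝓘(ℝ, A) ∞ (fun x => ((f x : Aˣ) : A)) → ContMDiff J 𝓘(ℝ, L) ∞ f := by
  intro _ hf
  have := D.isManifold
  have hcf : Continuous f := by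
    refine Continuous.subtype_mk (f := fun x => (f x : Aˣ)) ?_ (fun x => (f x).2)
    exact Units.isOpenEmbedding_val.isEmbedding.continuous_iff.2 hf.continuous
  intro x
  rw [contMDiffAt_iff_target]
  refine ⟨hcf.continuousAt, ?_⟩
  have hx : (((((f x)⁻¹ : H) : Aˣ) : A) * ((f x : Aˣ) : A)) ∈ D.φ.target := by
    have := D.one_mem
    rwa [← Units.val_one, ← inv_mul_cancel ((f x : Aˣ)), Units.val_mul] at this
  have h1 : ContDiffAt ℝ ∞ (fun a : A => D.P (D.φ.symm (((((f x)⁻¹ : H) : Aˣ) : A) * a)))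
      ((f x : Aˣ) : A) := by
    refine D.P.contDiff.contDiffAt.comp _ ?_
    refine ContDiffAt.comp (g := D.φ.symm) _ ?_ (contDiff_const.mul contDiff_id).contDiffAt
    exact (D.smooth_symm _ hx).contDiffAt (D.φ.open_target.mem_nhds hx)
  exact ContMDiffAt.comp x (g := fun a : A => D.P (D.φ.symm (((((f x)⁻¹ : H) : Aˣ) : A) * a)))
    h1.contMDiffAt (hf x)

theorem lieGroup : letI := D.chartedSpace; LieGroup 𝓘(ℝ, L) ∞ H := by
  let _ := D.chartedSpace
  have := D.isManifold
  have hmul : ContMDiff (𝓘(ℝ, L).prod 𝓘(ℝ, L)) 𝓘(ℝ, L) ∞ fun p : H × H => p.1 * p.2 := by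
    apply D.contMDiff_of_coe
    have h1 := D.contMDiff_coe.comp (contMDiff_fst (M := H) (N := H) (n := ∞)
      (I := 𝓘(ℝ, L)) (J := 𝓘(ℝ, L)))
    have h2 := D.contMDiff_coe.comp (contMDiff_snd (M := H) (N := H) (n := ∞)
      (I := 𝓘(ℝ, L)) (J := 𝓘(ℝ, L)))
    have h3 : ContDiff ℝ ∞ fun p : A × A => p.1 * p.2 := contDiff_fst.mul contDiff_snd
    exact h3.contMDiff.comp (h1.prodMk_space h2)
  have hinv : ContMDiff 𝓘(ℝ, L) 𝓘(ℝ, L) ∞ fun h : H => h⁻¹ := by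
    apply D.contMDiff_of_coe
    intro h
    have h1 : ContDiffAt ℝ ∞ Ring.inverse ((h : Aˣ) : A) := contDiffAt_ringInverse ℝ (h : Aˣ)
    have h2 := ContMDiffAt.comp h h1.contMDiffAt (D.contMDiff_coe h)
    refine h2.congr_of_eventuallyEq (Filter.Eventually.of_forall fun k => ?_)
    simp
  exact { toContMDiffMul := { contMDiff_mul := hmul, toIsManifold := D.isManifold }
          contMDiff_inv := hinv }

end ExpData

end

end LinLie

section

variable {𝕜 : Type} [RCLike 𝕜]

attribute [local instance] Matrix.linftyOpNormedRing Matrix.linftyOpNormedAlgebra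

theorem completeSpace_matrix (n : Type) [Fintype n] [DecidableEq n] :
    @CompleteSpace (Matrix n n 𝕜)
      (Matrix.linftyOpNormedRing (n := n) (α := 𝕜)).toMetricSpace.toPseudoMetricSpace.toUniformSpace :=
  FiniteDimensional.complete ℝ (Matrix n n 𝕜)

attribute [local instance] completeSpace_matrix

theorem det_exp_matrix {n : Type} [Fintype n] [DecidableEq n] (X : Matrix n n 𝕜) :
    (NormedSpace.exp X).det = NormedSpace.exp X.trace := by
  let _ : NormedAlgebra ℚ 𝕜 := NormedAlgebra.restrictScalars ℚ ℝ 𝕜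
  let _ : NormedAlgebra ℚ (Matrix n n 𝕜) := NormedAlgebra.restrictScalars ℚ ℝ (Matrix n n 𝕜)
  have hdet : Differentiable ℝ (fun M : Matrix n n 𝕜 => M.det) := by
    have he : ∀ i j, Differentiable ℝ (fun M : Matrix n n 𝕜 => M i j) := fun i j =>
      (LinearMap.toContinuousLinearMap
        ({ toFun := fun M => M i j, map_add' := fun _ _ => rfl, map_smul' := fun _ _ => rfl } :
          Matrix n n 𝕜 →ₗ[ℝ] 𝕜)).differentiable
    have : (fun M : Matrix n n 𝕜 => M.det) = fun M =>
        ∑ σ : Equiv.Perm n, ((Equiv.Perm.sign σ : ℤ) : 𝕜) * ∏ i, M (σ i) i := by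
      funext M; exact Matrix.det_apply' M
    rw [this]
    have hp : ∀ (σ : Equiv.Perm n) (s : Finset n),
        Differentiable ℝ (fun M : Matrix n n 𝕜 => ∏ i ∈ s, M (σ i) i) := by
      intro σ s
      classical
      induction s using Finset.induction_on with
      | empty => simp
      | insert a s ha ih =>
        simp only [Finset.prod_insert ha]
        exact (he _ _).mul ih
    exact Differentiable.fun_sum fun σ _ => (hp σ _).const_mul _
  -- the one-parameter family
  set f : ℝ → 𝕜 := fun t => (NormedSpace.exp (t • X)).det with hf
  have hE : HasDerivAt (fun t : ℝ => NormedSpace.exp (t • X)) X 0 := by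
    have h1 : HasFDerivAt (NormedSpace.exp : Matrix n n 𝕜 → Matrix n n 𝕜)
        (1 : Matrix n n 𝕜 →L[ℝ] Matrix n n 𝕜) ((0 : ℝ) • X) := by
      rw [zero_smul]
      exact (hasStrictFDerivAt_exp_zero (𝕂 := ℝ) (𝔸 := Matrix n n 𝕜)).hasFDerivAt
    have h2 : HasDerivAt (fun t : ℝ => t • X) X 0 := by
      have := (hasDerivAt_id (0 : ℝ)).smul_const X
      rw [one_smul] at this
      exact this
    exact h1.comp_hasDerivAt (0 : ℝ) h2
  have hf0 : HasDerivAt f X.trace 0 := by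
    have hd := (hdet 1).hasFDerivAt
    have h1 : HasDerivAt f (fderiv ℝ (fun M : Matrix n n 𝕜 => M.det) 1 X) 0 := by
      have hd' : HasFDerivAt (fun M : Matrix n n 𝕜 => M.det)
        (fderiv ℝ (fun M : Matrix n n 𝕜 => M.det) 1) (NormedSpace.exp ((0 : ℝ) • X)) := by
        rw [zero_smul, NormedSpace.exp_zero]; exact hd
      exact hd'.comp_hasDerivAt (0 : ℝ) hE
    have h2 : HasDerivAt (fun t : ℝ => (1 + t • X).det)
        (fderiv ℝ (fun M : Matrix n n 𝕜 => M.det) 1 X) 0 := by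
      have hd' : HasFDerivAt (fun M : Matrix n n 𝕜 => M.det)
        (fderiv ℝ (fun M : Matrix n n 𝕜 => M.det) 1) (1 + (0 : ℝ) • X) := by
        rw [zero_smul, add_zero]; exact hd
      have h3 : HasDerivAt (fun t : ℝ => 1 + t • X) X 0 := by
        have := ((hasDerivAt_id (0 : ℝ)).smul_const X).const_add 1
        rw [one_smul] at this
        exact this
      exact hd'.comp_hasDerivAt (0 : ℝ) h3
    have h4 : HasDerivAt (fun t : ℝ => (1 + t • X).det) X.trace 0 := by
      set Q : Polynomial 𝕜 :=
        (Matrix.det (1 + (Polynomial.X : Polynomial 𝕜) • X.map Polynomial.C)).divX.divX with hQ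
      have h5 : ∀ t : ℝ, (1 + t • X).det =
          1 + X.trace * (t : 𝕜) + Q.eval (t : 𝕜) * (t : 𝕜) ^ 2 := by
        intro t
        rw [hQ, ← Matrix.det_one_add_smul]
        congr 2
        ext i j
        simp [Algebra.smul_def]
      simp_rw [h5]
      have ht : HasDerivAt (fun t : ℝ => (t : 𝕜)) 1 0 := by
        simpa using (RCLike.ofRealCLM (K := 𝕜)).hasDerivAt (x := (0 : ℝ))
      have hq := (Q.hasDerivAt ((0 : ℝ) : 𝕜)).scomp (0 : ℝ) ht
      have h6 := ((ht.const_mul X.trace).const_add 1).add (hq.mul (ht.pow 2))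
      refine h6.congr_deriv ?_
      simp
    rw [h2.unique h4] at h1
    exact h1
  have hadd : ∀ s t : ℝ, f (s + t) = f s * f t := by
    intro s t
    simp only [hf]
    rw [add_smul, Matrix.exp_add_of_commute _ _
      (((Commute.refl X).smul_left s).smul_right t), Matrix.det_mul]
  have hft : ∀ t, HasDerivAt f (f t * X.trace) t := by
    intro t
    have h1 : HasDerivAt (fun s : ℝ => f t * f (s - t)) (f t * X.trace) t := by
      have : HasDerivAt (fun s : ℝ => f (s - t)) X.trace t := by
        apply HasDerivAt.comp_sub_const t t
        rw [sub_self]; exact hf0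
      exact this.const_mul _
    have h2 : (fun s : ℝ => f t * f (s - t)) = f := by
      funext s
      rw [← hadd, add_sub_cancel]
    rwa [h2] at h1
  set g : ℝ → 𝕜 := fun t => NormedSpace.exp (-(t • X.trace)) with hg
  have hgt : ∀ t, HasDerivAt g (-(g t * X.trace)) t := by
    intro t
    have h1 := (hasDerivAt_exp_smul_const (𝕂 := ℝ) (-X.trace) t)
    simpa [hg, smul_neg, mul_neg] using h1
  have hconst : ∀ t, HasDerivAt (fun t => f t * g t) 0 t := by
    intro t
    exact ((hft t).mul (hgt t)).congr_deriv (by ring)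
  have h01 := is_const_of_deriv_eq_zero (fun t => (hconst t).differentiableAt)
    (fun t => (hconst t).deriv) 1 0
  simp only [hf, hg, one_smul, zero_smul, neg_zero, NormedSpace.exp_zero, Matrix.det_one,
    mul_one] at h01
  have h02 : NormedSpace.exp (-X.trace) * NormedSpace.exp X.trace = 1 := by
    rw [← NormedSpace.exp_add, neg_add_cancel, NormedSpace.exp_zero]
  calc (NormedSpace.exp X).det
      = (NormedSpace.exp X).det * (NormedSpace.exp (-X.trace) * NormedSpace.exp X.trace) := by
        rw [h02, mul_one]
    _ = NormedSpace.exp X.trace := by rw [← mul_assoc, h01, one_mul]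

variable (𝕜) (p q : ℕ)

/-- The diagonal matrix with `p` entries `-1` followed by `q` entries `1`. -/
noncomputable def pqMatrix : Matrix (Fin p ⊕ Fin q) (Fin p ⊕ Fin q) 𝕜 :=
  Matrix.diagonal (Sum.elim (fun _ => -1) (fun _ => 1))

theorem pqMatrix_mul_self : pqMatrix 𝕜 p q * pqMatrix 𝕜 p q = 1 := by
  rw [pqMatrix, Matrix.diagonal_mul_diagonal, ← Matrix.diagonal_one]
  congr 1
  funext i
  rcases i with i | i <;> simp

/-- The group `O(𝕜, (p, q))` of matrices preserving the form with matrix `pqMatrix`. -/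
noncomputable def pqO : Subgroup (Matrix (Fin p ⊕ Fin q) (Fin p ⊕ Fin q) 𝕜)ˣ where
  carrier := {g | (g : Matrix (Fin p ⊕ Fin q) (Fin p ⊕ Fin q) 𝕜)ᴴ * pqMatrix 𝕜 p q * g =
    pqMatrix 𝕜 p q}
  one_mem' := by simp
  mul_mem' {a b} ha hb := by
    simp only [Set.mem_ofPred_eq] at ha hb ⊢
    rw [Units.val_mul, Matrix.conjTranspose_mul]
    generalize (a : Matrix (Fin p ⊕ Fin q) (Fin p ⊕ Fin q) 𝕜) = a at ha
    generalize (b : Matrix (Fin p ⊕ Fin q) (Fin p ⊕ Fin q) 𝕜) = b at hb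
    calc _ = bᴴ * (aᴴ * pqMatrix 𝕜 p q * a) * b := by simp only [Matrix.mul_assoc]
      _ = _ := by rw [ha, hb]
  inv_mem' {a} ha := by
    simp only [Set.mem_ofPred_eq] at ha ⊢
    have h1 := a.mul_inv
    generalize (a : Matrix (Fin p ⊕ Fin q) (Fin p ⊕ Fin q) 𝕜) = b at ha h1
    generalize ((a⁻¹ : (Matrix (Fin p ⊕ Fin q) (Fin p ⊕ Fin q) 𝕜)ˣ) :
      Matrix (Fin p ⊕ Fin q) (Fin p ⊕ Fin q) 𝕜) = c at h1 ⊢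
    have h2 : cᴴ * bᴴ = 1 := by rw [← Matrix.conjTranspose_mul, h1, Matrix.conjTranspose_one]
    calc _ = cᴴ * (bᴴ * pqMatrix 𝕜 p q * b) * c := by rw [ha]
      _ = (cᴴ * bᴴ) * pqMatrix 𝕜 p q * (b * c) := by simp only [Matrix.mul_assoc]
      _ = _ := by rw [h1, h2, Matrix.one_mul, Matrix.mul_one]

/-- The subgroup `SO(𝕜, (p, q))` of elements of determinant `1`. -/
noncomputable def pqSO : Subgroup (Matrix (Fin p ⊕ Fin q) (Fin p ⊕ Fin q) 𝕜)ˣ where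
  carrier := {g | g ∈ pqO 𝕜 p q ∧ (g : Matrix (Fin p ⊕ Fin q) (Fin p ⊕ Fin q) 𝕜).det = 1}
  one_mem' := ⟨one_mem _, by simp⟩
  mul_mem' ha hb := ⟨mul_mem ha.1 hb.1, by rw [Units.val_mul, Matrix.det_mul, ha.2, hb.2, one_mul]⟩
  inv_mem' {a} ha := ⟨inv_mem ha.1, by
    have := congrArg Matrix.det a.mul_inv
    rwa [Matrix.det_mul, ha.2, one_mul, Matrix.det_one] at this⟩

/-- The Lie algebra of `pqO`. -/
noncomputable def pqOLie : Submodule ℝ (Matrix (Fin p ⊕ Fin q) (Fin p ⊕ Fin q) 𝕜) where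
  carrier := {X | Xᴴ = pqMatrix 𝕜 p q * (-X) * pqMatrix 𝕜 p q}
  zero_mem' := by simp
  add_mem' {a b} ha hb := by
    simp only [Set.mem_ofPred_eq] at ha hb ⊢
    rw [Matrix.conjTranspose_add, ha, hb, neg_add, Matrix.mul_add, Matrix.add_mul]
  smul_mem' c X hX := by
    simp only [Set.mem_ofPred_eq] at hX ⊢
    rw [Matrix.conjTranspose_smul, hX]
    simp

/-- The Lie algebra of `pqSO`. -/
noncomputable def pqSOLie : Submodule ℝ (Matrix (Fin p ⊕ Fin q) (Fin p ⊕ Fin q) 𝕜) where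
  carrier := {X | X ∈ pqOLie 𝕜 p q ∧ X.trace = 0}
  zero_mem' := ⟨zero_mem _, by simp⟩
  add_mem' ha hb := ⟨add_mem ha.1 hb.1, by rw [Matrix.trace_add, ha.2, hb.2, add_zero]⟩
  smul_mem' c X hX := ⟨(pqOLie 𝕜 p q).smul_mem c hX.1, by rw [Matrix.trace_smul, hX.2, smul_zero]⟩

theorem mem_pqO_iff_exp (X : Matrix (Fin p ⊕ Fin q) (Fin p ⊕ Fin q) 𝕜) :
    LinLie.expUnit X ∈ pqO 𝕜 p q ↔ NormedSpace.exp Xᴴ =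
      NormedSpace.exp (pqMatrix 𝕜 p q * (-X) * pqMatrix 𝕜 p q) := by
  let _ : NormedAlgebra ℚ 𝕜 := NormedAlgebra.restrictScalars ℚ ℝ 𝕜
  let η : (Matrix (Fin p ⊕ Fin q) (Fin p ⊕ Fin q) 𝕜)ˣ :=
    ⟨pqMatrix 𝕜 p q, pqMatrix 𝕜 p q, pqMatrix_mul_self 𝕜 p q, pqMatrix_mul_self 𝕜 p q⟩
  have h1 : NormedSpace.exp (pqMatrix 𝕜 p q * (-X) * pqMatrix 𝕜 p q) =
      pqMatrix 𝕜 p q * NormedSpace.exp (-X) * pqMatrix 𝕜 p q := Matrix.exp_units_conj η (-X)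
  have h2 : NormedSpace.exp X * NormedSpace.exp (-X) = 1 := (LinLie.expUnit X).mul_inv
  have h3 : NormedSpace.exp (-X) * NormedSpace.exp X = 1 := (LinLie.expUnit X).inv_mul
  have h4 := pqMatrix_mul_self 𝕜 p q
  rw [h1, Matrix.exp_conjTranspose]
  change (NormedSpace.exp X)ᴴ * pqMatrix 𝕜 p q * NormedSpace.exp X = pqMatrix 𝕜 p q ↔ _
  constructor
  · intro h
    calc (NormedSpace.exp X)ᴴ = (NormedSpace.exp X)ᴴ * pqMatrix 𝕜 p q * (NormedSpace.exp X *
          NormedSpace.exp (-X)) * pqMatrix 𝕜 p q := by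
            rw [h2, Matrix.mul_one, Matrix.mul_assoc, h4, Matrix.mul_one]
      _ = ((NormedSpace.exp X)ᴴ * pqMatrix 𝕜 p q * NormedSpace.exp X) *
          NormedSpace.exp (-X) * pqMatrix 𝕜 p q := by simp only [Matrix.mul_assoc]
      _ = _ := by rw [h]
  · intro h
    rw [h]
    calc _ = pqMatrix 𝕜 p q * NormedSpace.exp (-X) * (pqMatrix 𝕜 p q * pqMatrix 𝕜 p q) *
          NormedSpace.exp X := by simp only [Matrix.mul_assoc]
      _ = _ := by rw [h4, Matrix.mul_one, Matrix.mul_assoc, h3, Matrix.mul_one]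

theorem isExpModel_pqO : LinLie.IsExpModel (pqO 𝕜 p q) (pqOLie 𝕜 p q) := by
  refine ⟨fun X hX => (mem_pqO_iff_exp 𝕜 p q X).2 (congrArg _ hX), ?_⟩
  obtain ⟨φ, h0, -, he, -⟩ := LinLie.exists_local_log
    (A := Matrix (Fin p ⊕ Fin q) (Fin p ⊕ Fin q) 𝕜) (W := Set.univ) Filter.univ_mem
  have c1 : Continuous fun X : Matrix (Fin p ⊕ Fin q) (Fin p ⊕ Fin q) 𝕜 => Xᴴ :=
    continuous_id.matrix_conjTranspose
  have c2 : Continuous fun X : Matrix (Fin p ⊕ Fin q) (Fin p ⊕ Fin q) 𝕜 =>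
      pqMatrix 𝕜 p q * (-X) * pqMatrix 𝕜 p q :=
    (continuous_const.mul continuous_neg).mul continuous_const
  have e1 : ∀ᶠ X in 𝓝 (0 : Matrix (Fin p ⊕ Fin q) (Fin p ⊕ Fin q) 𝕜), Xᴴ ∈ φ.source :=
    c1.tendsto' 0 0 (by simp) (φ.open_source.mem_nhds h0)
  have e2 : ∀ᶠ X in 𝓝 (0 : Matrix (Fin p ⊕ Fin q) (Fin p ⊕ Fin q) 𝕜),
      pqMatrix 𝕜 p q * (-X) * pqMatrix 𝕜 p q ∈ φ.source :=
    c2.tendsto' 0 0 (by simp) (φ.open_source.mem_nhds h0)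
  filter_upwards [e1, e2] with X h1 h2 hX
  refine φ.injOn h1 h2 ?_
  rw [he, he]
  exact (mem_pqO_iff_exp 𝕜 p q X).1 hX

theorem isExpModel_pqSO : LinLie.IsExpModel (pqSO 𝕜 p q) (pqSOLie 𝕜 p q) := by
  refine ⟨fun X hX => ⟨(isExpModel_pqO 𝕜 p q).1 X hX.1, ?_⟩, ?_⟩
  · exact (det_exp_matrix X).trans (by rw [hX.2, NormedSpace.exp_zero])
  obtain ⟨φ, h0, -, he, -⟩ := LinLie.exists_local_log (A := 𝕜) (W := Set.univ) Filter.univ_mem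
  have c1 : Continuous fun X : Matrix (Fin p ⊕ Fin q) (Fin p ⊕ Fin q) 𝕜 => X.trace :=
    continuous_id.matrix_trace
  have e1 : ∀ᶠ X in 𝓝 (0 : Matrix (Fin p ⊕ Fin q) (Fin p ⊕ Fin q) 𝕜), X.trace ∈ φ.source :=
    c1.tendsto' 0 0 (by simp) (φ.open_source.mem_nhds h0)
  filter_upwards [e1, (isExpModel_pqO 𝕜 p q).2] with X h1 h2 hX
  refine ⟨h2 hX.1, φ.injOn h1 h0 ?_⟩
  rw [he, he, NormedSpace.exp_zero]
  exact (det_exp_matrix X).symm.trans hX.2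

end

/-- A finite-dimensional smooth manifold without boundary, Hausdorff and second countable. The
model may be any finite-dimensional real normed space. -/
structure Mfd where
  carrier : Type u
  model : Type
  [nacg : NormedAddCommGroup model]
  [nsp : NormedSpace ℝ model]
  [finDim : FiniteDimensional ℝ model]
  [top : TopologicalSpace carrier]
  [t2 : T2Space carrier]
  [sct : SecondCountableTopology carrier]
  [charted : ChartedSpace model carrier]
  [mfd : IsManifold 𝓘(ℝ, model) ∞ carrier]

namespace Mfd

instance : CoeSort Mfd.{u} (Type u) := ⟨Mfd.carrier⟩

attribute [instance] Mfd.nacg Mfd.nsp Mfd.finDim Mfd.top Mfd.t2 Mfd.sct Mfd.charted Mfd.mfd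

/-- The model with corners of a manifold. -/
noncomputable abbrev I (M : Mfd.{u}) : ModelWithCorners ℝ M.model M.model := 𝓘(ℝ, M.model)

/-- Smooth maps. -/
@[ext]
structure Hom (M N : Mfd.{u}) where
  toFun : M → N
  smooth : ContMDiff M.I N.I ∞ toFun

instance : Category Mfd.{u} where
  Hom := Hom
  id M := ⟨id, contMDiff_id⟩
  comp f g := ⟨g.toFun ∘ f.toFun, g.smooth.comp f.smooth⟩

end Mfd

/-- A Lie group. -/
structure LieGrp extends Mfd.{0} where
  [grp : Group carrier]
  [lie : LieGroup 𝓘(ℝ, model) ∞ carrier]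

namespace LieGrp

instance : CoeSort LieGrp Type := ⟨fun G => G.carrier⟩

attribute [instance] LieGrp.grp LieGrp.lie

end LieGrp

namespace LinLie

theorem t2Space {R : Type} [NormedRing R] [CompleteSpace R] (H : Subgroup Rˣ) : T2Space H := by
  have : T2Space Rˣ := Units.isOpenEmbedding_val.isEmbedding.t2Space
  infer_instance

variable {A : Type} [NormedRing A] [NormedAlgebra ℝ A] [CompleteSpace A] [FiniteDimensional ℝ A]

theorem secondCountable (H : Subgroup Aˣ) : SecondCountableTopology H := by
  have : ProperSpace A := FiniteDimensional.proper_real A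
  have : SecondCountableTopology Aˣ :=
    Units.isOpenEmbedding_val.isEmbedding.secondCountableTopology
  exact TopologicalSpace.Subtype.secondCountableTopology (H : Set Aˣ)

variable {H : Subgroup Aˣ} {L : Submodule ℝ A}

/-- A linear group with its Lie algebra, as a Lie group with the exponential charts. -/
noncomputable def lieGrp (h : IsExpModel H L) : LieGrp where
  carrier := H
  model := L
  t2 := t2Space H
  sct := secondCountable H
  charted := (nonempty_expData h).some.chartedSpace
  mfd := (nonempty_expData h).some.isManifold
  lie := (nonempty_expData h).some.lieGroup

/-- An element of a linear group, as an element of the algebra. -/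
def val {h : IsExpModel H L} (g : lieGrp h) : A := ((show H from g : Aˣ) : A)

theorem contMDiff_val (h : IsExpModel H L) :
    ContMDiff (lieGrp h).I 𝓘(ℝ, A) ∞ (val : lieGrp h → A) :=
  (nonempty_expData h).some.contMDiff_coe

/-- A map into a linear group is smooth as soon as it is smooth as a map into the algebra. -/
theorem contMDiff_of_val (h : IsExpModel H L) {N : Mfd.{u}} {f : N → lieGrp h}
    (hf : ContMDiff N.I 𝓘(ℝ, A) ∞ fun x => val (f x)) : ContMDiff N.I (lieGrp h).I ∞ f :=
  (nonempty_expData h).some.contMDiff_of_coe hf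

theorem smooth_act {V : Type} [NormedAddCommGroup V] [NormedSpace ℝ V] (h : IsExpModel H L)
    (b : A × V → V) (hb : ContDiff ℝ ∞ b) :
    ContMDiff ((lieGrp h).I.prod 𝓘(ℝ, V)) 𝓘(ℝ, V) ∞
      fun x : lieGrp h × V => b (val x.1, x.2) := by
  have h2 := (contMDiff_val h).comp (contMDiff_fst (M := lieGrp h) (N := V) (n := ∞)
    (I := (lieGrp h).I) (J := 𝓘(ℝ, V)))
  have h3 := contMDiff_snd (M := lieGrp h) (N := V) (n := ∞) (I := (lieGrp h).I) (J := 𝓘(ℝ, V))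
  exact hb.contMDiff.comp (h2.prodMk_space h3)

end LinLie

/-- An effective smooth left action of a Lie group on a manifold. -/
structure EffectiveAction (G : LieGrp) (S : Mfd.{0}) where
  act : G → S → S
  one_act : ∀ s, act 1 s = s
  mul_act : ∀ g h s, act (g * h) s = act g (act h s)
  smooth : ContMDiff (G.I.prod S.I) S.I ∞ fun x : G × S => act x.1 x.2
  effective : ∀ g, (∀ s, act g s = s) → g = 1

theorem EffectiveAction.act_injective {G : LieGrp} {S : Mfd.{0}} (lam : EffectiveAction G S)
    {g h : G} (H : ∀ s, lam.act g s = lam.act h s) : g = h := by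
  have : h⁻¹ * g = 1 := lam.effective _ fun s => by
    rw [lam.mul_act, H, ← lam.mul_act, inv_mul_cancel, lam.one_act]
  exact (inv_mul_eq_one.1 this).symm

/-- The action of a Lie group on itself by left multiplication. -/
noncomputable def leftMul (G : LieGrp) : EffectiveAction G G.toMfd where
  act g h := g * h
  one_act := one_mul
  mul_act := mul_assoc
  smooth := contMDiff_mul 𝓘(ℝ, G.model) ∞
  effective g h := by simpa using h 1

/-- Both a local trivialisation and its inverse are smooth. -/
def IsSmoothTriv {S : Mfd.{0}} {F M : Mfd.{u}} {π : F → M} (e : Bundle.Trivialization S π) : Prop :=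
  ContMDiffOn F.I (M.I.prod S.I) ∞ e e.source ∧
    ContMDiffOn (M.I.prod S.I) F.I ∞ e.toOpenPartialHomeomorph.symm e.target

/-- A smooth fibre bundle with standard fibre `S`. -/
structure FibreBundle (S : Mfd.{0}) where
  base : Mfd.{u}
  total : Mfd.{u}
  proj : total → base
  smooth_proj : ContMDiff total.I base.I ∞ proj
  locally_trivial : ∀ m, ∃ e : Bundle.Trivialization S proj, m ∈ e.baseSet ∧ IsSmoothTriv e

namespace FibreBundle

variable {S : Mfd.{0}}

/-- The fibre over a point. -/
def Fibre (B : FibreBundle.{u} S) (m : B.base) : Type u := {x : B.total // B.proj x = m}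

/-- A map of fibre bundles, over an arbitrary map of base spaces. -/
@[ext]
structure Hom (B C : FibreBundle.{u} S) where
  base : B.base ⟶ C.base
  total : B.total ⟶ C.total
  comm : ∀ x, C.proj (total.toFun x) = base.toFun (B.proj x)

instance : Category (FibreBundle.{u} S) where
  Hom := Hom
  id B := ⟨𝟙 _, 𝟙 _, fun _ => rfl⟩
  comp f g := ⟨f.base ≫ g.base, f.total ≫ g.total, fun x =>
    (g.comm _).trans (congrArg g.base.toFun (f.comm x))⟩

/-- The functor sending a bundle to its base space. -/
def baseFunctor : FibreBundle.{u} S ⥤ Mfd.{u} where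
  obj B := B.base
  map f := Hom.base f

/-- The map induced by a bundle map on the fibre over `m`. -/
def Hom.onFibre {B C : FibreBundle.{u} S} (f : Hom B C) (m : B.base) (x : B.Fibre m) :
    C.Fibre (f.base.toFun m) :=
  ⟨f.total.toFun x.1, by rw [f.comm, x.2]⟩

end FibreBundle

section GBundle

variable {G : LieGrp} {S : Mfd.{0}} (lam : EffectiveAction G S)

/-- The transition from `e'` to `e` is given by a smooth `G`-valued function on the overlap. -/
def Compatible {F M : Mfd.{u}} {π : F → M} (e e' : Bundle.Trivialization S π) : Prop :=
  ∃ g : M → G, ContMDiffOn M.I G.I ∞ g (e.baseSet ∩ e'.baseSet) ∧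
    ∀ m ∈ e.baseSet ∩ e'.baseSet, ∀ s,
      e (e'.toOpenPartialHomeomorph.symm (m, s)) = (m, lam.act (g m) s)

/-- A maximal `(G, λ)`-bundle atlas on a fibre bundle. As `λ` is effective, the `G`-valued
transition functions are determined by the trivialisations, and such maximal atlases correspond to
strict equivalence classes of coordinate `(G, λ)`-bundle structures. -/
structure GStructure (B : FibreBundle.{u} S) where
  atlas : Set (Bundle.Trivialization S B.proj)
  smooth : ∀ e ∈ atlas, IsSmoothTriv e
  cover : ∀ m, ∃ e ∈ atlas, m ∈ e.baseSet
  compatible : ∀ e ∈ atlas, ∀ e' ∈ atlas, Compatible lam e e'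
  maximal : ∀ e : Bundle.Trivialization S B.proj, IsSmoothTriv e →
    (∀ e' ∈ atlas, Compatible lam e e') → e ∈ atlas

/-- A `(G, λ)`-fibre bundle. -/
structure GBundle where
  bundle : FibreBundle.{u} S
  str : GStructure lam bundle

namespace GBundle

variable {lam}

/-- In the trivialisations `e` and `e'`, the bundle map `f` is of the form
`(m, s) ↦ (f m, h m • s)` for a smooth `G`-valued function `h`. -/
def LocallyG (lam : EffectiveAction G S) {B C : FibreBundle.{u} S} (f : B ⟶ C)
    (e : Bundle.Trivialization S B.proj) (e' : Bundle.Trivialization S C.proj) : Prop :=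
  ∃ h : B.base → G,
    ContMDiffOn B.base.I G.I ∞ h (e.baseSet ∩ f.base.toFun ⁻¹' e'.baseSet) ∧
    ∀ m ∈ e.baseSet ∩ f.base.toFun ⁻¹' e'.baseSet, ∀ s,
      e' (f.total.toFun (e.toOpenPartialHomeomorph.symm (m, s))) =
        (f.base.toFun m, lam.act (h m) s)

/-- A map of `(G, λ)`-bundles. -/
@[ext]
structure Hom (X Y : GBundle.{u} lam) where
  hom : X.bundle ⟶ Y.bundle
  locally_G : ∀ e ∈ X.str.atlas, ∀ e' ∈ Y.str.atlas, LocallyG lam hom e e'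

theorem locallyG_comp {X Y Z : GBundle.{u} lam} (f : Hom X Y) (g : Hom Y Z)
    (e : Bundle.Trivialization S X.bundle.proj) (he : e ∈ X.str.atlas)
    (e'' : Bundle.Trivialization S Z.bundle.proj) (he'' : e'' ∈ Z.str.atlas) :
    LocallyG lam (f.hom ≫ g.hom) e e'' := by
  classical
  let T : X.bundle.base → S → S := fun m s =>
    (e'' (g.hom.total.toFun (f.hom.total.toFun (e.toOpenPartialHomeomorph.symm (m, s))))).2
  let W : Set X.bundle.base :=
    e.baseSet ∩ (f.hom ≫ g.hom).base.toFun ⁻¹' e''.baseSet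
  have hloc : ∀ m ∈ W, ∃ V : Set X.bundle.base, IsOpen V ∧ m ∈ V ∧ ∃ h : X.bundle.base → G,
      ContMDiffOn X.bundle.base.I G.I ∞ h (W ∩ V) ∧
      ∀ x ∈ W ∩ V, ∀ s, T x s = lam.act (h x) s := by
    intro m _
    obtain ⟨e', he', hme'⟩ := Y.str.cover (f.hom.base.toFun m)
    obtain ⟨h, hh, hh'⟩ := f.locally_G e he e' he'
    obtain ⟨i, hi, hi'⟩ := g.locally_G e' he' e'' he''
    refine ⟨f.hom.base.toFun ⁻¹' e'.baseSet,
      e'.open_baseSet.preimage f.hom.base.smooth.continuous, hme',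
      fun x => i (f.hom.base.toFun x) * h x, ?_, ?_⟩
    · refine ContMDiffOn.mul (I := 𝓘(ℝ, G.model)) ?_
        (hh.mono fun x hx => ⟨hx.1.1, hx.2⟩)
      exact hi.comp (f.hom.base.smooth.contMDiffOn) fun x hx => ⟨hx.2, hx.1.2⟩
    · intro x hx s
      have h1 := hh' x ⟨hx.1.1, hx.2⟩ s
      have h2 := hi' (f.hom.base.toFun x) ⟨hx.2, hx.1.2⟩ (lam.act (h x) s)
      have hsrc : f.hom.total.toFun (e.toOpenPartialHomeomorph.symm (x, s)) ∈ e'.source := by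
        rw [e'.mem_source, f.hom.comm, e.proj_symm_apply' hx.1.1]
        exact hx.2
      have h3 : f.hom.total.toFun (e.toOpenPartialHomeomorph.symm (x, s)) =
          e'.toOpenPartialHomeomorph.symm (f.hom.base.toFun x, lam.act (h x) s) := by
        rw [← h1]
        exact (e'.toOpenPartialHomeomorph.left_inv hsrc).symm
      simp only [T]
      rw [h3, h2, lam.mul_act]
  let H : X.bundle.base → G := fun x =>
    if hx : ∃ a : G, ∀ s, T x s = lam.act a s then hx.choose else 1
  have hH : ∀ x (a : G), (∀ s, T x s = lam.act a s) → H x = a := by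
    intro x a ha
    have hx : ∃ a : G, ∀ s, T x s = lam.act a s := ⟨a, ha⟩
    simp only [H, dif_pos hx]
    exact lam.act_injective fun s => by rw [← hx.choose_spec, ha]
  refine ⟨H, ?_, ?_⟩
  · intro m hm
    obtain ⟨V, hV, hmV, h, hs, hT⟩ := hloc m hm
    have h1 : ContMDiffWithinAt X.bundle.base.I G.I ∞ H (W ∩ V) m :=
      (hs m ⟨hm, hmV⟩).congr (fun y hy => hH y _ (hT y hy)) (hH m _ (hT m ⟨hm, hmV⟩))
    exact (contMDiffWithinAt_inter (hV.mem_nhds hmV)).1 h1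
  · intro m hm s
    obtain ⟨V, hV, hmV, h, hs, hT⟩ := hloc m hm
    have h1 := hT m ⟨hm, hmV⟩
    rw [hH m _ h1]
    refine Prod.ext ?_ (h1 s)
    have hp : Z.bundle.proj ((f.hom ≫ g.hom).total.toFun
        (e.toOpenPartialHomeomorph.symm (m, s))) = (f.hom ≫ g.hom).base.toFun m := by
      rw [(f.hom ≫ g.hom).comm, e.proj_symm_apply' hm.1]
    rw [e''.coe_fst' (by rw [hp]; exact hm.2), hp]

theorem locallyG_id (X : GBundle.{u} lam) (e : Bundle.Trivialization S X.bundle.proj)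
    (he : e ∈ X.str.atlas) (e' : Bundle.Trivialization S X.bundle.proj)
    (he' : e' ∈ X.str.atlas) : LocallyG lam (𝟙 X.bundle) e e' := by
  obtain ⟨g, hg, hg'⟩ := X.str.compatible e' he' e he
  exact ⟨g, hg.mono fun x hx => ⟨hx.2, hx.1⟩, fun m hm s => hg' m ⟨hm.2, hm.1⟩ s⟩

instance : Category (GBundle.{u} lam) where
  Hom := Hom
  id X := ⟨𝟙 X.bundle, fun e he e' he' => locallyG_id X e he e' he'⟩
  comp f g := ⟨f.hom ≫ g.hom, fun e he e' he' => locallyG_comp f g e he e' he'⟩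

/-- The functor forgetting the `(G, λ)`-structure. -/
def forget : GBundle.{u} lam ⥤ FibreBundle.{u} S where
  obj X := X.bundle
  map f := Hom.hom f

end GBundle

end GBundle

/-- Principal `G`-bundles. -/
noncomputable abbrev PrincipalBundle (G : LieGrp) := GBundle.{u} (leftMul G)

section Orthogonal

variable (𝕜 : Type) [RCLike 𝕜] (p q : ℕ)

/-- The space `𝕜 ^ (p + q)` as a real manifold. -/
noncomputable abbrev vecMfd : Mfd.{0} where
  carrier := Fin p ⊕ Fin q → 𝕜
  model := Fin p ⊕ Fin q → 𝕜

variable {𝕜 p q} in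
/-- The standard `(p, q)`-inner product
`- ∑_{i ≤ p} conj (v i) * w i + ∑_{i > p} conj (v i) * w i`. -/
noncomputable def pqForm (v w : Fin p ⊕ Fin q → 𝕜) : 𝕜 := star v ⬝ᵥ (pqMatrix 𝕜 p q *ᵥ w)

attribute [local instance] Matrix.linftyOpNormedRing Matrix.linftyOpNormedAlgebra
  completeSpace_matrix

variable {𝕜 p q} in
/-- The standard action of a matrix group on `𝕜 ^ (p + q)`. -/
noncomputable def matrixAction {H : Subgroup (Matrix (Fin p ⊕ Fin q) (Fin p ⊕ Fin q) 𝕜)ˣ}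
    {L : Submodule ℝ (Matrix (Fin p ⊕ Fin q) (Fin p ⊕ Fin q) 𝕜)} (h : LinLie.IsExpModel H L) :
    EffectiveAction (LinLie.lieGrp h) (vecMfd 𝕜 p q) where
  act g v := LinLie.val g *ᵥ v
  one_act s := Matrix.one_mulVec s
  mul_act g k s := (Matrix.mulVec_mulVec s _ _).symm
  smooth := by
    refine LinLie.smooth_act h (fun x : Matrix (Fin p ⊕ Fin q) (Fin p ⊕ Fin q) 𝕜 ×
        (Fin p ⊕ Fin q → 𝕜) => x.1 *ᵥ x.2) ?_
    refine contDiff_pi.2 fun i => ?_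
    have h1 : ∀ j, ContDiff ℝ ∞ fun x : Matrix (Fin p ⊕ Fin q) (Fin p ⊕ Fin q) 𝕜 ×
        (Fin p ⊕ Fin q → 𝕜) => x.1 i j * x.2 j := fun j => by
      refine ContDiff.mul ?_ ?_
      · exact (LinearMap.toContinuousLinearMap
          ({ toFun := fun M => M i j, map_add' := fun _ _ => rfl, map_smul' := fun _ _ => rfl } :
          Matrix (Fin p ⊕ Fin q) (Fin p ⊕ Fin q) 𝕜 →ₗ[ℝ] 𝕜)).contDiff.comp contDiff_fst
      · exact (contDiff_apply ℝ 𝕜 j).comp contDiff_snd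
    exact ContDiff.sum (s := Finset.univ) fun j _ => h1 j
  effective g hg := by
    apply Subtype.ext
    apply Units.ext
    refine Matrix.mulVec_injective (funext fun v => ?_)
    exact (hg v).trans (Matrix.one_mulVec v).symm

/-- `O(𝕜, (p, q))` as a Lie group. -/
noncomputable abbrev lieO : LieGrp := LinLie.lieGrp (isExpModel_pqO 𝕜 p q)

/-- `SO(𝕜, (p, q))` as a Lie group. -/
noncomputable abbrev lieSO : LieGrp := LinLie.lieGrp (isExpModel_pqSO 𝕜 p q)

/-- The standard action of `O(𝕜, (p, q))` on `𝕜 ^ (p + q)`. -/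
noncomputable abbrev actO : EffectiveAction (lieO 𝕜 p q) (vecMfd 𝕜 p q) :=
  matrixAction (isExpModel_pqO 𝕜 p q)

/-- The standard action of `SO(𝕜, (p, q))` on `𝕜 ^ (p + q)`. -/
noncomputable abbrev actSO : EffectiveAction (lieSO 𝕜 p q) (vecMfd 𝕜 p q) :=
  matrixAction (isExpModel_pqSO 𝕜 p q)

end Orthogonal

section Metrised

variable {𝕜 : Type} [RCLike 𝕜] {p q : ℕ}

/-- A trivialisation that is linear on the fibres. -/
def IsLinearTriv {B : FibreBundle.{u} (vecMfd 𝕜 p q)} [∀ m, AddCommGroup (B.Fibre m)]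
    [∀ m, Module 𝕜 (B.Fibre m)] (e : Bundle.Trivialization (vecMfd 𝕜 p q) B.proj) : Prop :=
  ∀ m ∈ e.baseSet, IsLinearMap 𝕜 fun x : B.Fibre m => ((e x.1).2 : Fin p ⊕ Fin q → 𝕜)

variable (𝕜 p q) in
/-- The structure of a `𝕜`-vector bundle of rank `p + q` with a metric of signature `(p, q)` on a
fibre bundle: `p` is the negative and `q` the positive index. The metric is sesquilinear, linear
in the second variable. -/
structure MetricStructure (B : FibreBundle.{u} (vecMfd 𝕜 p q)) where
  [acg : ∀ m, AddCommGroup (B.Fibre m)]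
  [mod : ∀ m, Module 𝕜 (B.Fibre m)]
  locally_linear : ∀ m, ∃ e : Bundle.Trivialization (vecMfd 𝕜 p q) B.proj,
    m ∈ e.baseSet ∧ IsSmoothTriv e ∧ IsLinearTriv e
  metric : ∀ m, B.Fibre m → B.Fibre m → 𝕜
  metric_add : ∀ m x y z, metric m x (y + z) = metric m x y + metric m x z
  metric_smul : ∀ m x (c : 𝕜) y, metric m x (c • y) = c * metric m x y
  metric_symm : ∀ m x y, metric m y x = starRingEnd 𝕜 (metric m x y)
  nondegenerate : ∀ m x, (∀ y, metric m x y = 0) → x = 0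
  smooth_metric : ∀ (U : Set B.base) (σ τ : ∀ m, B.Fibre m), IsOpen U →
    ContMDiffOn B.base.I B.total.I ∞ (fun m => (σ m).1) U →
    ContMDiffOn B.base.I B.total.I ∞ (fun m => (τ m).1) U →
    ContMDiffOn B.base.I 𝓘(ℝ, 𝕜) ∞ (fun m => metric m (σ m) (τ m)) U
  negative_index : ∀ m, IsGreatest {d | ∃ N : Submodule 𝕜 (B.Fibre m),
    Module.finrank 𝕜 N = d ∧ ∀ x ∈ N, x ≠ 0 → RCLike.re (metric m x x) < 0} p
  positive_index : ∀ m, IsGreatest {d | ∃ N : Submodule 𝕜 (B.Fibre m),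
    Module.finrank 𝕜 N = d ∧ ∀ x ∈ N, x ≠ 0 → 0 < RCLike.re (metric m x x)} q

/-- A trivialisation that is a linear isometry from each fibre to `𝕜 ^ (p + q)` with the standard
`(p, q)`-inner product. -/
def MetricStructure.IsIsometricTriv {B : FibreBundle.{u} (vecMfd 𝕜 p q)}
    (s : MetricStructure 𝕜 p q B) (e : Bundle.Trivialization (vecMfd 𝕜 p q) B.proj) : Prop :=
  letI := s.acg
  letI := s.mod
  IsLinearTriv e ∧ ∀ m ∈ e.baseSet, ∀ x y : B.Fibre m,
    s.metric m x y = pqForm (e x.1).2 (e y.1).2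

variable (𝕜 p q) in
/-- A metrised vector bundle over `𝕜` of rank `p + q` and signature `(p, q)`. -/
structure MVB where
  bundle : FibreBundle.{u} (vecMfd 𝕜 p q)
  str : MetricStructure 𝕜 p q bundle

namespace MVB

/-- The fibre of a metrised vector bundle, as a vector space. -/
def Fibre (V : MVB.{u} 𝕜 p q) (m : V.bundle.base) : Type u := V.bundle.Fibre m

noncomputable instance (V : MVB.{u} 𝕜 p q) (m : V.bundle.base) : AddCommGroup (V.Fibre m) :=
  V.str.acg m

noncomputable instance (V : MVB.{u} 𝕜 p q) (m : V.bundle.base) : Module 𝕜 (V.Fibre m) :=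
  V.str.mod m

/-- A point of the total space, as an element of the fibre it lies in. -/
def pt (V : MVB.{u} 𝕜 p q) {m : V.bundle.base} (x : V.bundle.total) (h : V.bundle.proj x = m) :
    V.Fibre m :=
  ⟨x, h⟩

/-- The metric on a fibre. -/
def metric (V : MVB.{u} 𝕜 p q) {m : V.bundle.base} (x y : V.Fibre m) : 𝕜 := V.str.metric m x y

/-- The map between fibres induced by a bundle map. -/
noncomputable def onFibre {V W : MVB.{u} 𝕜 p q} (f : V.bundle ⟶ W.bundle) (m : V.bundle.base)
    (x : V.Fibre m) : W.Fibre (f.base.toFun m) :=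
  FibreBundle.Hom.onFibre f m x

/-- A map of metrised vector bundles: a map of fibre bundles, linear and isometric on fibres. -/
@[ext]
structure Hom (V W : MVB.{u} 𝕜 p q) where
  hom : V.bundle ⟶ W.bundle
  linear : ∀ m, IsLinearMap 𝕜 (onFibre hom m : V.Fibre m → W.Fibre (hom.base.toFun m))
  isometry : ∀ m (x y : V.Fibre m),
    W.metric (onFibre hom m x) (onFibre hom m y) = V.metric x y

noncomputable instance : Category (MVB.{u} 𝕜 p q) where
  Hom := Hom
  id V := ⟨𝟙 V.bundle, fun _ => ⟨fun _ _ => rfl, fun _ _ => rfl⟩, fun _ _ _ => rfl⟩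
  comp {U V W} f g := ⟨f.hom ≫ g.hom,
    fun m => ⟨fun x y => (congrArg (onFibre g.hom _) ((f.linear m).map_add x y)).trans
        ((g.linear _).map_add _ _),
      fun c x => (congrArg (onFibre g.hom _) ((f.linear m).map_smul c x)).trans
        ((g.linear _).map_smul _ _)⟩,
    fun m x y => (g.isometry _ _ _).trans (f.isometry m x y)⟩

/-- The functor forgetting the vector bundle structure and the metric. -/
noncomputable def forget : MVB.{u} 𝕜 p q ⥤ FibreBundle.{u} (vecMfd 𝕜 p q) where
  obj V := V.bundle
  map f := Hom.hom f

end MVB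

/-- An orientation of a metrised vector bundle: on each fibre an equivalence class of ordered
bases, two bases being equivalent if the change of basis has positive (in particular real)
determinant, such that near each point there is a smooth local frame in the given classes. -/
structure OrientationStructure (V : MVB.{u} 𝕜 p q) where
  positive : ∀ m, Set (Module.Basis (Fin p ⊕ Fin q) 𝕜 (V.Fibre m))
  is_class : ∀ m, ∃ b₀ : Module.Basis (Fin p ⊕ Fin q) 𝕜 (V.Fibre m),
    positive m = {b | ∃ r : ℝ, 0 < r ∧ b₀.det (fun i => b i) = (r : 𝕜)}
  locally_framed : ∀ m, ∃ e : Bundle.Trivialization (vecMfd 𝕜 p q) V.bundle.proj,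
    m ∈ e.baseSet ∧ IsSmoothTriv e ∧ ∀ m' ∈ e.baseSet,
      (IsLinearMap 𝕜 fun x : V.Fibre m' => ((e x.1).2 : Fin p ⊕ Fin q → 𝕜)) ∧
      ∀ b : Module.Basis (Fin p ⊕ Fin q) 𝕜 (V.Fibre m'),
        (∀ i, (e (b i).1).2 = Pi.single i (1 : 𝕜)) → b ∈ positive m'

variable (𝕜 p q) in
/-- An oriented metrised vector bundle over `𝕜` of rank `p + q` and signature `(p, q)`. -/
structure OMVB where
  toMVB : MVB.{u} 𝕜 p q
  orientation : OrientationStructure toMVB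

namespace OMVB

/-- A map of oriented metrised vector bundles. -/
@[ext]
structure Hom (V W : OMVB.{u} 𝕜 p q) where
  hom : V.toMVB ⟶ W.toMVB
  orientation_preserving : ∀ m, ∀ b ∈ V.orientation.positive m,
    ∀ b' : Module.Basis (Fin p ⊕ Fin q) 𝕜 (W.toMVB.Fibre (hom.hom.base.toFun m)),
      (∀ i, b' i = MVB.onFibre hom.hom m (b i)) → b' ∈ W.orientation.positive _

theorem exists_image_basis {V W : MVB.{u} 𝕜 p q} (f : V ⟶ W) (m : V.bundle.base)
    (b : Module.Basis (Fin p ⊕ Fin q) 𝕜 (V.Fibre m))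
    (c : Module.Basis (Fin p ⊕ Fin q) 𝕜 (W.Fibre (f.hom.base.toFun m))) :
    ∃ b' : Module.Basis (Fin p ⊕ Fin q) 𝕜 (W.Fibre (f.hom.base.toFun m)),
      ∀ i, b' i = MVB.onFibre f.hom m (b i) := by
  let L : V.Fibre m →ₗ[𝕜] W.Fibre (f.hom.base.toFun m) := (f.linear m).mk'
  have hinj : Function.Injective L := by
    refine (injective_iff_map_eq_zero L).2 fun x hx => V.str.nondegenerate m x fun y => ?_
    have h1 := f.isometry m x y
    have h2 : MVB.onFibre f.hom m x = 0 := hx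
    rw [h2] at h1
    have h3 : W.metric (0 : W.Fibre (f.hom.base.toFun m)) (MVB.onFibre f.hom m y) = 0 := by
      have h4 := W.str.metric_smul _ (MVB.onFibre f.hom m y) (0 : 𝕜) (0 : W.Fibre _)
      have h5 := W.str.metric_symm _ (MVB.onFibre f.hom m y) (0 : W.Fibre _)
      rw [zero_mul] at h4
      have h6 : ((0 : 𝕜) • (0 : W.Fibre (f.hom.base.toFun m))) = 0 := zero_smul _ _
      erw [h6] at h4
      exact h5.trans (by rw [h4, map_zero])
    exact h1.symm.trans h3
  have hfin : Module.finrank 𝕜 (V.Fibre m) =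
      Module.finrank 𝕜 (W.Fibre (f.hom.base.toFun m)) := by
    rw [Module.finrank_eq_card_basis b, Module.finrank_eq_card_basis c]
  have : FiniteDimensional 𝕜 (V.Fibre m) := b.finiteDimensional_of_finite
  have : FiniteDimensional 𝕜 (W.Fibre (f.hom.base.toFun m)) := c.finiteDimensional_of_finite
  refine ⟨b.map (LinearEquiv.ofInjectiveOfFinrankEq L hinj hfin), fun i => rfl⟩

noncomputable instance : Category (OMVB.{u} 𝕜 p q) where
  Hom := Hom
  id V := ⟨𝟙 V.toMVB, fun m b hb b' h => by
    have : b' = b := Module.Basis.eq_of_apply_eq h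
    exact this ▸ hb⟩
  comp {U V W} f g := ⟨f.hom ≫ g.hom, fun m b hb b'' h => by
    obtain ⟨c, -⟩ := V.orientation.is_class (f.hom.hom.base.toFun m)
    obtain ⟨b', hb'⟩ := exists_image_basis f.hom m b c
    refine g.orientation_preserving _ b' (f.orientation_preserving m b hb b' hb') b'' fun i => ?_
    rw [hb']
    exact h i⟩

/-- The functor forgetting the orientation. -/
noncomputable def forget : OMVB.{u} 𝕜 p q ⥤ MVB.{u} 𝕜 p q where
  obj V := V.toMVB
  map f := Hom.hom f

end OMVB

/-- An identification of the values of a functor `F` to principal bundles with bundles of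
orthonormal frames: each point of the principal bundle gives a linear isometry from `𝕜 ^ (p + q)`
onto a fibre of the vector bundle, over the same base point up to the natural isomorphism
`baseIso`, smoothly, equivariantly for the principal right action, and naturally. -/
structure FrameIdentification {G : LieGrp} (lam : EffectiveAction G (vecMfd 𝕜 p q))
    {C : Type*} [Category C] (U : C ⥤ MVB.{u} 𝕜 p q) (F : C ⥤ PrincipalBundle.{u} G) where
  baseIso : F ⋙ GBundle.forget ⋙ FibreBundle.baseFunctor ≅
    U ⋙ MVB.forget ⋙ FibreBundle.baseFunctor
  frame : ∀ X : C, (F.obj X).bundle.total → (Fin p ⊕ Fin q → 𝕜) → (U.obj X).bundle.total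
  smooth : ∀ X, ContMDiff ((F.obj X).bundle.total.I.prod 𝓘(ℝ, Fin p ⊕ Fin q → 𝕜))
    (U.obj X).bundle.total.I ∞
    fun a : (F.obj X).bundle.total × (Fin p ⊕ Fin q → 𝕜) => frame X a.1 a.2
  proj_frame : ∀ X a v, (U.obj X).bundle.proj (frame X a v) =
    (baseIso.hom.app X).toFun ((F.obj X).bundle.proj a)
  linear : ∀ X a (m : (U.obj X).bundle.base) (h : ∀ v, (U.obj X).bundle.proj (frame X a v) = m),
    IsLinearMap 𝕜 fun v => (U.obj X).pt (frame X a v) (h v)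
  isometry : ∀ X a (m : (U.obj X).bundle.base)
    (h : ∀ v, (U.obj X).bundle.proj (frame X a v) = m) (v w : Fin p ⊕ Fin q → 𝕜),
    (U.obj X).metric ((U.obj X).pt (frame X a v) (h v)) ((U.obj X).pt (frame X a w) (h w)) =
      pqForm v w
  equivariant : ∀ X, ∀ e ∈ (F.obj X).str.atlas, ∀ m ∈ e.baseSet, ∀ g h : G, ∀ v,
    frame X (e.toOpenPartialHomeomorph.symm (m, g * h)) v =
      frame X (e.toOpenPartialHomeomorph.symm (m, g)) (lam.act h v)
  natural : ∀ {X Y} (f : X ⟶ Y) a v,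
    frame Y ((F.map f).hom.total.toFun a) v = (U.map f).hom.total.toFun (frame X a v)

end Metrised

/-! The analytic core is that smooth orthonormal frames exist locally. At one point the Gram matrix
of a linear frame is brought to the standard matrix `η` by Sylvester's law of inertia
(`exists_conj_eq_pqMatrix`). After this constant change of frame the Gram matrices `A` at nearby
points are Hermitian and close to `η`, and `exp (-log (η A) / 2)` carries them back to `η`, smoothly
in `A` (`exists_smooth_conj_eq_pqMatrix`). So isometric trivialisations cover the base
(`MVB.exists_isometric`).

Two isometric trivialisations differ by isometries of the standard form, that is by elements of
`O(𝕜, (p, q))`, and these depend smoothly on the point because their matrix entries do. The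
isometric trivialisations therefore form a maximal atlas. Conversely, such an atlas transports the
vector space structure and the form of the standard fibre to each fibre, and the result does not
depend on the trivialisation used. Both passages keep the underlying fibre bundle and are inverse to
each other as equalities, whence an isomorphism of categories.

Passing to principal bundles is a general fact about an effective action (`GBundle.frameFunctor`): a
bundle is sent to the principal bundle with the same cocycle. A point of the latter defines a map
from the standard fibre to a fibre and is determined by it, by effectiveness
(`GBundle.frame_injective`). Bundle maps act on such frames by composition and are recovered from
this action; the associated bundle, built again from the same cocycle, gives essential surjectivity.
For the orthogonal group these frames are the orthonormal ones.

In the oriented case the extra input is that elements of `O(𝕜, (p, q))` have determinant of absolute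
value one, so a positive determinant equals one. An orthonormal frame is made positive by
multiplying a single vector by a smooth phase (a sign over `ℝ`). The structure group is then `SO(𝕜,
(p, q))`, and the general fact applies again. -/

/-! ### Compatible trivialisations, maximal atlases, and bundle maps tested locally. -/

section GTools

variable {G : LieGrp} {S : Mfd.{0}} (lam : EffectiveAction G S)

/-- A map that is locally given by smooth `G`-valued functions is given by a single smooth
`G`-valued function, as the action is effective. -/
theorem EffectiveAction.exists_smooth_of_local {M : Mfd.{u}} {W : Set M} {T : M → S → S}
    (hloc : ∀ m ∈ W, ∃ V : Set M, IsOpen V ∧ m ∈ V ∧ ∃ h : M → G,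
      ContMDiffOn M.I G.I ∞ h (W ∩ V) ∧ ∀ x ∈ W ∩ V, ∀ s, T x s = lam.act (h x) s) :
    ∃ H : M → G, ContMDiffOn M.I G.I ∞ H W ∧ ∀ m ∈ W, ∀ s, T m s = lam.act (H m) s := by
  classical
  -- Effectiveness makes the group element unique, so the choice agrees with every local smooth `h`.
  -- The value `1` is only reached off `W`.
  let H : M → G := fun x => if hx : ∃ a : G, ∀ s, T x s = lam.act a s then hx.choose else 1
  have hH : ∀ x (a : G), (∀ s, T x s = lam.act a s) → H x = a := by
    intro x a ha
    have hx : ∃ a : G, ∀ s, T x s = lam.act a s := ⟨a, ha⟩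
    simp only [H, dif_pos hx]
    exact lam.act_injective fun s => by rw [← hx.choose_spec, ha]
  refine ⟨H, ?_, ?_⟩
  · intro m hm
    obtain ⟨V, hV, hmV, h, hs, hT⟩ := hloc m hm
    have h1 : ContMDiffWithinAt M.I G.I ∞ H (W ∩ V) m :=
      (hs m ⟨hm, hmV⟩).congr (fun y hy => hH y _ (hT y hy)) (hH m _ (hT m ⟨hm, hmV⟩))
    exact (contMDiffWithinAt_inter (hV.mem_nhds hmV)).1 h1
  · intro m hm s
    obtain ⟨V, hV, hmV, h, hs, hT⟩ := hloc m hm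
    rw [hH m _ (hT m ⟨hm, hmV⟩)]
    exact hT m ⟨hm, hmV⟩ s

@[simp] theorem EffectiveAction.act_inv_act (g : G) (s : S) :
    lam.act g (lam.act g⁻¹ s) = s := by
  rw [← lam.mul_act, mul_inv_cancel, lam.one_act]

theorem EffectiveAction.contMDiffOn_act {M : Mfd.{u}} {g : M → G} {U : Set M}
    (hg : ContMDiffOn M.I G.I ∞ g U) :
    ContMDiffOn (M.I.prod S.I) (M.I.prod S.I) ∞ (fun x : M × S => (x.1, lam.act (g x.1) x.2))
      (U ×ˢ Set.univ) := by
  refine contMDiffOn_fst.prodMk ?_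
  refine lam.smooth.comp_contMDiffOn (f := fun x : M × S => (g x.1, x.2)) ?_
  exact (hg.comp contMDiffOn_fst fun x hx => hx.1).prodMk contMDiffOn_snd

variable {F M : Mfd.{u}} {π : F → M} {lam}

theorem Bundle.Trivialization.symm_eq_of_apply_eq {e : Bundle.Trivialization S π} {x : F} {m : M}
    {s : S} (hx : π x = m) (hm : m ∈ e.baseSet) (h : (e x).2 = s) :
    e.toOpenPartialHomeomorph.symm (m, s) = x := by
  subst hx h
  exact e.symm_apply_mk_proj (e.mem_source.2 hm)

theorem Bundle.Trivialization.snd_apply_symm (e : Bundle.Trivialization S π) {m : M}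
    (hm : m ∈ e.baseSet) (s : S) : (e (e.toOpenPartialHomeomorph.symm (m, s))).2 = s := by
  rw [e.apply_symm_apply' hm]

theorem Bundle.Trivialization.ext_of_mem (e : Bundle.Trivialization S π) {x y : F}
    (hx : π x ∈ e.baseSet) (hxy : π x = π y) (h : (e x).2 = (e y).2) : x = y := by
  rw [← e.symm_eq_of_apply_eq (x := x) rfl hx rfl, e.symm_eq_of_apply_eq hxy.symm hx h.symm]

namespace Compatible

variable {e e' e'' : Bundle.Trivialization S π}

/-- Compatibility is a local property: the first component of a change of trivialisation is forced,
and local functions `g` agree where they overlap, by effectiveness. -/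
theorem of_local (h : ∀ m ∈ e.baseSet ∩ e'.baseSet, ∃ V : Set M, IsOpen V ∧ m ∈ V ∧ ∃ g : M → G,
      ContMDiffOn M.I G.I ∞ g ((e.baseSet ∩ e'.baseSet) ∩ V) ∧
      ∀ x ∈ (e.baseSet ∩ e'.baseSet) ∩ V, ∀ s,
        (e (e'.toOpenPartialHomeomorph.symm (x, s))).2 = lam.act (g x) s) :
    Compatible lam e e' := by
  obtain ⟨H, hH, hT⟩ := lam.exists_smooth_of_local
    (T := fun m s => (e (e'.toOpenPartialHomeomorph.symm (m, s))).2) h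
  refine ⟨H, hH, fun m hm s => Prod.ext ?_ (hT m hm s)⟩
  have hp := e'.proj_symm_apply' (x := s) hm.2
  rw [e.coe_fst' (by rw [hp]; exact hm.1), hp]

theorem symm (h : Compatible lam e e') : Compatible lam e' e := by
  obtain ⟨g, hg, h⟩ := h
  refine ⟨fun m => (g m)⁻¹, ContMDiffOn.inv (I := G.I) (hg.mono fun x hx => ⟨hx.2, hx.1⟩),
    fun m hm s => ?_⟩
  have h1 := h m ⟨hm.2, hm.1⟩ (lam.act (g m)⁻¹ s)
  rw [lam.act_inv_act] at h1
  have hp := e'.proj_symm_apply' (x := lam.act (g m)⁻¹ s) hm.1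
  rw [e.symm_eq_of_apply_eq hp hm.2 (congrArg Prod.snd h1), e'.apply_symm_apply' hm.1]

/-- A single intermediate trivialisation says nothing outside its base set, so the intermediate `e'`
may vary with the point of the overlap. Near that point the two transition functions multiply. -/
theorem trans_of_local (h : ∀ m ∈ e.baseSet ∩ e''.baseSet, ∃ e' : Bundle.Trivialization S π,
    m ∈ e'.baseSet ∧ Compatible lam e e' ∧ Compatible lam e' e'') : Compatible lam e e'' := by
  refine of_local fun m hm => ?_
  obtain ⟨e', hm', ⟨g, hg, hg'⟩, k, hk, hk'⟩ := h m hm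
  refine ⟨e'.baseSet, e'.open_baseSet, hm', fun x => g x * k x, ?_, fun x hx s => ?_⟩
  · exact ContMDiffOn.mul (I := G.I) (hg.mono fun x hx => ⟨hx.1.1, hx.2⟩)
      (hk.mono fun x hx => ⟨hx.2, hx.1.2⟩)
  · have h1 := congrArg Prod.snd (hk' x ⟨hx.2, hx.1.2⟩ s)
    rw [← e'.symm_eq_of_apply_eq (e''.proj_symm_apply' hx.1.2) hx.2 h1, hg' x ⟨hx.1.1, hx.2⟩,
      lam.mul_act]

end Compatible

/-- The maximal atlas generated by a covering family of compatible smooth trivialisations. -/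
def GStructure.generate {B : FibreBundle.{u} S} (E : Set (Bundle.Trivialization S B.proj))
    (smooth : ∀ e ∈ E, IsSmoothTriv e) (cover : ∀ m, ∃ e ∈ E, m ∈ e.baseSet)
    (compatible : ∀ e ∈ E, ∀ e' ∈ E, Compatible lam e e') : GStructure lam B where
  atlas := {e | IsSmoothTriv e ∧ ∀ e' ∈ E, Compatible lam e e'}
  smooth _ he := he.1
  cover m := let ⟨e, he, hm⟩ := cover m; ⟨e, ⟨smooth e he, compatible e he⟩, hm⟩
  compatible _ he _ he' := Compatible.trans_of_local fun m _ =>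
    let ⟨e₁, he₁, hm⟩ := cover m; ⟨e₁, hm, he.2 e₁ he₁, (he'.2 e₁ he₁).symm⟩
  maximal _ hs he := ⟨hs, fun e' he' => he e' ⟨smooth e' he', compatible e' he'⟩⟩

theorem GStructure.ext_atlas {B : FibreBundle.{u} S} {A A' : GStructure lam B}
    (h : A.atlas = A'.atlas) : A = A' := by
  cases A; cases A'; cases h; rfl

namespace GBundle

/-- The transition function between trivialisations of the atlas. -/
theorem exists_transition (X : GBundle.{u} lam) {e e' : Bundle.Trivialization S X.bundle.proj}
    (he : e ∈ X.str.atlas) (he' : e' ∈ X.str.atlas) : ∃ g : X.bundle.base → G,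
    ContMDiffOn X.bundle.base.I G.I ∞ g (e.baseSet ∩ e'.baseSet) ∧
    ∀ m ∈ e.baseSet ∩ e'.baseSet, ∀ s, e.toOpenPartialHomeomorph.symm (m, s) =
      e'.toOpenPartialHomeomorph.symm (m, lam.act (g m) s) := by
  obtain ⟨g, hg, h⟩ := X.str.compatible e' he' e he
  refine ⟨g, hg.mono fun x hx => ⟨hx.2, hx.1⟩, fun m hm s => ?_⟩
  exact (e'.symm_eq_of_apply_eq (e.proj_symm_apply' hm.1) hm.2
    (congrArg Prod.snd (h m ⟨hm.2, hm.1⟩ s))).symm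

theorem exists_eq_symm (X : GBundle.{u} lam) (x : X.bundle.total) :
    ∃ e ∈ X.str.atlas, ∃ m ∈ e.baseSet, ∃ s, x = e.toOpenPartialHomeomorph.symm (m, s) := by
  obtain ⟨e, he, hm⟩ := X.str.cover (X.bundle.proj x)
  exact ⟨e, he, _, hm, _, (e.symm_apply_mk_proj (e.mem_source.2 hm)).symm⟩

/-- In suitable trivialisations near each point, `t` is of the form `(m, s) ↦ (b m, h m • s)`. -/
def IsLocallyG (X Y : GBundle.{u} lam) (b : X.bundle.base ⟶ Y.bundle.base)
    (t : X.bundle.total → Y.bundle.total) : Prop :=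
  ∀ m, ∃ e ∈ X.str.atlas, m ∈ e.baseSet ∧ ∃ e' ∈ Y.str.atlas, b.toFun m ∈ e'.baseSet ∧
    ∃ h : X.bundle.base → G, ContMDiffOn X.bundle.base.I G.I ∞ h
      (e.baseSet ∩ b.toFun ⁻¹' e'.baseSet) ∧
    ∀ x ∈ e.baseSet ∩ b.toFun ⁻¹' e'.baseSet, ∀ s, t (e.toOpenPartialHomeomorph.symm (x, s)) =
      e'.toOpenPartialHomeomorph.symm (b.toFun x, lam.act (h x) s)

variable {X Y : GBundle.{u} lam} {b : X.bundle.base ⟶ Y.bundle.base}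
  {t : X.bundle.total → Y.bundle.total}

theorem IsLocallyG.comm (H : IsLocallyG X Y b t) (x : X.bundle.total) :
    Y.bundle.proj (t x) = b.toFun (X.bundle.proj x) := by
  obtain ⟨e, he, hm, e', he', hm', h, hh, hT⟩ := H (X.bundle.proj x)
  have h1 := hT _ ⟨hm, hm'⟩ (e x).2
  rw [e.symm_apply_mk_proj (e.mem_source.2 hm)] at h1
  rw [h1, e'.proj_symm_apply' hm']

/-- No smoothness of `t` is assumed: near `x` it is the composite of `e`, the base map together with
the action of `h`, and the inverse of `e'`. -/
theorem IsLocallyG.contMDiff (H : IsLocallyG X Y b t) :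
    ContMDiff X.bundle.total.I Y.bundle.total.I ∞ t := by
  intro x
  obtain ⟨e, he, hm, e', he', hm', h, hh, hT⟩ := H (X.bundle.proj x)
  set W := e.baseSet ∩ b.toFun ⁻¹' e'.baseSet with hW
  have hWo : IsOpen W := e.open_baseSet.inter (e'.open_baseSet.preimage b.smooth.continuous)
  have hU : X.bundle.proj ⁻¹' W ∈ 𝓝 x :=
    (hWo.preimage X.bundle.smooth_proj.continuous).mem_nhds ⟨hm, hm'⟩
  refine ContMDiffOn.contMDiffAt (s := X.bundle.proj ⁻¹' W) ?_ hU
  have h1 : ContMDiffOn X.bundle.total.I (X.bundle.base.I.prod S.I) ∞ e (X.bundle.proj ⁻¹' W) :=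
    (X.str.smooth e he).1.mono fun y hy => e.mem_source.2 hy.1
  have h2 := (lam.contMDiffOn_act hh).comp h1 fun y hy =>
    ⟨by rw [e.coe_fst' hy.1]; exact hy, trivial⟩
  have h3 : ContMDiffOn X.bundle.total.I (Y.bundle.base.I.prod S.I) ∞
      (fun y => (b.toFun (e y).1, lam.act (h (e y).1) (e y).2)) (X.bundle.proj ⁻¹' W) :=
    (b.smooth.comp_contMDiffOn (contMDiff_fst.comp_contMDiffOn h2)).prodMk
      (contMDiff_snd.comp_contMDiffOn h2)
  refine ((Y.str.smooth e' he').2.comp h3 fun y hy => ?_).congr fun y hy => ?_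
  · rw [Set.mem_preimage, e'.mem_target, e.coe_fst' hy.1]
    exact hy.2
  · have h4 := hT _ hy (e y).2
    rw [e.symm_apply_mk_proj (e.mem_source.2 hy.1)] at h4
    rw [h4, Function.comp_apply, e.coe_fst' hy.1]

/-- A map that is of the required form in suitable trivialisations is a map of `G`-bundles. -/
def IsLocallyG.toHom (H : IsLocallyG X Y b t) : X ⟶ Y where
  hom := { base := b, total := ⟨t, H.contMDiff⟩, comm := H.comm }
  locally_G e he e' he' := by
    obtain ⟨K, hK, hT⟩ := lam.exists_smooth_of_local (W := e.baseSet ∩ b.toFun ⁻¹' e'.baseSet)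
      (T := fun m s => (e' (t (e.toOpenPartialHomeomorph.symm (m, s)))).2) (by
        intro m hm
        obtain ⟨f, hf, hfm, f', hf', hfm', h, hh, hT⟩ := H m
        obtain ⟨g, hg, hg'⟩ := X.exists_transition he hf
        obtain ⟨k, hk, hk'⟩ := Y.exists_transition hf' he'
        -- From `e` to `f`, through the map, then from `f'` to `e'`: the three group elements
        -- multiply in this order.
        refine ⟨f.baseSet ∩ b.toFun ⁻¹' f'.baseSet,
          f.open_baseSet.inter (f'.open_baseSet.preimage b.smooth.continuous), ⟨hfm, hfm'⟩,
          fun x => k (b.toFun x) * (h x * g x), ?_, fun x hx s => ?_⟩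
        · refine ContMDiffOn.mul (I := G.I) ?_ (ContMDiffOn.mul (I := G.I) ?_ ?_)
          · exact hk.comp b.smooth.contMDiffOn fun x hx => ⟨hx.2.2, hx.1.2⟩
          · exact hh.mono fun x hx => hx.2
          · exact hg.mono fun x hx => ⟨hx.1.1, hx.2.1⟩
        · dsimp only
          rw [hg' x ⟨hx.1.1, hx.2.1⟩, hT x hx.2, hk' _ ⟨hx.2.2, hx.1.2⟩,
            e'.snd_apply_symm hx.1.2, lam.mul_act, lam.mul_act])
    refine ⟨K, hK, fun m hm s => Prod.ext ?_ (hT m hm s)⟩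
    have hp : Y.bundle.proj (t (e.toOpenPartialHomeomorph.symm (m, s))) = b.toFun m := by
      rw [H.comm, e.proj_symm_apply' hm.1]
    exact (e'.coe_fst' (by rw [hp]; exact hm.2)).trans hp

theorem Hom.exists_symm (f : X ⟶ Y) {e : Bundle.Trivialization S X.bundle.proj}
    (he : e ∈ X.str.atlas) {e' : Bundle.Trivialization S Y.bundle.proj} (he' : e' ∈ Y.str.atlas) :
    ∃ h : X.bundle.base → G, ContMDiffOn X.bundle.base.I G.I ∞ h
      (e.baseSet ∩ f.hom.base.toFun ⁻¹' e'.baseSet) ∧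
    ∀ x ∈ e.baseSet ∩ f.hom.base.toFun ⁻¹' e'.baseSet, ∀ s,
      f.hom.total.toFun (e.toOpenPartialHomeomorph.symm (x, s)) =
      e'.toOpenPartialHomeomorph.symm (f.hom.base.toFun x, lam.act (h x) s) := by
  obtain ⟨h, hh, hT⟩ := f.locally_G e he e' he'
  refine ⟨h, hh, fun x hx s => (e'.symm_eq_of_apply_eq ?_ hx.2
    (congrArg Prod.snd (hT x hx s))).symm⟩
  rw [f.hom.comm, e.proj_symm_apply' hx.1]

end GBundle

end GTools

/-! ### A smooth structure from local homeomorphisms to a manifold. -/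

section GlueCharts

variable {T : Type*} [TopologicalSpace T] {N H E ι : Type*} [NormedAddCommGroup E]
  [NormedSpace ℝ E] [TopologicalSpace H] (I : ModelWithCorners ℝ E H) [TopologicalSpace N]
  [ChartedSpace H N] (φ : ι → OpenPartialHomeomorph T N)

/-- The charts obtained from local homeomorphisms to a manifold. -/
@[reducible] noncomputable def chartedSpaceOfLocal (cover : ∀ x, ∃ i, x ∈ (φ i).source) :
    ChartedSpace H T where
  atlas := {f | ∃ i, ∃ c ∈ atlas H N, f = φ i ≫ₕ c}
  chartAt x := φ (cover x).choose ≫ₕ chartAt H (φ (cover x).choose x)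
  mem_chart_source x := by
    rw [OpenPartialHomeomorph.trans_source]
    exact ⟨(cover x).choose_spec, mem_chart_source H _⟩
  chart_mem_atlas x := ⟨_, _, chart_mem_atlas H _, rfl⟩

variable [IsManifold I ∞ N] (cover : ∀ x, ∃ i, x ∈ (φ i).source)
  (smooth : ∀ i j, ContMDiffOn I I ∞ ((φ i).symm ≫ₕ φ j) ((φ i).symm ≫ₕ φ j).source)

include smooth in
-- A change of charts is a change between two of the maps `φ i`, smooth by hypothesis, between an
-- inverse chart and a chart of `N`.
theorem isManifold_of_local : letI := chartedSpaceOfLocal (H := H) φ cover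
    IsManifold I ∞ T := by
  let _ := chartedSpaceOfLocal (H := H) φ cover
  refine isManifold_of_contDiffOn _ _ _ ?_
  rintro _ _ ⟨i, c, hc, rfl⟩ ⟨j, d, hd, rfl⟩
  have h1 := contMDiffOn_symm_of_mem_maximalAtlas
    (IsManifold.subset_maximalAtlas (I := I) (n := ∞) hc)
  have h2 := contMDiffOn_of_mem_maximalAtlas
    (IsManifold.subset_maximalAtlas (I := I) (n := ∞) hd)
  set W := ((φ i ≫ₕ c).symm ≫ₕ φ j ≫ₕ d).source with hW
  have hmem : ∀ y ∈ W, y ∈ c.target ∧ c.symm y ∈ ((φ i).symm ≫ₕ φ j).source ∧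
      ((φ i).symm ≫ₕ φ j) (c.symm y) ∈ d.source := by
    intro y hy
    simp only [hW, OpenPartialHomeomorph.trans_source, OpenPartialHomeomorph.symm_source, Set.mem_inter_iff, Set.mem_preimage,
      OpenPartialHomeomorph.trans_symm_eq_symm_trans_symm, OpenPartialHomeomorph.coe_trans,
      Function.comp_apply] at hy ⊢
    exact ⟨hy.1.1, ⟨hy.1.2, hy.2.1⟩, hy.2.2⟩
  have h3 : ContMDiffOn I I ∞ (d ∘ ((φ i).symm ≫ₕ φ j) ∘ c.symm) W :=
    h2.comp ((smooth i j).comp (h1.mono fun y hy => (hmem y hy).1) fun y hy => (hmem y hy).2.1)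
      fun y hy => (hmem y hy).2.2
  have h4 := (I.contMDiff (n := ∞)).comp_contMDiffOn h3
  have h5 := h4.comp ((I.contMDiffOn_symm (n := ∞)).mono Set.inter_subset_right)
    (s := I.symm ⁻¹' W ∩ Set.range I) fun x hx => hx.1
  exact contMDiffOn_iff_contDiffOn.1 h5

include smooth in
-- This identifies the new structure as the intended one: each `φ i` is a diffeomorphism onto its
-- target. Indeed `φ i` followed by a chart of `N` is a chart of `T`, and the chart of `N` can be
-- undone.
theorem contMDiffOn_of_local (i : ι) : letI := chartedSpaceOfLocal (H := H) φ cover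
    ContMDiffOn I I ∞ (φ i) (φ i).source ∧ ContMDiffOn I I ∞ (φ i).symm (φ i).target := by
  let _ := chartedSpaceOfLocal (H := H) φ cover
  have := isManifold_of_local I φ cover smooth
  have hc : ∀ y : N, chartAt H y ∈ IsManifold.maximalAtlas I ∞ N := fun y =>
    IsManifold.chart_mem_maximalAtlas y
  have hf : ∀ y : N, φ i ≫ₕ chartAt H y ∈ IsManifold.maximalAtlas I ∞ T := fun y =>
    IsManifold.subset_maximalAtlas ⟨i, _, chart_mem_atlas H y, rfl⟩
  constructor
  · intro x hx
    set c := chartAt H (φ i x) with hcdef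
    have hcx : φ i x ∈ c.source := mem_chart_source H _
    have h1 := contMDiffAt_of_mem_maximalAtlas (x := x) (hf (φ i x)) (by
      rw [OpenPartialHomeomorph.trans_source]; exact ⟨hx, hcx⟩)
    have h2 : ContMDiffAt I I ∞ c.symm ((φ i ≫ₕ c) x) :=
      contMDiffAt_symm_of_mem_maximalAtlas (hc _) (c.map_source hcx)
    refine ContMDiffAt.contMDiffWithinAt ((h2.comp x h1).congr_of_eventuallyEq ?_)
    have hev : ∀ᶠ y in 𝓝 x, φ i y ∈ c.source :=
      ((φ i).continuousAt hx).eventually (c.open_source.mem_nhds hcx)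
    filter_upwards [hev] with y hy
    exact (c.left_inv hy).symm
  · intro y hy
    set c := chartAt H y with hcdef
    have hcy : y ∈ c.source := mem_chart_source H _
    have h1 := contMDiffAt_of_mem_maximalAtlas (hc y) hcy
    have h2 : ContMDiffAt I I ∞ (φ i ≫ₕ c).symm (c y) :=
      contMDiffAt_symm_of_mem_maximalAtlas (hf y) (by
        rw [OpenPartialHomeomorph.trans_target]
        exact ⟨c.map_source hcy, by simpa [c.left_inv hcy] using hy⟩)
    refine ContMDiffAt.contMDiffWithinAt ((h2.comp y h1).congr_of_eventuallyEq ?_)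
    filter_upwards [c.open_source.mem_nhds hcy] with z hz
    simp [OpenPartialHomeomorph.trans_symm_eq_symm_trans_symm, c.left_inv hz]

end GlueCharts

/-! ### Hausdorffness and second countability of a total space. -/

section Trivs

variable {B F Z ι : Type*} [TopologicalSpace B] [TopologicalSpace F] [TopologicalSpace Z]
  {π : Z → B} (e : ι → Bundle.Trivialization F π) (cover : ∀ b, ∃ i, b ∈ (e i).baseSet)

include cover in
-- Points over the same base point lie in one trivialisation and are separated in its product; other
-- points are separated already in the base.
theorem t2Space_of_trivializations [T2Space B] [T2Space F] (hπ : Continuous π) : T2Space Z := by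
  refine ⟨fun x y hxy => ?_⟩
  by_cases h : π x = π y
  · obtain ⟨i, hi⟩ := cover (π x)
    have hx : x ∈ (e i).source := (e i).mem_source.2 hi
    have hy : y ∈ (e i).source := (e i).mem_source.2 (h ▸ hi)
    have hne : e i x ≠ e i y := fun heq => hxy ((e i).injOn hx hy heq)
    obtain ⟨U, V, hU, hV, hxU, hyV, hUV⟩ := t2_separation hne
    have hc : ContinuousOn (e i) (e i).source := (e i).continuousOn_toFun
    refine ⟨(e i).source ∩ e i ⁻¹' U, (e i).source ∩ e i ⁻¹' V,
      hc.isOpen_inter_preimage (e i).open_source hU,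
      hc.isOpen_inter_preimage (e i).open_source hV, ⟨hx, hxU⟩, ⟨hy, hyV⟩, ?_⟩
    exact Set.disjoint_left.2 fun z hz hz' => Set.disjoint_left.1 hUV hz.2 hz'.2
  · obtain ⟨U, V, hU, hV, hxU, hyV, hUV⟩ := t2_separation h
    exact ⟨_, _, hU.preimage hπ, hV.preimage hπ, hxU, hyV, hUV.preimage π⟩

include cover in
-- By the Lindelöf property of the base, countably many base sets suffice, and over each of them the
-- total space is a second countable product.
theorem secondCountable_of_trivializations [SecondCountableTopology B]
    [SecondCountableTopology F] : SecondCountableTopology Z := by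
  obtain ⟨t, ht, hU⟩ := TopologicalSpace.isOpen_iUnion_countable (fun i => (e i).baseSet)
    fun i => (e i).open_baseSet
  have hc : Countable t := ht.to_subtype
  have : ∀ i : t, SecondCountableTopology (e i).source := fun i =>
    (e i).sourceHomeomorphBaseSetProd.secondCountableTopology
  refine TopologicalSpace.secondCountableTopology_of_countable_cover
    (U := fun i : t => (e i).source) (fun i => (e i).open_source) ?_
  refine Set.eq_univ_of_forall fun x => ?_
  have hx : π x ∈ ⋃ i ∈ t, (e i).baseSet := by
    rw [hU]; exact Set.mem_iUnion.2 (cover _)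
  obtain ⟨i, hi, hx⟩ := Set.mem_iUnion₂.1 hx
  exact Set.mem_iUnion.2 ⟨⟨i, hi⟩, (e i).mem_source.2 hx⟩

end Trivs

/-! ### Smooth fibre bundles from trivialisations with smooth changes. -/

section OfTrivs

variable {S : Mfd.{0}} {M : Mfd.{u}} {Z ι : Type u} [TopologicalSpace Z] {π : Z → M}
  (e : ι → Bundle.Trivialization S π) (cover : ∀ b, ∃ i, b ∈ (e i).baseSet) (hπ : Continuous π)
  (smooth : ∀ i j, ContMDiffOn (M.I.prod S.I) (M.I.prod S.I) ∞
    (fun x => e j ((e i).toOpenPartialHomeomorph.symm x))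
    (((e i).baseSet ∩ (e j).baseSet) ×ˢ Set.univ))

include smooth in
theorem contMDiffOn_symm_trans_trivializations (i j : ι) :
    ContMDiffOn (M.I.prod S.I) (M.I.prod S.I) ∞
      ((e i).toOpenPartialHomeomorph.symm ≫ₕ (e j).toOpenPartialHomeomorph)
      ((e i).toOpenPartialHomeomorph.symm ≫ₕ (e j).toOpenPartialHomeomorph).source := by
  refine (smooth i j).mono fun x hx => ?_
  have h1 : x.1 ∈ (e i).baseSet := (e i).mem_target.1 hx.1
  have h2 : π ((e i).toOpenPartialHomeomorph.symm x) ∈ (e j).baseSet := (e j).mem_source.1 hx.2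
  rw [(e i).proj_symm_apply hx.1] at h2
  exact ⟨⟨h1, h2⟩, trivial⟩

theorem exists_mem_source_of_cover (cover : ∀ b, ∃ i, b ∈ (e i).baseSet) (x : Z) :
    ∃ i, x ∈ (e i).toOpenPartialHomeomorph.source :=
  (cover (π x)).imp fun i hi => (e i).mem_source.2 hi

/-- The total space of a bundle with smooth changes of trivialisations, as a manifold. -/
noncomputable def Mfd.ofTrivializations : Mfd.{u} where
  carrier := Z
  model := M.model × S.model
  t2 := t2Space_of_trivializations e cover hπ
  sct := secondCountable_of_trivializations e cover
  charted := chartedSpaceOfLocal (H := ModelProd M.model S.model)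
    (fun i => (e i).toOpenPartialHomeomorph) (exists_mem_source_of_cover e cover)
  mfd := by
    rw [modelWithCornersSelf_prod]
    exact isManifold_of_local (M.I.prod S.I) (fun i => (e i).toOpenPartialHomeomorph)
      (exists_mem_source_of_cover e cover) (contMDiffOn_symm_trans_trivializations e smooth)

theorem isSmoothTriv_ofTrivializations (i : ι) :
    IsSmoothTriv (F := Mfd.ofTrivializations e cover hπ smooth) (e i) := by
  have h := contMDiffOn_of_local (M.I.prod S.I) (fun i => (e i).toOpenPartialHomeomorph)
    (exists_mem_source_of_cover e cover) (contMDiffOn_symm_trans_trivializations e smooth) i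
  have hI : (Mfd.ofTrivializations e cover hπ smooth).I = M.I.prod S.I :=
    modelWithCornersSelf_prod
  unfold IsSmoothTriv
  rw [hI]
  exact h

/-- The resulting fibre bundle. -/
noncomputable def FibreBundle.ofTrivializations : FibreBundle.{u} S where
  base := M
  total := Mfd.ofTrivializations e cover hπ smooth
  proj := π
  smooth_proj x := by
    obtain ⟨i, hi⟩ := cover (π x)
    have hx : x ∈ (e i).source := (e i).mem_source.2 hi
    have h1 := (isSmoothTriv_ofTrivializations e cover hπ smooth i).1.contMDiffAt
      ((e i).open_source.mem_nhds hx)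
    have h2 := (contMDiff_fst (I := M.I) (J := S.I) (n := ∞) (e i x)).comp x h1
    refine h2.congr_of_eventuallyEq ?_
    filter_upwards [(e i).open_source.mem_nhds hx] with y hy
    exact ((e i).coe_fst hy).symm
  locally_trivial m := let ⟨i, hi⟩ := cover m
    ⟨e i, hi, isSmoothTriv_ofTrivializations e cover hπ smooth i⟩

end OfTrivs

/-! ### Bundles built from cocycles, and the cocycle of a bundle. -/

/-- A smooth cocycle on `M` with values in `G`. -/
structure Cocycle (G : LieGrp) (M : Mfd.{u}) (ι : Type u) where
  baseSet : ι → Set M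
  isOpen_baseSet : ∀ i, IsOpen (baseSet i)
  indexAt : M → ι
  mem_baseSet_at : ∀ x, x ∈ baseSet (indexAt x)
  g : ι → ι → M → G
  smooth : ∀ i j, ContMDiffOn M.I G.I ∞ (g i j) (baseSet i ∩ baseSet j)
  g_self : ∀ i, ∀ x ∈ baseSet i, g i i x = 1
  g_comp : ∀ i j k, ∀ x ∈ baseSet i ∩ baseSet j ∩ baseSet k, g j k x * g i j x = g i k x

namespace Cocycle

variable {G : LieGrp} {S : Mfd.{0}} (lam : EffectiveAction G S) {M : Mfd.{u}} {ι : Type u}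
  (Z : Cocycle G M ι)

/-- The topological bundle with a given cocycle. -/
def core : FiberBundleCore ι M S where
  baseSet := Z.baseSet
  isOpen_baseSet := Z.isOpen_baseSet
  indexAt := Z.indexAt
  mem_baseSet_at := Z.mem_baseSet_at
  coordChange i j x s := lam.act (Z.g i j x) s
  coordChange_self i x hx s := by rw [Z.g_self i x hx, lam.one_act]
  continuousOn_coordChange i j :=
    (contMDiff_snd.comp_contMDiffOn (lam.contMDiffOn_act (Z.smooth i j))).continuousOn
  coordChange_comp i j k x hx s := by rw [← lam.mul_act, Z.g_comp i j k x hx]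

theorem localTriv_symm (i j : ι) {m : M} (hm : m ∈ Z.baseSet i ∩ Z.baseSet j) (s : S) :
    ((Z.core lam).localTriv i).toOpenPartialHomeomorph.symm (m, s) =
      ((Z.core lam).localTriv j).toOpenPartialHomeomorph.symm (m, lam.act (Z.g i j m) s) := by
  rw [FiberBundleCore.localTriv_symm_apply, FiberBundleCore.localTriv_symm_apply]
  exact congrArg _ ((Z.core lam).coordChange_comp i j _ m ⟨hm, Z.mem_baseSet_at m⟩ s).symm

theorem localTriv_apply_symm (i j : ι) {m : M} (hm : m ∈ Z.baseSet i ∩ Z.baseSet j) (s : S) :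
    (Z.core lam).localTriv j (((Z.core lam).localTriv i).toOpenPartialHomeomorph.symm (m, s)) =
      (m, lam.act (Z.g i j m) s) := by
  rw [Z.localTriv_symm lam i j hm]
  exact ((Z.core lam).localTriv j).apply_symm_apply' hm.2

theorem smooth_localTriv (i j : ι) : ContMDiffOn (M.I.prod S.I) (M.I.prod S.I) ∞
    (fun x => (Z.core lam).localTriv j
      (((Z.core lam).localTriv i).toOpenPartialHomeomorph.symm x))
    ((((Z.core lam).localTriv i).baseSet ∩ ((Z.core lam).localTriv j).baseSet) ×ˢ Set.univ) :=
  (lam.contMDiffOn_act (Z.smooth i j)).congr fun x hx => Z.localTriv_apply_symm lam i j hx.1 x.2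

/-- The smooth fibre bundle with a given cocycle. -/
noncomputable def bundle : FibreBundle.{u} S :=
  FibreBundle.ofTrivializations (fun i => (Z.core lam).localTriv i)
    (fun b => ⟨Z.indexAt b, Z.mem_baseSet_at b⟩) (Z.core lam).continuous_proj
    (Z.smooth_localTriv lam)

/-- The local trivialisations of the bundle with a given cocycle. -/
noncomputable def triv (i : ι) : Bundle.Trivialization S (Z.bundle lam).proj :=
  (Z.core lam).localTriv i

theorem isSmoothTriv_triv (i : ι) : IsSmoothTriv (Z.triv lam i) :=
  isSmoothTriv_ofTrivializations (fun i => (Z.core lam).localTriv i)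
    (fun b => ⟨Z.indexAt b, Z.mem_baseSet_at b⟩) (Z.core lam).continuous_proj
    (Z.smooth_localTriv lam) i

theorem triv_symm (i j : ι) {m : M} (hi : m ∈ Z.baseSet i) (hj : m ∈ Z.baseSet j) (s : S) :
    (Z.triv lam i).toOpenPartialHomeomorph.symm (m, s) =
      (Z.triv lam j).toOpenPartialHomeomorph.symm (m, lam.act (Z.g i j m) s) :=
  Z.localTriv_symm lam i j ⟨hi, hj⟩ s

/-- The `G`-bundle with a given cocycle. -/
noncomputable def gBundle : GBundle.{u} lam where
  bundle := Z.bundle lam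
  str := GStructure.generate (Set.range (Z.triv lam))
    (by rintro _ ⟨i, rfl⟩; exact Z.isSmoothTriv_triv lam i)
    (fun m => ⟨_, ⟨Z.indexAt m, rfl⟩, Z.mem_baseSet_at m⟩)
    (by
      rintro _ ⟨i, rfl⟩ _ ⟨j, rfl⟩
      exact ⟨Z.g j i, (Z.smooth j i).mono fun x hx => ⟨hx.2, hx.1⟩,
        fun m hm s => Z.localTriv_apply_symm lam j i ⟨hm.2, hm.1⟩ s⟩)

theorem triv_mem_atlas (i : ι) : Z.triv lam i ∈ (Z.gBundle lam).str.atlas := by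
  refine ⟨Z.isSmoothTriv_triv lam i, ?_⟩
  rintro _ ⟨j, rfl⟩
  exact ⟨Z.g j i, (Z.smooth j i).mono fun x hx => ⟨hx.2, hx.1⟩,
    fun m hm s => Z.localTriv_apply_symm lam j i ⟨hm.2, hm.1⟩ s⟩

end Cocycle

namespace GBundle

variable {G : LieGrp} {S : Mfd.{0}} {lam : EffectiveAction G S} (X : GBundle.{u} lam)

/-- The cocycle of transition functions of a `G`-bundle. -/
noncomputable def cocycle : Cocycle G X.bundle.base X.str.atlas where
  baseSet e := e.1.baseSet
  isOpen_baseSet e := e.1.open_baseSet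
  indexAt m := ⟨(X.str.cover m).choose, (X.str.cover m).choose_spec.1⟩
  mem_baseSet_at m := (X.str.cover m).choose_spec.2
  g e e' := (X.exists_transition e.2 e'.2).choose
  smooth e e' := (X.exists_transition e.2 e'.2).choose_spec.1
  -- Effectiveness turns identities between maps of the standard fibre into the cocycle identities
  -- in `G`.
  g_self e m hm := lam.effective _ fun s => by
    have h := (X.exists_transition e.2 e.2).choose_spec.2 m ⟨hm, hm⟩ s
    have h1 := congrArg (fun x => (e.1 x).2) h
    simp only [e.1.snd_apply_symm hm] at h1
    exact h1.symm
  g_comp e e' e'' m hm := lam.act_injective fun s => by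
    have h := (X.exists_transition e.2 e'.2).choose_spec.2 m hm.1 s
    have h' := (X.exists_transition e'.2 e''.2).choose_spec.2 m ⟨hm.1.2, hm.2⟩
      (lam.act ((X.exists_transition e.2 e'.2).choose m) s)
    have h'' := (X.exists_transition e.2 e''.2).choose_spec.2 m ⟨hm.1.1, hm.2⟩ s
    have h1 := congrArg (fun x => (e''.1 x).2) (h''.symm.trans (h.trans h'))
    simp only [e''.1.snd_apply_symm hm.2] at h1
    rw [lam.mul_act]
    exact h1.symm

theorem symm_eq_symm_cocycle (e e' : X.str.atlas) {m : X.bundle.base} (hm : m ∈ e.1.baseSet)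
    (hm' : m ∈ e'.1.baseSet) (s : S) : e.1.toOpenPartialHomeomorph.symm (m, s) =
      e'.1.toOpenPartialHomeomorph.symm (m, lam.act (X.cocycle.g e e' m) s) :=
  (X.exists_transition e.2 e'.2).choose_spec.2 m ⟨hm, hm'⟩ s

end GBundle

/-! ### The frame bundle of a `(G, λ)`-bundle. -/

namespace GBundle

variable {G : LieGrp} {S : Mfd.{0}} {lam : EffectiveAction G S}

theorem hom_ext {X Y : GBundle.{u} lam} {f g : X ⟶ Y}
    (hb : ∀ m, f.hom.base.toFun m = g.hom.base.toFun m)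
    (ht : ∀ x, f.hom.total.toFun x = g.hom.total.toFun x) : f = g :=
  Hom.ext (FibreBundle.Hom.ext (Mfd.Hom.ext (funext hb)) (Mfd.Hom.ext (funext ht)))

/-- Bundles with the same cocycle are related by a bundle map. -/
theorem exists_hom_of_transition {X Y : GBundle.{u} lam} (b : X.bundle.base ⟶ Y.bundle.base)
    {ι : Type*} (e : ι → X.str.atlas) (e' : ι → Y.str.atlas)
    (cover : ∀ m, ∃ i, m ∈ (e i).1.baseSet)
    (hb : ∀ i, ∀ m ∈ (e i).1.baseSet, b.toFun m ∈ (e' i).1.baseSet)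
    (htr : ∀ i j, ∀ m ∈ (e i).1.baseSet, m ∈ (e j).1.baseSet → ∃ g : G, ∀ s,
      (e i).1.toOpenPartialHomeomorph.symm (m, s) =
        (e j).1.toOpenPartialHomeomorph.symm (m, lam.act g s) ∧
      (e' i).1.toOpenPartialHomeomorph.symm (b.toFun m, s) =
        (e' j).1.toOpenPartialHomeomorph.symm (b.toFun m, lam.act g s)) :
    ∃ f : X ⟶ Y, f.hom.base = b ∧ ∀ i, ∀ m ∈ (e i).1.baseSet, ∀ s,
      f.hom.total.toFun ((e i).1.toOpenPartialHomeomorph.symm (m, s)) =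
        (e' i).1.toOpenPartialHomeomorph.symm (b.toFun m, s) := by
  choose i hi using cover
  let t : X.bundle.total → Y.bundle.total := fun x =>
    (e' (i (X.bundle.proj x))).1.toOpenPartialHomeomorph.symm
      (b.toFun (X.bundle.proj x), ((e (i (X.bundle.proj x))).1 x).2)
  -- The map is the identity of the fibre in the trivialisations chosen at the base point. As both
  -- bundles have the same transition elements, it is then the identity in all the given ones.
  have ht : ∀ j, ∀ m ∈ (e j).1.baseSet, ∀ s,
      t ((e j).1.toOpenPartialHomeomorph.symm (m, s)) =
        (e' j).1.toOpenPartialHomeomorph.symm (b.toFun m, s) := by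
    intro j m hm s
    obtain ⟨g, hg⟩ := htr j (i m) m hm (hi m)
    have hp : X.bundle.proj ((e j).1.toOpenPartialHomeomorph.symm (m, s)) = m :=
      (e j).1.proj_symm_apply' hm
    simp only [t, hp]
    rw [(hg s).1, (hg s).2, (e (i m)).1.snd_apply_symm (hi m)]
  have H : IsLocallyG X Y b t := fun m =>
    ⟨_, (e (i m)).2, hi m, _, (e' (i m)).2, hb _ _ (hi m), fun _ => 1, contMDiffOn_const,
      fun x hx s => by rw [ht _ _ hx.1, lam.one_act]⟩
  exact ⟨H.toHom, rfl, ht⟩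

variable (X : GBundle.{u} lam)

/-- The principal bundle of frames of a `G`-bundle. -/
noncomputable def frameBundle : PrincipalBundle.{u} G := X.cocycle.gBundle (leftMul G)

/-- The trivialisation of the frame bundle given by a trivialisation of the bundle. -/
noncomputable def frameTriv (e : X.str.atlas) :
    Bundle.Trivialization G.toMfd X.frameBundle.bundle.proj :=
  X.cocycle.triv (leftMul G) e

theorem frameTriv_mem (e : X.str.atlas) : X.frameTriv e ∈ X.frameBundle.str.atlas :=
  X.cocycle.triv_mem_atlas (leftMul G) e

/-- The projection of the frame bundle. -/
noncomputable def frameProj (a : X.frameBundle.bundle.total) : X.bundle.base :=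
  X.frameBundle.bundle.proj a

/-- The point of the frame bundle with given coordinates in a trivialisation. -/
noncomputable def mkFrame (e : X.str.atlas) (m : X.bundle.base) (g : G) :
    X.frameBundle.bundle.total :=
  (X.frameTriv e).toOpenPartialHomeomorph.symm (m, g)

variable {X}

theorem frameProj_mkFrame (e : X.str.atlas) {m : X.bundle.base} (hm : m ∈ e.1.baseSet) (g : G) :
    X.frameProj (X.mkFrame e m g) = m :=
  (X.frameTriv e).proj_symm_apply' hm

theorem frameTriv_mkFrame (e : X.str.atlas) {m : X.bundle.base} (hm : m ∈ e.1.baseSet) (g : G) :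
    (X.frameTriv e (X.mkFrame e m g)).2 = g :=
  (X.frameTriv e).snd_apply_symm hm g

theorem mkFrame_frameTriv (e : X.str.atlas) {a : X.frameBundle.bundle.total}
    (ha : X.frameProj a ∈ e.1.baseSet) :
    X.mkFrame e (X.frameProj a) (X.frameTriv e a).2 = a :=
  (X.frameTriv e).symm_eq_of_apply_eq rfl ha rfl

theorem exists_eq_mkFrame (a : X.frameBundle.bundle.total) :
    ∃ e : X.str.atlas, ∃ m ∈ e.1.baseSet, ∃ g, a = X.mkFrame e m g := by
  obtain ⟨e, he, hm⟩ := X.str.cover (X.frameProj a)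
  exact ⟨⟨e, he⟩, _, hm, _, (mkFrame_frameTriv ⟨e, he⟩ hm).symm⟩

theorem mkFrame_eq_mkFrame (e e' : X.str.atlas) {m : X.bundle.base} (hm : m ∈ e.1.baseSet)
    (hm' : m ∈ e'.1.baseSet) (g : G) :
    X.mkFrame e m g = X.mkFrame e' m (X.cocycle.g e e' m * g) :=
  X.cocycle.triv_symm (leftMul G) e e' hm hm' g

/-- A point of the frame bundle as a map from the standard fibre to the total space. -/
noncomputable def frame (a : X.frameBundle.bundle.total) (s : S) : X.bundle.total :=
  (X.cocycle.indexAt (X.frameProj a)).1.toOpenPartialHomeomorph.symm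
    (X.frameProj a, lam.act (X.frameTriv (X.cocycle.indexAt (X.frameProj a)) a).2 s)

/-- The map of a frame is defined by one chosen trivialisation but may be computed in any: changing
the trivialisation multiplies the frame coordinate by the transition element on the left, and the
same element acts on the coordinates in `X`. -/
theorem frame_mkFrame (e : X.str.atlas) {m : X.bundle.base} (hm : m ∈ e.1.baseSet) (g : G)
    (s : S) : frame (X.mkFrame e m g) s =
      e.1.toOpenPartialHomeomorph.symm (m, lam.act g s) := by
  have key : ∀ (a : X.frameBundle.bundle.total) m, X.frameProj a = m → frame a s =
      (X.cocycle.indexAt m).1.toOpenPartialHomeomorph.symm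
        (m, lam.act (X.frameTriv (X.cocycle.indexAt m) a).2 s) := by
    rintro a _ rfl
    rfl
  have hi : m ∈ (X.cocycle.indexAt m).1.baseSet := X.cocycle.mem_baseSet_at m
  rw [key _ m (frameProj_mkFrame e hm g), mkFrame_eq_mkFrame e _ hm hi, frameTriv_mkFrame _ hi,
    X.symm_eq_symm_cocycle e _ hm hi, lam.mul_act]

theorem frame_eq (e : X.str.atlas) {a : X.frameBundle.bundle.total}
    (ha : X.frameProj a ∈ e.1.baseSet) (s : S) : frame a s =
      e.1.toOpenPartialHomeomorph.symm (X.frameProj a, lam.act (X.frameTriv e a).2 s) := by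
  conv_lhs => rw [← mkFrame_frameTriv e ha]
  exact frame_mkFrame e ha _ s

theorem proj_frame (a : X.frameBundle.bundle.total) (s : S) :
    X.bundle.proj (frame a s) = X.frameProj a := by
  obtain ⟨e, m, hm, g, rfl⟩ := exists_eq_mkFrame a
  rw [frame_mkFrame e hm, frameProj_mkFrame e hm, e.1.proj_symm_apply' hm]

/-- Effectiveness again: a frame is determined by its base point and the map it defines. Identities
between frames are from here on checked on points of the standard fibre. -/
theorem frame_injective {a a' : X.frameBundle.bundle.total} (h : X.frameProj a = X.frameProj a')
    (hs : ∀ s, frame a s = frame a' s) : a = a' := by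
  obtain ⟨e, m, hm, g, rfl⟩ := exists_eq_mkFrame a
  rw [frameProj_mkFrame e hm] at h
  rw [← mkFrame_frameTriv (a := a') e (h ▸ hm), ← h]
  congr 1
  refine lam.act_injective fun s => ?_
  have h1 := hs s
  rw [frame_mkFrame e hm, frame_eq e (h ▸ hm), ← h] at h1
  have h2 := congrArg (fun x => (e.1 x).2) h1
  simpa only [e.1.snd_apply_symm hm] using h2

theorem contMDiff_frame (X : GBundle.{u} lam) :
    ContMDiff (X.frameBundle.bundle.total.I.prod S.I) X.bundle.total.I ∞
      fun a : X.frameBundle.bundle.total × S => frame a.1 a.2 := by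
  rintro ⟨a, s⟩
  obtain ⟨e, he, hm⟩ := X.str.cover (X.frameProj a)
  have hsm : IsSmoothTriv (X.frameTriv ⟨e, he⟩) :=
    X.cocycle.isSmoothTriv_triv (leftMul G) ⟨e, he⟩
  set U : Set (X.frameBundle.bundle.total × S) := {x | X.frameProj x.1 ∈ e.baseSet} with hU
  have hUo : IsOpen U := e.open_baseSet.preimage
    (X.frameBundle.bundle.smooth_proj.continuous.comp continuous_fst)
  refine ContMDiffOn.contMDiffAt (s := U) ?_ (hUo.mem_nhds hm)
  have h1 : ContMDiffOn (X.frameBundle.bundle.total.I.prod S.I)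
      (X.frameBundle.bundle.base.I.prod G.I) ∞ (fun x => X.frameTriv ⟨e, he⟩ x.1) U :=
    hsm.1.comp contMDiffOn_fst fun x hx => (X.frameTriv ⟨e, he⟩).mem_source.2 hx
  have h2 : ContMDiffOn (X.frameBundle.bundle.total.I.prod S.I) X.bundle.base.I ∞
      (fun x : X.frameBundle.bundle.total × S => X.frameProj x.1) U :=
    X.frameBundle.bundle.smooth_proj.comp_contMDiffOn contMDiffOn_fst
  have h3 : ContMDiffOn (X.frameBundle.bundle.total.I.prod S.I) S.I ∞
      (fun x : X.frameBundle.bundle.total × S => lam.act (X.frameTriv ⟨e, he⟩ x.1).2 x.2) U :=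
    lam.smooth.comp_contMDiffOn ((contMDiff_snd.comp_contMDiffOn h1).prodMk contMDiffOn_snd)
  refine ((X.str.smooth e he).2.comp (h2.prodMk h3) fun x hx => ?_).congr fun x hx =>
    frame_eq ⟨e, he⟩ hx x.2
  exact e.mem_target.2 hx

/-! ### Functoriality of the frame bundle. -/

section FrameMap

variable {Y : GBundle.{u} lam}

/-- A frame followed by a bundle map is a frame, since in trivialisations the bundle map acts by an
element of `G`. By `frame_injective` this frame is unique, so it can serve as a definition. -/
theorem exists_frame_eq (f : X ⟶ Y) (a : X.frameBundle.bundle.total) :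
    ∃ a' : Y.frameBundle.bundle.total, Y.frameProj a' = f.hom.base.toFun (X.frameProj a) ∧
      ∀ s, frame a' s = f.hom.total.toFun (frame a s) := by
  obtain ⟨e, m, hm, g, rfl⟩ := exists_eq_mkFrame a
  obtain ⟨e', he', hm'⟩ := Y.str.cover (f.hom.base.toFun m)
  obtain ⟨h, -, hT⟩ := f.exists_symm e.2 he'
  refine ⟨Y.mkFrame ⟨e', he'⟩ (f.hom.base.toFun m) (h m * g), ?_, fun s => ?_⟩
  · rw [frameProj_mkFrame _ hm', frameProj_mkFrame e hm]
  · rw [frame_mkFrame _ hm', frame_mkFrame e hm, hT m ⟨hm, hm'⟩, lam.mul_act]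

/-- The map of frame bundles induced by a map of `G`-bundles. -/
noncomputable def frameMapFun (f : X ⟶ Y) (a : X.frameBundle.bundle.total) :
    Y.frameBundle.bundle.total :=
  (exists_frame_eq f a).choose

theorem frameProj_frameMapFun (f : X ⟶ Y) (a : X.frameBundle.bundle.total) :
    Y.frameProj (frameMapFun f a) = f.hom.base.toFun (X.frameProj a) :=
  (exists_frame_eq f a).choose_spec.1

theorem frame_frameMapFun (f : X ⟶ Y) (a : X.frameBundle.bundle.total) (s : S) :
    frame (frameMapFun f a) s = f.hom.total.toFun (frame a s) :=
  (exists_frame_eq f a).choose_spec.2 s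

theorem isLocallyG_frameMapFun (f : X ⟶ Y) :
    IsLocallyG X.frameBundle Y.frameBundle f.hom.base (frameMapFun f) := by
  intro m
  obtain ⟨e, he, hm⟩ := X.str.cover m
  obtain ⟨e', he', hm'⟩ := Y.str.cover (f.hom.base.toFun m)
  obtain ⟨h, hh, hT⟩ := f.exists_symm he he'
  refine ⟨X.frameTriv ⟨e, he⟩, X.frameTriv_mem _, hm, Y.frameTriv ⟨e', he'⟩, Y.frameTriv_mem _,
    hm', h, hh, fun x hx g => ?_⟩
  change frameMapFun f (X.mkFrame ⟨e, he⟩ x g) = Y.mkFrame ⟨e', he'⟩ (f.hom.base.toFun x) (h x * g)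
  refine frame_injective ?_ fun s => ?_
  · rw [frameProj_frameMapFun, frameProj_mkFrame ⟨e, he⟩ hx.1, frameProj_mkFrame ⟨e', he'⟩ hx.2]
  · rw [frame_frameMapFun, frame_mkFrame ⟨e, he⟩ hx.1, frame_mkFrame ⟨e', he'⟩ hx.2, hT x hx,
      lam.mul_act]

end FrameMap

variable (lam) in
/-- The functor from `G`-bundles to principal bundles given by frames. -/
noncomputable def frameFunctor : GBundle.{u} lam ⥤ PrincipalBundle.{u} G where
  obj X := X.frameBundle
  map f := (isLocallyG_frameMapFun f).toHom
  map_id X := hom_ext (fun _ => rfl) fun a =>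
    frame_injective (frameProj_frameMapFun _ a) fun s => frame_frameMapFun _ a s
  map_comp {X Y Z} f g := hom_ext (fun _ => rfl) fun a => by
    change frameMapFun (f ≫ g) a = frameMapFun g (frameMapFun f a)
    refine frame_injective ?_ fun s => ?_
    · rw [frameProj_frameMapFun, frameProj_frameMapFun, frameProj_frameMapFun]
      rfl
    · rw [frame_frameMapFun, frame_frameMapFun, frame_frameMapFun]
      rfl

/-- Every point of the total space is a value of a frame, for instance of the frame with coordinate
`1` in a trivialisation around it. -/
instance : (frameFunctor.{u} lam).Faithful where
  map_injective {X Y f g} h := by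
    refine hom_ext (fun m => ?_) fun x => ?_
    · exact congrArg (fun k : X.frameBundle ⟶ Y.frameBundle => k.hom.base.toFun m) h
    · obtain ⟨e, he, m, hm, s, rfl⟩ := X.exists_eq_symm x
      have h1 : frameMapFun f (X.mkFrame ⟨e, he⟩ m 1) = frameMapFun g (X.mkFrame ⟨e, he⟩ m 1) :=
        congrArg (fun k : X.frameBundle ⟶ Y.frameBundle => k.hom.total.toFun _) h
      have h2 := congrArg (fun a => frame a s) h1
      simpa only [frame_frameMapFun, frame_mkFrame ⟨e, he⟩ hm, lam.one_act] using h2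

/-! ### Bundle maps recovered from maps of frame bundles. -/

section Full

variable {Y : GBundle.{u} lam}

/-- The underlying map of base spaces of a map of frame bundles. -/
noncomputable def frameBase (F : X.frameBundle ⟶ Y.frameBundle) :
    X.bundle.base ⟶ Y.bundle.base :=
  F.hom.base

theorem exists_apply_mkFrame (F : X.frameBundle ⟶ Y.frameBundle) (e : X.str.atlas)
    (e' : Y.str.atlas) : ∃ h : X.bundle.base → G, ContMDiffOn X.bundle.base.I G.I ∞ h
      (e.1.baseSet ∩ (frameBase F).toFun ⁻¹' e'.1.baseSet) ∧
    ∀ m ∈ e.1.baseSet ∩ (frameBase F).toFun ⁻¹' e'.1.baseSet, ∀ g,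
      F.hom.total.toFun (X.mkFrame e m g) = Y.mkFrame e' ((frameBase F).toFun m) (h m * g) :=
  F.exists_symm (X.frameTriv_mem e) (Y.frameTriv_mem e')

/-- The map of total spaces determined by a map of frame bundles. -/
noncomputable def ofFrameMap (F : X.frameBundle ⟶ Y.frameBundle) (x : X.bundle.total) :
    Y.bundle.total :=
  frame (F.hom.total.toFun (X.mkFrame (X.cocycle.indexAt (X.bundle.proj x)) (X.bundle.proj x) 1))
    ((X.cocycle.indexAt (X.bundle.proj x)).1 x).2

/-- Maps of principal bundles are left multiplications in trivialisations, hence commute with right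
translation, which on frames is precomposition with the action. -/
theorem frame_apply_mkFrame (F : X.frameBundle ⟶ Y.frameBundle) (e : X.str.atlas)
    {m : X.bundle.base} (hm : m ∈ e.1.baseSet) (g : G) (s : S) :
    frame (F.hom.total.toFun (X.mkFrame e m g)) s =
      frame (F.hom.total.toFun (X.mkFrame e m 1)) (lam.act g s) := by
  obtain ⟨e', he', hm'⟩ := Y.str.cover ((frameBase F).toFun m)
  obtain ⟨h, -, hT⟩ := exists_apply_mkFrame F e ⟨e', he'⟩
  rw [hT m ⟨hm, hm'⟩, hT m ⟨hm, hm'⟩, frame_mkFrame ⟨e', he'⟩ hm', frame_mkFrame ⟨e', he'⟩ hm',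
    mul_one, lam.mul_act]

/-- Well-definedness of `ofFrameMap`: a change of trivialisation alters the frame and the coordinate
of the point by mutually cancelling factors. -/
theorem ofFrameMap_symm (F : X.frameBundle ⟶ Y.frameBundle) (e : X.str.atlas)
    {m : X.bundle.base} (hm : m ∈ e.1.baseSet) (s : S) :
    ofFrameMap F (e.1.toOpenPartialHomeomorph.symm (m, s)) =
      frame (F.hom.total.toFun (X.mkFrame e m 1)) s := by
  have hi : m ∈ (X.cocycle.indexAt m).1.baseSet := X.cocycle.mem_baseSet_at m
  have hp : X.bundle.proj (e.1.toOpenPartialHomeomorph.symm (m, s)) = m :=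
    e.1.proj_symm_apply' hm
  simp only [ofFrameMap, hp]
  rw [X.symm_eq_symm_cocycle e _ hm hi, (X.cocycle.indexAt m).1.snd_apply_symm hi,
    mkFrame_eq_mkFrame e _ hm hi, frame_apply_mkFrame F _ hi (_ * 1), mul_one]

theorem isLocallyG_ofFrameMap (F : X.frameBundle ⟶ Y.frameBundle) :
    IsLocallyG X Y (frameBase F) (ofFrameMap F) := by
  intro m
  obtain ⟨e, he, hm⟩ := X.str.cover m
  obtain ⟨e', he', hm'⟩ := Y.str.cover ((frameBase F).toFun m)
  obtain ⟨h, hh, hT⟩ := exists_apply_mkFrame F ⟨e, he⟩ ⟨e', he'⟩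
  refine ⟨e, he, hm, e', he', hm', h, hh, fun x hx s => ?_⟩
  rw [ofFrameMap_symm F ⟨e, he⟩ hx.1, hT x hx, frame_mkFrame ⟨e', he'⟩ hx.2, mul_one]

end Full

instance : (frameFunctor.{u} lam).Full where
  map_surjective {X Y} F := by
    refine ⟨(isLocallyG_ofFrameMap (X := X) (Y := Y) F).toHom, hom_ext (fun _ => rfl) fun a => ?_⟩
    refine frame_injective (X := Y) ?_ fun s => ?_
    · exact (frameProj_frameMapFun _ a).trans (F.hom.comm a).symm
    · refine (frame_frameMapFun (X := X) (Y := Y) _ a s).trans ?_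
      obtain ⟨e, m, hm, g, rfl⟩ := exists_eq_mkFrame (X := X) a
      rw [frame_mkFrame e hm]
      exact (ofFrameMap_symm F e hm _).trans (frame_apply_mkFrame F e hm g s).symm

/-! ### The associated bundle and essential surjectivity. -/

section EssSurj

variable (P : PrincipalBundle.{u} G)

variable (lam) in
/-- The bundle associated with a principal bundle. -/
noncomputable def associated : GBundle.{u} lam := P.cocycle.gBundle lam

variable (lam) in
/-- The trivialisation of the associated bundle given by one of the principal bundle. -/
noncomputable def associatedTriv (e : P.str.atlas) : (associated lam P).str.atlas :=
  ⟨P.cocycle.triv lam e, P.cocycle.triv_mem_atlas lam e⟩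

/-- The cocycle of the associated bundle is chosen afresh from its atlas; effectiveness shows that
on these trivialisations it is the cocycle it was built from. -/
theorem cocycle_associatedTriv (e e' : P.str.atlas) {m : P.bundle.base} (hm : m ∈ e.1.baseSet)
    (hm' : m ∈ e'.1.baseSet) :
    (associated lam P).cocycle.g (associatedTriv lam P e) (associatedTriv lam P e') m =
      P.cocycle.g e e' m := by
  refine lam.act_injective fun s => ?_
  have h1 := (associated lam P).symm_eq_symm_cocycle (associatedTriv lam P e)
    (associatedTriv lam P e') (m := m) hm hm' s
  have h2 := P.cocycle.triv_symm lam e e' hm hm' s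
  have h3 := congrArg (fun x => (P.cocycle.triv lam e' x).2) (h1.symm.trans h2)
  exact ((P.cocycle.triv lam e').snd_apply_symm hm' _).symm.trans
    (h3.trans ((P.cocycle.triv lam e').snd_apply_symm hm' _))

theorem exists_associated_transition (e e' : P.str.atlas) (m : P.bundle.base)
    (hm : m ∈ e.1.baseSet) (hm' : m ∈ e'.1.baseSet) : ∃ g : G, ∀ k,
      (associated lam P).mkFrame (associatedTriv lam P e) m k =
        (associated lam P).mkFrame (associatedTriv lam P e') m (g * k) ∧
      e.1.toOpenPartialHomeomorph.symm (m, k) =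
        e'.1.toOpenPartialHomeomorph.symm (m, g * k) := by
  refine ⟨P.cocycle.g e e' m, fun k => ⟨?_, P.symm_eq_symm_cocycle e e' hm hm' k⟩⟩
  have h := mkFrame_eq_mkFrame (X := associated lam P) (associatedTriv lam P e)
    (associatedTriv lam P e') hm hm' k
  rwa [cocycle_associatedTriv P e e' hm hm'] at h

variable (lam) in
-- Both bundles have the same transition elements in trivialisations indexed by the atlas of `P`.
-- The maps in the two directions are the identity in these trivialisations, hence mutually inverse.
theorem nonempty_frameBundle_associated_iso :
    Nonempty ((associated lam P).frameBundle ≅ P) := by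
  let e : P.str.atlas → (associated lam P).frameBundle.str.atlas := fun e =>
    ⟨(associated lam P).frameTriv (associatedTriv lam P e), frameTriv_mem _ _⟩
  have hcov : ∀ m : P.bundle.base, ∃ i : P.str.atlas, m ∈ i.1.baseSet := fun m =>
    let ⟨i, hi, hm⟩ := P.str.cover m; ⟨⟨i, hi⟩, hm⟩
  obtain ⟨f, hfb, hf⟩ := exists_hom_of_transition (X := (associated lam P).frameBundle) (Y := P)
    (𝟙 P.bundle.base) e id hcov (fun i m hm => hm)
    fun i j m hm hm' => exists_associated_transition P i j m hm hm'
  obtain ⟨f', hfb', hf'⟩ := exists_hom_of_transition (X := P) (Y := (associated lam P).frameBundle)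
    (𝟙 P.bundle.base) id e hcov (fun i m hm => hm)
    fun i j m hm hm' => (exists_associated_transition P i j m hm hm').imp fun g h k =>
      ⟨(h k).2, (h k).1⟩
  have hb : ∀ m : P.bundle.base, f.hom.base.toFun m = m := fun m =>
    congrArg (fun b : P.bundle.base ⟶ P.bundle.base => b.toFun m) hfb
  have hb' : ∀ m : P.bundle.base, f'.hom.base.toFun m = m := fun m =>
    congrArg (fun b : P.bundle.base ⟶ P.bundle.base => b.toFun m) hfb'
  refine ⟨⟨f, f', hom_ext (fun m => ?_) fun x => ?_, hom_ext (fun m => ?_) fun x => ?_⟩⟩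
  · exact (congrArg f'.hom.base.toFun (hb m)).trans (hb' m)
  · obtain ⟨i, hm⟩ := hcov ((associated lam P).frameProj x)
    rw [← mkFrame_frameTriv (a := x) (associatedTriv lam P i) hm]
    exact (congrArg f'.hom.total.toFun (hf i _ hm _)).trans (hf' i _ hm _)
  · exact (congrArg f.hom.base.toFun (hb' m)).trans (hb m)
  · obtain ⟨i, hi, m, hm, g, rfl⟩ := P.exists_eq_symm x
    exact (congrArg f.hom.total.toFun (hf' ⟨i, hi⟩ m hm g)).trans (hf ⟨i, hi⟩ m hm g)

end EssSurj

instance : (frameFunctor.{u} lam).EssSurj where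
  mem_essImage P := ⟨associated lam P, nonempty_frameBundle_associated_iso lam P⟩

instance : (frameFunctor.{u} lam).IsEquivalence where

end GBundle

/-! ### Sesquilinear forms given by matrices. -/

section SesqForm

variable {𝕜 : Type} [RCLike 𝕜] {n : Type} [Fintype n]

/-- The sesquilinear form with a given matrix. -/
def Matrix.sesq (A : Matrix n n 𝕜) (v w : n → 𝕜) : 𝕜 := star v ⬝ᵥ (A *ᵥ w)

namespace Matrix

variable (A B C : Matrix n n 𝕜) (v w w' : n → 𝕜)

theorem sesq_mulVec_mulVec : A.sesq (B *ᵥ v) (C *ᵥ w) = (Bᴴ * A * C).sesq v w := by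
  simp only [sesq, star_mulVec, ← dotProduct_mulVec, mulVec_mulVec, Matrix.mul_assoc]

theorem sesq_add_right : A.sesq v (w + w') = A.sesq v w + A.sesq v w' := by
  simp [sesq, mulVec_add]

theorem sesq_smul_right (c : 𝕜) : A.sesq v (c • w) = c * A.sesq v w := by
  simp [sesq, mulVec_smul]

variable {A B} in
theorem IsHermitian.sesq_symm (hA : A.IsHermitian) : A.sesq w v = starRingEnd 𝕜 (A.sesq v w) := by
  rw [sesq, sesq, starRingEnd_apply, star_dotProduct, star_mulVec, hA.eq, ← dotProduct_mulVec,
    star_dotProduct, star_star]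

theorem sesq_single [DecidableEq n] (i j : n) :
    A.sesq (Pi.single i 1) (Pi.single j 1) = A i j := by
  rw [sesq, mulVec_single_one, ← Pi.single_star, star_one, single_one_dotProduct, col_apply]

variable {A B} in
theorem ext_of_sesq [DecidableEq n] (h : ∀ v w, A.sesq v w = B.sesq v w) : A = B := by
  ext i j
  rw [← sesq_single A, h, sesq_single]

theorem re_sesq_diagonal [DecidableEq n] (d : n → ℝ) :
    RCLike.re ((diagonal fun i => (d i : 𝕜)).sesq v v) = ∑ i, d i * ‖v i‖ ^ 2 := by
  rw [sesq, dotProduct, map_sum]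
  refine Finset.sum_congr rfl fun i _ => ?_
  rw [mulVec_diagonal, Pi.star_apply, mul_left_comm, RCLike.star_def, RCLike.conj_mul]
  norm_cast

/-- A subspace on which a diagonal form is negative definite has at most the dimension given by
the negative entries. -/
theorem finrank_le_card_neg [DecidableEq n] (d : n → ℝ) (N : Submodule 𝕜 (n → 𝕜))
    (hN : ∀ x ∈ N, x ≠ 0 → RCLike.re ((diagonal fun i => (d i : 𝕜)).sesq x x) < 0) :
    Module.finrank 𝕜 N ≤ Fintype.card {i // d i < 0} := by
  -- Restriction to the negative coordinates is injective on `N`: where these coordinates vanish the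
  -- form is nonnegative.
  let f : N →ₗ[𝕜] ({i // d i < 0} → 𝕜) :=
    (LinearMap.funLeft 𝕜 𝕜 (Subtype.val : {i // d i < 0} → n)) ∘ₗ N.subtype
  have hf : Function.Injective f := by
    refine (injective_iff_map_eq_zero f).2 fun x hx => ?_
    by_contra hne
    have h1 := hN x x.2 fun h => hne (Subtype.ext h)
    rw [re_sesq_diagonal] at h1
    refine absurd h1 (not_lt.2 (Finset.sum_nonneg fun i _ => ?_))
    by_cases hi : d i < 0
    · have h2 : (x : n → 𝕜) i = 0 := congrFun hx ⟨i, hi⟩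
      rw [h2]
      simp
    · exact mul_nonneg (not_lt.1 hi) (sq_nonneg _)
  simpa using LinearMap.finrank_le_finrank_of_injective hf

theorem finrank_le_card_pos [DecidableEq n] (d : n → ℝ) (N : Submodule 𝕜 (n → 𝕜))
    (hN : ∀ x ∈ N, x ≠ 0 → 0 < RCLike.re ((diagonal fun i => (d i : 𝕜)).sesq x x)) :
    Module.finrank 𝕜 N ≤ Fintype.card {i // 0 < d i} := by
  refine (finrank_le_card_neg (fun i => -d i) N fun x hx hne => ?_).trans_eq
    (Fintype.card_congr (Equiv.subtypeEquivRight fun i => by simp))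
  have h := hN x hx hne
  rw [re_sesq_diagonal] at h ⊢
  simpa using h

end Matrix

end SesqForm

/-! ### The standard form of signature `(p, q)` and reduction to it. -/

section PQ

variable {𝕜 : Type} [RCLike 𝕜] {p q : ℕ}

local notation "𝔼" => Fin p ⊕ Fin q → 𝕜

variable (𝕜 p q) in
theorem pqMatrix_isHermitian : (pqMatrix 𝕜 p q).IsHermitian := by
  refine Matrix.isHermitian_diagonal_of_self_adjoint _ (funext fun i => ?_)
  rcases i with i | i <;> simp

theorem pqForm_eq_sesq (v w : 𝔼) : pqForm v w = (pqMatrix 𝕜 p q).sesq v w := rfl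

variable (𝕜 p q) in
theorem pqMatrix_eq : pqMatrix 𝕜 p q = Matrix.diagonal fun i =>
    ((Sum.elim (fun _ => -1) (fun _ => 1) i : ℝ) : 𝕜) := by
  rw [pqMatrix]
  congr 1
  funext i
  rcases i with i | i <;> simp

open scoped ComplexOrder in
theorem pqForm_nondegenerate (v : 𝔼) (h : ∀ w, pqForm v w = 0) : v = 0 := by
  have h1 : ∀ w, (pqMatrix 𝕜 p q).sesq w v = 0 := fun w => by
    rw [(pqMatrix_isHermitian 𝕜 p q).sesq_symm v w, ← pqForm_eq_sesq, h, map_zero]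
  have h2 : pqMatrix 𝕜 p q *ᵥ v = 0 := by
    -- With this test vector the form becomes the squared Euclidean length of `η v`.
    have h3 := h1 (pqMatrix 𝕜 p q *ᵥ v)
    rw [Matrix.sesq] at h3
    exact dotProduct_star_self_eq_zero.1 h3
  rw [← Matrix.one_mulVec v, ← pqMatrix_mul_self, ← Matrix.mulVec_mulVec, h2, Matrix.mulVec_zero]

theorem pqForm_mulVec_of_mem {g : (Matrix (Fin p ⊕ Fin q) (Fin p ⊕ Fin q) 𝕜)ˣ}
    (hg : g ∈ pqO 𝕜 p q) (v w : 𝔼) :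
    pqForm ((g : Matrix (Fin p ⊕ Fin q) (Fin p ⊕ Fin q) 𝕜) *ᵥ v)
      ((g : Matrix (Fin p ⊕ Fin q) (Fin p ⊕ Fin q) 𝕜) *ᵥ w) = pqForm v w := by
  rw [pqForm_eq_sesq, Matrix.sesq_mulVec_mulVec]
  have : (g : Matrix (Fin p ⊕ Fin q) (Fin p ⊕ Fin q) 𝕜)ᴴ * pqMatrix 𝕜 p q * g =
    pqMatrix 𝕜 p q := hg
  rw [this, pqForm_eq_sesq]

/-- A linear isometry of the standard form is given by an element of `O(𝕜, (p, q))`. -/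
theorem exists_pqO_of_isometry {T : 𝔼 → 𝔼} (hT : IsLinearMap 𝕜 T)
    (h : ∀ v w, pqForm (T v) (T w) = pqForm v w) :
    ∃ g ∈ pqO 𝕜 p q, ∀ v, T v = (g : Matrix (Fin p ⊕ Fin q) (Fin p ⊕ Fin q) 𝕜) *ᵥ v := by
  set M := LinearMap.toMatrix' hT.mk' with hM
  have hTM : ∀ v, T v = M *ᵥ v := fun v => (LinearMap.toMatrix'_mulVec hT.mk' v).symm
  have h1 : Mᴴ * pqMatrix 𝕜 p q * M = pqMatrix 𝕜 p q := Matrix.ext_of_sesq fun v w => by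
    rw [← Matrix.sesq_mulVec_mulVec, ← hTM, ← hTM]
    exact h v w
  -- The isometry equation and `η * η = 1` provide a left inverse, so invertibility need not be
  -- assumed.
  have h2 : (pqMatrix 𝕜 p q * Mᴴ * pqMatrix 𝕜 p q) * M = 1 := by
    rw [Matrix.mul_assoc, Matrix.mul_assoc, ← Matrix.mul_assoc Mᴴ, h1, pqMatrix_mul_self]
  exact ⟨⟨M, _, mul_eq_one_comm.1 h2, h2⟩, h1, hTM⟩

theorem card_neg_sum (p q : ℕ) : Fintype.card {i : Fin p ⊕ Fin q //
    (Sum.elim (fun _ => -1) (fun _ => 1) i : ℝ) < 0} = p := by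
  rw [Fintype.card_subtype, Finset.card_filter, Fintype.sum_sum_type]
  simp [not_lt.2 (zero_le_one (α := ℝ))]

theorem card_pos_sum (p q : ℕ) : Fintype.card {i : Fin p ⊕ Fin q //
    (0 : ℝ) < Sum.elim (fun _ => -1) (fun _ => 1) i} = q := by
  rw [Fintype.card_subtype, Finset.card_filter, Fintype.sum_sum_type]
  simp

theorem re_pqForm (x : 𝔼) : RCLike.re (pqForm x x) =
    -∑ i, ‖x (Sum.inl i)‖ ^ 2 + ∑ j, ‖x (Sum.inr j)‖ ^ 2 := by
  rw [pqForm_eq_sesq, pqMatrix_eq, Matrix.re_sesq_diagonal, Fintype.sum_sum_type]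
  simp

theorem sum_sq_norm_pos {ι : Type*} [Fintype ι] {v : ι → 𝕜} (hv : v ≠ 0) :
    0 < ∑ i, ‖v i‖ ^ 2 := by
  obtain ⟨i, hi⟩ := Function.ne_iff.1 hv
  exact Finset.sum_pos' (fun _ _ => sq_nonneg _)
    ⟨i, Finset.mem_univ i, pow_pos (norm_pos_iff.2 hi) 2⟩

variable (𝕜 p q) in
-- The first `p` coordinates span a negative definite subspace, and the number of negative diagonal
-- entries bounds the dimension of any other.
theorem pqForm_negative_index : IsGreatest {d | ∃ N : Submodule 𝕜 𝔼,
    Module.finrank 𝕜 N = d ∧ ∀ x ∈ N, x ≠ 0 → RCLike.re (pqForm x x) < 0} p := by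
  constructor
  · let f : (Fin p → 𝕜) →ₗ[𝕜] 𝔼 :=
      (LinearEquiv.sumArrowLequivProdArrow (Fin p) (Fin q) 𝕜 𝕜).symm.toLinearMap ∘ₗ
        LinearMap.inl 𝕜 _ _
    have hf : Function.Injective f :=
      (LinearEquiv.sumArrowLequivProdArrow (Fin p) (Fin q) 𝕜 𝕜).symm.injective.comp
        LinearMap.inl_injective
    refine ⟨LinearMap.range f, by simpa using LinearMap.finrank_range_of_inj hf, ?_⟩
    rintro _ ⟨v, rfl⟩ hne
    have hv : v ≠ 0 := fun h => hne (by rw [h, map_zero])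
    rw [re_pqForm]
    simpa [f] using sum_sq_norm_pos hv
  · rintro d ⟨N, rfl, hN⟩
    have := Matrix.finrank_le_card_neg _ N fun x hx hne => by
      have := hN x hx hne
      rwa [pqForm_eq_sesq, pqMatrix_eq] at this
    rwa [card_neg_sum] at this

variable (𝕜 p q) in
theorem pqForm_positive_index : IsGreatest {d | ∃ N : Submodule 𝕜 𝔼,
    Module.finrank 𝕜 N = d ∧ ∀ x ∈ N, x ≠ 0 → 0 < RCLike.re (pqForm x x)} q := by
  constructor
  · let f : (Fin q → 𝕜) →ₗ[𝕜] 𝔼 :=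
      (LinearEquiv.sumArrowLequivProdArrow (Fin p) (Fin q) 𝕜 𝕜).symm.toLinearMap ∘ₗ
        LinearMap.inr 𝕜 _ _
    have hf : Function.Injective f :=
      (LinearEquiv.sumArrowLequivProdArrow (Fin p) (Fin q) 𝕜 𝕜).symm.injective.comp
        LinearMap.inr_injective
    refine ⟨LinearMap.range f, by simpa using LinearMap.finrank_range_of_inj hf, ?_⟩
    rintro _ ⟨v, rfl⟩ hne
    have hv : v ≠ 0 := fun h => hne (by rw [h, map_zero])
    rw [re_pqForm]
    simpa [f] using sum_sq_norm_pos hv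
  · rintro d ⟨N, rfl, hN⟩
    have := Matrix.finrank_le_card_pos _ N fun x hx hne => by
      have := hN x hx hne
      rwa [pqForm_eq_sesq, pqMatrix_eq] at this
    rwa [card_pos_sum] at this

/-- Choosing `p` indices of negative and `q` of positive entries uses up all `p + q` indices. The
choice is thus a permutation, and no entry is zero. -/
theorem exists_perm_of_card {d : Fin p ⊕ Fin q → ℝ} (hn : p ≤ Fintype.card {i // d i < 0})
    (hp : q ≤ Fintype.card {i // 0 < d i}) :
    ∃ σ : Fin p ⊕ Fin q ≃ Fin p ⊕ Fin q, ∀ i, d (σ i) = Sum.elim (fun _ => -1) (fun _ => 1) i *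
      |d (σ i)| ∧ d (σ i) ≠ 0 := by
  obtain ⟨f⟩ := Function.Embedding.nonempty_of_card_le (α := Fin p) (by simpa using hn)
  obtain ⟨g⟩ := Function.Embedding.nonempty_of_card_le (α := Fin q) (by simpa using hp)
  let σ : Fin p ⊕ Fin q → Fin p ⊕ Fin q := Sum.elim (fun i => (f i).1) fun j => (g j).1
  have hσ : Function.Injective σ := by
    refine (Subtype.val_injective.comp f.injective).sumElim
      (Subtype.val_injective.comp g.injective) fun i j h => ?_
    have h1 := (f i).2
    have h2 := (g j).2
    rw [show (f i).1 = (g j).1 from h] at h1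
    exact lt_asymm h1 h2
  refine ⟨Equiv.ofBijective σ (Finite.injective_iff_bijective.1 hσ), fun i => ?_⟩
  rcases i with i | i
  · have h := (f i).2
    exact ⟨by simp [σ, abs_of_neg h], h.ne⟩
  · have h := (g i).2
    exact ⟨by simp [σ, abs_of_pos h], h.ne'⟩

/-- A Hermitian form of signature `(p, q)` can be brought to the standard form. -/
theorem exists_conj_eq_pqMatrix {A : Matrix (Fin p ⊕ Fin q) (Fin p ⊕ Fin q) 𝕜}
    (hA : A.IsHermitian) {N Q : Submodule 𝕜 𝔼} (hNp : Module.finrank 𝕜 N = p)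
    (hN : ∀ x ∈ N, x ≠ 0 → RCLike.re (A.sesq x x) < 0) (hQq : Module.finrank 𝕜 Q = q)
    (hQ : ∀ x ∈ Q, x ≠ 0 → 0 < RCLike.re (A.sesq x x)) :
    ∃ C : Matrix (Fin p ⊕ Fin q) (Fin p ⊕ Fin q) 𝕜, Cᴴ * A * C = pqMatrix 𝕜 p q := by
  set d := hA.eigenvalues
  set U : Matrix (Fin p ⊕ Fin q) (Fin p ⊕ Fin q) 𝕜 := hA.eigenvectorUnitary.1 with hU
  have hUU : Uᴴ * U = 1 := Unitary.coe_star_mul_self hA.eigenvectorUnitary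
  have hUU' : U * Uᴴ = 1 := Unitary.coe_mul_star_self hA.eigenvectorUnitary
  have hD : Uᴴ * A * U = Matrix.diagonal fun i => (d i : 𝕜) := by
    have h := hA.conjStarAlgAut_star_eigenvectorUnitary
    rw [Unitary.conjStarAlgAut_star_apply] at h
    exact h
  -- Coordinates with respect to the eigenvectors: `N` and `Q` become definite subspaces of a
  -- diagonal form, which bounds below the numbers of negative and positive eigenvalues.
  let e : 𝔼 ≃ₗ[𝕜] 𝔼 := Matrix.toLin'OfInv hUU' hUU
  have he : ∀ x, (Matrix.diagonal fun i => (d i : 𝕜)).sesq (e x) (e x) = A.sesq x x := by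
    intro x
    rw [← hD, ← Matrix.sesq_mulVec_mulVec]
    have : U *ᵥ e x = x := e.symm_apply_apply x
    rw [this]
  have hn : p ≤ Fintype.card {i // d i < 0} := by
    refine hNp.ge.trans ?_
    rw [← LinearEquiv.finrank_map_eq e N]
    refine Matrix.finrank_le_card_neg d _ ?_
    rintro _ ⟨x, hx, rfl⟩ hne
    have := hN x hx fun h => hne (by rw [h, map_zero])
    rwa [← he] at this
  have hp : q ≤ Fintype.card {i // 0 < d i} := by
    refine hQq.ge.trans ?_
    rw [← LinearEquiv.finrank_map_eq e Q]
    refine Matrix.finrank_le_card_pos d _ ?_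
    rintro _ ⟨x, hx, rfl⟩ hne
    have := hQ x hx fun h => hne (by rw [h, map_zero])
    rwa [← he] at this
  obtain ⟨σ, hσ⟩ := exists_perm_of_card hn hp
  -- Eigenvectors scaled by `|d i| ^ (-1/2)` have squares `±1`; the permutation `σ` then puts the
  -- negative ones first.
  set s : Fin p ⊕ Fin q → 𝕜 := fun i => ((Real.sqrt |d i|)⁻¹ : ℝ) with hs
  refine ⟨(U * Matrix.diagonal s).submatrix id σ, ?_⟩
  have h1 : (U * Matrix.diagonal s)ᴴ * A * (U * Matrix.diagonal s) =
      Matrix.diagonal fun i => ((d i * |d i|⁻¹ : ℝ) : 𝕜) := by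
    have h2 : (U * Matrix.diagonal s)ᴴ * A * (U * Matrix.diagonal s) =
        (Matrix.diagonal s)ᴴ * (Uᴴ * A * U) * Matrix.diagonal s := by
      rw [Matrix.conjTranspose_mul]
      simp only [Matrix.mul_assoc]
    rw [h2, hD, Matrix.diagonal_conjTranspose, Matrix.diagonal_mul_diagonal,
      Matrix.diagonal_mul_diagonal]
    congr 1
    funext i
    have h3 : (Real.sqrt |d i|)⁻¹ * (Real.sqrt |d i|)⁻¹ = |d i|⁻¹ := by
      rw [← mul_inv, Real.mul_self_sqrt (abs_nonneg _)]
    rw [Pi.star_apply, RCLike.star_def, RCLike.conj_ofReal, ← h3]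
    simp only [hs]
    push_cast
    ring
  rw [Matrix.conjTranspose_submatrix]
  have h4 : (U * Matrix.diagonal s)ᴴ.submatrix σ id * A * (U * Matrix.diagonal s).submatrix id σ =
      ((U * Matrix.diagonal s)ᴴ * A * (U * Matrix.diagonal s)).submatrix σ σ := by
    ext i j
    simp [Matrix.mul_apply]
  rw [h4, h1, Matrix.submatrix_diagonal_equiv, pqMatrix_eq]
  congr 1
  funext i
  obtain ⟨h5, h6⟩ := hσ i
  rw [Function.comp_apply]
  congr 1
  conv_lhs => enter [1]; rw [h5]
  rw [mul_assoc, mul_inv_cancel₀ (abs_ne_zero.2 h6), mul_one]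

attribute [local instance] Matrix.linftyOpNormedRing Matrix.linftyOpNormedAlgebra
  completeSpace_matrix

variable (𝕜 p q) in
/-- Near the standard form, Hermitian matrices can be brought to the standard form smoothly. -/
theorem exists_smooth_conj_eq_pqMatrix :
    ∃ (W : Set (Matrix (Fin p ⊕ Fin q) (Fin p ⊕ Fin q) 𝕜))
      (R : Matrix (Fin p ⊕ Fin q) (Fin p ⊕ Fin q) 𝕜 →
        Matrix (Fin p ⊕ Fin q) (Fin p ⊕ Fin q) 𝕜),
      IsOpen W ∧ pqMatrix 𝕜 p q ∈ W ∧ ContDiffOn ℝ ∞ R W ∧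
      ∀ A ∈ W, A.IsHermitian → (R A)ᴴ * A * R A = pqMatrix 𝕜 p q := by
  obtain ⟨φ, h0, -, he, hs⟩ := LinLie.exists_local_log
    (A := Matrix (Fin p ⊕ Fin q) (Fin p ⊕ Fin q) 𝕜) (W := Set.univ) Filter.univ_mem
  set η := pqMatrix 𝕜 p q with hη
  have hηη : η * η = 1 := pqMatrix_mul_self 𝕜 p q
  have hηH : ηᴴ = η := pqMatrix_isHermitian 𝕜 p q
  have h1 : φ.symm (η * η) = 0 := by
    rw [hηη, ← (he 0).trans NormedSpace.exp_zero]
    exact φ.left_inv h0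
  have h1t : η * η ∈ φ.target := by
    rw [hηη, ← (he 0).trans NormedSpace.exp_zero]
    exact φ.map_source h0
  have hmul : ContDiff ℝ ∞ fun A : Matrix (Fin p ⊕ Fin q) (Fin p ⊕ Fin q) 𝕜 => η * A :=
    contDiff_const.mul contDiff_id
  set V : Set (Matrix (Fin p ⊕ Fin q) (Fin p ⊕ Fin q) 𝕜) := (fun A => η * A) ⁻¹' φ.target
  have hVo : IsOpen V := φ.open_target.preimage hmul.continuous
  have hlog : ContDiffOn ℝ ∞ (fun A => φ.symm (η * A)) V :=
    hs.comp hmul.contDiffOn fun A hA => hA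
  have hc : ContinuousOn (fun A => η * (φ.symm (η * A))ᴴ * η) V := by
    have h2 : Continuous fun X : Matrix (Fin p ⊕ Fin q) (Fin p ⊕ Fin q) 𝕜 => η * Xᴴ * η :=
      (continuous_const.mul continuous_id.matrix_conjTranspose).mul continuous_const
    exact h2.comp_continuousOn hlog.continuousOn
  -- `R A` is an inverse square root of `η A`. The second condition on `A` keeps `η Lᴴ η`, for `L =
  -- log (η A)`, in the region where the exponential is injective.
  refine ⟨V ∩ (fun A => η * (φ.symm (η * A))ᴴ * η) ⁻¹' φ.source,
    fun A => NormedSpace.exp (-((1 / 2 : ℝ) • φ.symm (η * A))),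
    hc.isOpen_inter_preimage hVo φ.open_source, ⟨h1t, ?_⟩, ?_, ?_⟩
  · simpa [h1] using h0
  · refine ((LinLie.contDiff_exp).of_le le_top).comp_contDiffOn ?_
    exact ((hlog.mono Set.inter_subset_left).const_smul (1 / 2 : ℝ)).neg
  · rintro A ⟨hA, hA'⟩ hAH
    let _ : NormedAlgebra ℚ 𝕜 := NormedAlgebra.restrictScalars ℚ ℝ 𝕜
    let ηu : (Matrix (Fin p ⊕ Fin q) (Fin p ⊕ Fin q) 𝕜)ˣ := ⟨η, η, hηη, hηη⟩
    have hconj : ∀ X : Matrix (Fin p ⊕ Fin q) (Fin p ⊕ Fin q) 𝕜,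
        NormedSpace.exp (η * X * η) = η * NormedSpace.exp X * η := fun X =>
      Matrix.exp_units_conj ηu X
    set L := φ.symm (η * A) with hL
    have hexp : NormedSpace.exp L = η * A := (he L).symm.trans (φ.right_inv hA)
    -- As `A` is Hermitian, both sides have exponential `η A`, and the exponential is injective
    -- there.
    have hLL : η * Lᴴ * η = L := by
      refine φ.injOn hA' (φ.map_target hA) ((he _).trans (Eq.trans ?_ (he _).symm))
      change NormedSpace.exp (η * Lᴴ * η) = NormedSpace.exp L
      rw [hexp, hconj, Matrix.exp_conjTranspose, hexp, Matrix.conjTranspose_mul, hηH,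
        hAH.eq, Matrix.mul_assoc, Matrix.mul_assoc, hηη, Matrix.mul_one]
    have hLH : Lᴴ = η * L * η := by
      conv_rhs => rw [← hLL]
      simp only [Matrix.mul_assoc, hηη, Matrix.mul_one]
      rw [← Matrix.mul_assoc, hηη, Matrix.one_mul]
    set K := -((1 / 2 : ℝ) • L) with hK
    have hKH : (NormedSpace.exp K)ᴴ = η * NormedSpace.exp K * η := by
      rw [← Matrix.exp_conjTranspose, ← hconj, hK, Matrix.conjTranspose_neg,
        Matrix.conjTranspose_smul, hLH]
      simp
    have hcomm : Commute K L := ((Commute.refl L).smul_left _).neg_left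
    -- The three exponents commute and sum to zero.
    have h3 : NormedSpace.exp K * NormedSpace.exp L * NormedSpace.exp K = 1 := by
      rw [← Matrix.exp_add_of_commute _ _ hcomm,
        ← Matrix.exp_add_of_commute _ _ ((Commute.refl K).add_left hcomm.symm)]
      have : K + L + K = 0 := by rw [hK]; module
      rw [this, NormedSpace.exp_zero]
    have hA2 : A = η * NormedSpace.exp L := by
      rw [hexp, ← Matrix.mul_assoc, hηη, Matrix.one_mul]
    calc (NormedSpace.exp K)ᴴ * A * NormedSpace.exp K
        = η * NormedSpace.exp K * (η * η) * NormedSpace.exp L * NormedSpace.exp K := by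
          rw [hKH, hA2]; simp only [Matrix.mul_assoc]
      _ = η * (NormedSpace.exp K * NormedSpace.exp L * NormedSpace.exp K) := by
          rw [hηη, Matrix.mul_one]; simp only [Matrix.mul_assoc]
      _ = η := by rw [h3, Matrix.mul_one]

end PQ

/-- An open subset of a manifold. -/
noncomputable def Mfd.restrict (M : Mfd.{u}) (U : TopologicalSpace.Opens M) : Mfd.{u} where
  carrier := U
  model := M.model

/-! ### Smooth matrix-valued functions and changes of trivialisation by them. -/

section MatrixTriv

attribute [local instance] Matrix.linftyOpNormedRing Matrix.linftyOpNormedAlgebra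
  completeSpace_matrix

namespace LinLie

variable {A : Type} [NormedRing A] [NormedAlgebra ℝ A] [CompleteSpace A] [FiniteDimensional ℝ A]
  {H : Subgroup Aˣ} {L : Submodule ℝ A}

/-- The statement for maps defined on a whole manifold is applied to the open submanifold `U`. -/
theorem contMDiffOn_of_val (h : IsExpModel H L) {N : Mfd.{u}} {f : N → lieGrp h} {U : Set N}
    (hU : IsOpen U) (hf : ContMDiffOn N.I 𝓘(ℝ, A) ∞ (fun x => val (f x)) U) :
    ContMDiffOn N.I (lieGrp h).I ∞ f U := by
  intro x hx
  let V : TopologicalSpace.Opens N := ⟨U, hU⟩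
  have h1 : ContMDiff N.I 𝓘(ℝ, A) ∞ fun y : V => val (f y.1) := fun y =>
    (contMDiffAt_subtype_iff (U := V)).2 (hf.contMDiffAt (hU.mem_nhds y.2))
  have h2 : ContMDiff N.I (lieGrp h).I ∞ fun y : V => f y.1 :=
    contMDiff_of_val h (N := N.restrict V) h1
  exact ((contMDiffAt_subtype_iff (U := V)).1 (h2 ⟨x, hx⟩)).contMDiffWithinAt

theorem contMDiffOn_of_val_eq (h : IsExpModel H L) {N : Mfd.{u}} {f : N → lieGrp h} {U : Set N}
    (hU : IsOpen U) {V : Type*} [NormedAddCommGroup V] [NormedSpace ℝ V] {F : V → A}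
    (hF : ContDiff ℝ ∞ F) {c : N → V} (hc : ContMDiffOn N.I 𝓘(ℝ, V) ∞ c U)
    (hf : ∀ x ∈ U, val (f x) = F (c x)) : ContMDiffOn N.I (lieGrp h).I ∞ f U :=
  contMDiffOn_of_val h hU ((hF.contMDiff.comp_contMDiffOn hc).congr hf)

end LinLie

variable {𝕜 : Type} [RCLike 𝕜] {p q : ℕ}

local notation "𝔼" => Fin p ⊕ Fin q → 𝕜
local notation "𝔐" => Matrix (Fin p ⊕ Fin q) (Fin p ⊕ Fin q) 𝕜

/-- Smoothness of a matrix-valued function, entry by entry. -/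
def SmoothEntries {N : Mfd.{u}} (f : N → 𝔐) (U : Set N) : Prop :=
  ∀ i j, ContMDiffOn N.I 𝓘(ℝ, 𝕜) ∞ (fun x => f x i j) U

variable (𝕜 p q) in
theorem contDiff_matrix_of : ContDiff ℝ ∞ fun c : Fin p ⊕ Fin q → 𝔼 => (Matrix.of c : 𝔐) :=
  (LinearMap.toContinuousLinearMap
    ({ toFun := fun c => Matrix.of c, map_add' := fun _ _ => rfl,
       map_smul' := fun _ _ => rfl } : (Fin p ⊕ Fin q → 𝔼) →ₗ[ℝ] 𝔐)).contDiff

variable (𝕜) in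
theorem contDiff_matrix_entry (i j : Fin p ⊕ Fin q) : ContDiff ℝ ∞ fun M : 𝔐 => M i j :=
  (LinearMap.toContinuousLinearMap
    ({ toFun := fun M => M i j, map_add' := fun _ _ => rfl, map_smul' := fun _ _ => rfl } :
    𝔐 →ₗ[ℝ] 𝕜)).contDiff

theorem contMDiffOn_mul_field {E K N : Type*} [NormedAddCommGroup E] [NormedSpace ℝ E]
    [TopologicalSpace K] {J : ModelWithCorners ℝ E K} [TopologicalSpace N] [ChartedSpace K N]
    {f g : N → 𝕜} {U : Set N} (hf : ContMDiffOn J 𝓘(ℝ, 𝕜) ∞ f U)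
    (hg : ContMDiffOn J 𝓘(ℝ, 𝕜) ∞ g U) : ContMDiffOn J 𝓘(ℝ, 𝕜) ∞ (fun x => f x * g x) U :=
  (contDiff_mul (𝕜 := ℝ) (𝔸 := 𝕜)).contMDiff.comp_contMDiffOn (hf.prodMk_space hg)

theorem contMDiffOn_mulVec {E K N : Type*} [NormedAddCommGroup E] [NormedSpace ℝ E]
    [TopologicalSpace K] {J : ModelWithCorners ℝ E K} [TopologicalSpace N] [ChartedSpace K N]
    {f : N → 𝔐} {g : N → 𝔼} {U : Set N}
    (hf : ∀ i j, ContMDiffOn J 𝓘(ℝ, 𝕜) ∞ (fun x => f x i j) U)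
    (hg : ContMDiffOn J 𝓘(ℝ, 𝔼) ∞ g U) : ContMDiffOn J 𝓘(ℝ, 𝔼) ∞ (fun x => f x *ᵥ g x) U :=
  contMDiffOn_pi_space.2 fun i => contMDiffOn_finsetSum (t := Finset.univ) fun j _ =>
    contMDiffOn_mul_field (hf i j) (contMDiffOn_pi_space.1 hg j)

namespace SmoothEntries

variable {N : Mfd.{u}} {f g : N → Matrix (Fin p ⊕ Fin q) (Fin p ⊕ Fin q) 𝕜} {U V : Set N}

theorem mono (hf : SmoothEntries f V) (h : U ⊆ V) : SmoothEntries f U :=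
  fun i j => (hf i j).mono h

theorem const (A : 𝔐) : SmoothEntries (fun _ : N => A) U := fun _ _ => contMDiffOn_const

theorem mul (hf : SmoothEntries f U) (hg : SmoothEntries g U) :
    SmoothEntries (fun x => f x * g x) U := fun i j =>
  contMDiffOn_finsetSum (t := Finset.univ) fun k _ => contMDiffOn_mul_field (hf i k) (hg k j)

theorem conjTranspose (hf : SmoothEntries f U) : SmoothEntries (fun x => (f x)ᴴ) U := fun i j =>
  (RCLike.conjCLE (K := 𝕜)).contDiff.contMDiff.comp_contMDiffOn (hf j i)

theorem contMDiffOn_curry (hf : SmoothEntries f U) :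
    ContMDiffOn N.I 𝓘(ℝ, Fin p ⊕ Fin q → 𝔼) ∞ (fun x i j => f x i j) U :=
  contMDiffOn_pi_space.2 fun i => contMDiffOn_pi_space.2 fun j => hf i j

theorem comp_contDiffOn (hf : SmoothEntries f U) {W : Set 𝔐} {R : 𝔐 → 𝔐}
    (hR : ContDiffOn ℝ ∞ R W) (hW : ∀ x ∈ U, f x ∈ W) : SmoothEntries (fun x => R (f x)) U := by
  intro i j
  have h1 : ContDiffOn ℝ ∞ (fun c : Fin p ⊕ Fin q → 𝔼 => R (Matrix.of c) i j)
      ((fun c => Matrix.of c) ⁻¹' W) :=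
    (contDiff_matrix_entry 𝕜 i j).comp_contDiffOn
      (hR.comp (contDiff_matrix_of 𝕜 p q).contDiffOn fun c hc => hc)
  exact h1.contMDiffOn.comp hf.contMDiffOn_curry fun x hx => hW x hx

theorem continuousOn (hf : SmoothEntries f U) : ContinuousOn f U :=
  hf.contMDiffOn_curry.continuousOn

theorem det (hf : SmoothEntries f U) :
    ContMDiffOn N.I 𝓘(ℝ, 𝕜) ∞ (fun x => (f x).det) U := by
  have h : ContDiff ℝ ∞ fun c : Fin p ⊕ Fin q → 𝔼 => (Matrix.of c).det := by
    simp only [Matrix.det_apply']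
    refine ContDiff.sum fun σ _ => contDiff_const.mul (contDiff_prod fun i _ => ?_)
    exact (contDiff_apply ℝ 𝕜 i).comp (contDiff_apply ℝ 𝔼 (σ i))
  exact h.contMDiff.comp_contMDiffOn hf.contMDiffOn_curry

end SmoothEntries

theorem contDiff_pqForm : ContDiff ℝ ∞ fun x : 𝔼 × 𝔼 => (pqForm x.1 x.2 : 𝕜) := by
  have h : (fun x : 𝔼 × 𝔼 => (pqForm x.1 x.2 : 𝕜)) = fun x => ∑ i, RCLike.conjCLE (x.1 i) *
      ((Sum.elim (fun _ => -1) (fun _ => 1) i : 𝕜) * x.2 i) := by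
    funext x
    simp only [pqForm, pqMatrix, dotProduct, Matrix.mulVec_diagonal]
    rfl
  rw [h]
  refine ContDiff.sum fun i _ => ContDiff.mul ?_ (contDiff_const.mul ?_)
  · exact (RCLike.conjCLE (K := 𝕜)).contDiff.comp ((contDiff_apply ℝ 𝕜 i).comp contDiff_fst)
  · exact (contDiff_apply ℝ 𝕜 i).comp contDiff_snd

/-- A family of linear maps given by elements of a matrix group is given by a smooth function if
it maps constant vectors to smooth functions. -/
theorem exists_smooth_of_matrix {H : Subgroup 𝔐ˣ} {L : Submodule ℝ 𝔐}
    (h : LinLie.IsExpModel H L) {N : Mfd.{u}} {W : Set N} (hW : IsOpen W) {T : N → 𝔼 → 𝔼}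
    (hT : ∀ m ∈ W, ∃ g ∈ H, ∀ v, T m v = (g : 𝔐) *ᵥ v)
    (hs : ∀ v, ContMDiffOn N.I 𝓘(ℝ, 𝔼) ∞ (fun m => T m v) W) :
    ∃ g : N → LinLie.lieGrp h, ContMDiffOn N.I (LinLie.lieGrp h).I ∞ g W ∧
      ∀ m ∈ W, ∀ v, T m v = (matrixAction h).act (g m) v := by
  classical
  have hex : ∀ m, ∃ g : LinLie.lieGrp h, m ∈ W → ∀ v, T m v = LinLie.val g *ᵥ v := fun m => by
    by_cases hm : m ∈ W
    · obtain ⟨g, hg, hgT⟩ := hT m hm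
      exact ⟨⟨g, hg⟩, fun _ => hgT⟩
    · exact ⟨1, fun h => absurd h hm⟩
  choose g hg using hex
  -- The columns of the matrix are the images of the standard basis vectors, which depend smoothly
  -- on the point.
  have hc : SmoothEntries (fun m => Matrix.of fun i j => T m (Pi.single j 1) i) W := fun i j =>
    contMDiffOn_pi_space.1 (hs (Pi.single j 1)) i
  refine ⟨g, LinLie.contMDiffOn_of_val_eq h hW (contDiff_matrix_of 𝕜 p q) hc.contMDiffOn_curry
    fun x hx => ?_, hg⟩
  ext i j
  change LinLie.val (g x) i j = T x (Pi.single j 1) i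
  rw [hg x hx, Matrix.mulVec_single_one]
  rfl

/-- If in given trivialisations a bundle map is given by elements of a matrix group, then it is
given by a smooth function. -/
theorem locallyG_of_matrix {H : Subgroup 𝔐ˣ} {L : Submodule ℝ 𝔐} (h : LinLie.IsExpModel H L)
    {B C : FibreBundle.{u} (vecMfd 𝕜 p q)} (f : B ⟶ C)
    {e : Bundle.Trivialization (vecMfd 𝕜 p q) B.proj} (he : IsSmoothTriv e)
    {e' : Bundle.Trivialization (vecMfd 𝕜 p q) C.proj} (he' : IsSmoothTriv e')
    (hT : ∀ m ∈ e.baseSet, f.base.toFun m ∈ e'.baseSet → ∃ g ∈ H, ∀ v : 𝔼,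
      (e' (f.total.toFun (e.toOpenPartialHomeomorph.symm (m, v)))).2 = (g : 𝔐) *ᵥ v) :
    GBundle.LocallyG (matrixAction h) f e e' := by
  set W := e.baseSet ∩ f.base.toFun ⁻¹' e'.baseSet with hW
  have hWo : IsOpen W := e.open_baseSet.inter (e'.open_baseSet.preimage f.base.smooth.continuous)
  have hproj : ∀ m ∈ W, ∀ v : 𝔼,
      C.proj (f.total.toFun (e.toOpenPartialHomeomorph.symm (m, v))) = f.base.toFun m :=
    fun m hm v => by rw [f.comm, e.proj_symm_apply' hm.1]
  obtain ⟨g, hg, hgT⟩ := exists_smooth_of_matrix h hWo (T := fun m v =>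
    (e' (f.total.toFun (e.toOpenPartialHomeomorph.symm (m, v)))).2)
    (fun m hm => hT m hm.1 hm.2) fun v => by
      have h1 : ContMDiffOn B.base.I B.total.I ∞
          (fun m => e.toOpenPartialHomeomorph.symm (m, v)) W :=
        he.2.comp (contMDiffOn_id.prodMk contMDiffOn_const) fun m hm => e.mem_target.2 hm.1
      have h2 := he'.1.comp (f.total.smooth.comp_contMDiffOn h1) fun m hm => by
        rw [Set.mem_preimage, e'.mem_source]
        exact (hproj m hm v).symm ▸ hm.2
      exact contMDiff_snd.comp_contMDiffOn h2
  refine ⟨g, hg, fun m hm v => Prod.ext ?_ (hgT m hm v)⟩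
  exact (e'.coe_fst' (by rw [hproj m hm]; exact hm.2)).trans (hproj m hm v)

section Twist

variable {S : Mfd.{0}} {B : FibreBundle.{u} S} {e : Bundle.Trivialization S B.proj}
  (he : IsSmoothTriv e) {U : Set B.base} (hU : IsOpen U) (hUe : U ⊆ e.baseSet)
  {α β : B.base × S → S} (hα : ContMDiffOn (B.base.I.prod S.I) S.I ∞ α (U ×ˢ Set.univ))
  (hβ : ContMDiffOn (B.base.I.prod S.I) S.I ∞ β (U ×ˢ Set.univ))
  (hαβ : ∀ m ∈ U, ∀ s, α (m, β (m, s)) = s) (hβα : ∀ m ∈ U, ∀ s, β (m, α (m, s)) = s)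

include he hUe hα in
theorem contMDiffOn_twist : ContMDiffOn B.total.I (B.base.I.prod S.I) ∞
    (fun x => (B.proj x, α (B.proj x, (e x).2))) (B.proj ⁻¹' U) := by
  have h1 : ContMDiffOn B.total.I (B.base.I.prod S.I) ∞ e (B.proj ⁻¹' U) :=
    he.1.mono fun x hx => e.mem_source.2 (hUe hx)
  refine B.smooth_proj.contMDiffOn.prodMk (hα.comp
    (B.smooth_proj.contMDiffOn.prodMk (contMDiff_snd.comp_contMDiffOn h1)) fun x hx => ?_)
  exact ⟨hx, trivial⟩

include he hUe hβ in
theorem contMDiffOn_twist_symm : ContMDiffOn (B.base.I.prod S.I) B.total.I ∞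
    (fun y => e.toOpenPartialHomeomorph.symm (y.1, β y)) (U ×ˢ Set.univ) :=
  he.2.comp (contMDiffOn_fst.prodMk hβ) fun _ hy => e.mem_target.2 (hUe hy.1)

/-- The modification of a trivialisation by a family of diffeomorphisms of the standard fibre. -/
noncomputable def Bundle.Trivialization.twist : Bundle.Trivialization S B.proj where
  toFun x := (B.proj x, α (B.proj x, (e x).2))
  invFun y := e.toOpenPartialHomeomorph.symm (y.1, β y)
  source := B.proj ⁻¹' U
  target := U ×ˢ Set.univ
  baseSet := U
  map_source' x hx := ⟨hx, trivial⟩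
  map_target' y hy := by
    rw [Set.mem_preimage, e.proj_symm_apply' (hUe hy.1)]
    exact hy.1
  left_inv' x hx := by
    rw [hβα _ hx]
    exact e.symm_eq_of_apply_eq rfl (hUe hx) rfl
  right_inv' y hy := by
    rw [e.proj_symm_apply' (hUe hy.1), e.snd_apply_symm (hUe hy.1)]
    exact Prod.ext rfl (hαβ _ hy.1 y.2)
  open_source := hU.preimage B.smooth_proj.continuous
  open_target := hU.prod isOpen_univ
  continuousOn_toFun := (contMDiffOn_twist he hUe hα).continuousOn
  continuousOn_invFun := (contMDiffOn_twist_symm he hUe hβ).continuousOn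
  open_baseSet := hU
  source_eq := rfl
  target_eq := rfl
  proj_toFun _ _ := rfl

end Twist

/-- The modification of a trivialisation by a smooth family of invertible matrices. -/
theorem exists_matrix_twist {B : FibreBundle.{u} (vecMfd 𝕜 p q)}
    {e : Bundle.Trivialization (vecMfd 𝕜 p q) B.proj} (he : IsSmoothTriv e) {U : Set B.base}
    (hU : IsOpen U) (hUe : U ⊆ e.baseSet) {P Q : B.base → 𝔐}
    (hP : SmoothEntries P U) (hQ : SmoothEntries Q U)
    (hPQ : ∀ m ∈ U, P m * Q m = 1) :
    ∃ e' : Bundle.Trivialization (vecMfd 𝕜 p q) B.proj, e'.baseSet = U ∧ IsSmoothTriv e' ∧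
      ∀ x, B.proj x ∈ U → ((e' x).2 : 𝔼) = P (B.proj x) *ᵥ (e x).2 := by
  have hmul : ∀ R : B.base → 𝔐, SmoothEntries R U →
      ContMDiffOn (B.base.I.prod 𝓘(ℝ, 𝔼)) 𝓘(ℝ, 𝔼) ∞
        (fun y : B.base × 𝔼 => R y.1 *ᵥ y.2) (U ×ˢ Set.univ) := fun R hR =>
    contMDiffOn_mulVec (fun i j => (hR i j).comp contMDiffOn_fst fun y hy => hy.1)
      contMDiffOn_snd
  have hPQ' : ∀ m ∈ U, ∀ v : 𝔼, P m *ᵥ (Q m *ᵥ v) = v := fun m hm v => by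
    rw [Matrix.mulVec_mulVec, hPQ m hm, Matrix.one_mulVec]
  have hQP : ∀ m ∈ U, ∀ v : 𝔼, Q m *ᵥ (P m *ᵥ v) = v := fun m hm v => by
    rw [Matrix.mulVec_mulVec, mul_eq_one_comm.1 (hPQ m hm), Matrix.one_mulVec]
  exact ⟨Bundle.Trivialization.twist (S := vecMfd 𝕜 p q) (α := fun y => P y.1 *ᵥ y.2)
    (β := fun y => Q y.1 *ᵥ y.2) he hU hUe (hmul P hP) (hmul Q hQ)
    hPQ' hQP, rfl, ⟨contMDiffOn_twist he hUe (hmul P hP),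
      contMDiffOn_twist_symm he hUe (hmul Q hQ)⟩, fun x _ => rfl⟩

end MatrixTriv

/-! ### Local orthonormal frames of metrised bundles. -/

section MetricBundles

variable {𝕜 : Type} [RCLike 𝕜] {p q : ℕ}

local notation "𝔼" => Fin p ⊕ Fin q → 𝕜
local notation "𝔐" => Matrix (Fin p ⊕ Fin q) (Fin p ⊕ Fin q) 𝕜

namespace MVB

variable (V : MVB.{u} 𝕜 p q) {e e' : Bundle.Trivialization (vecMfd 𝕜 p q) V.bundle.proj}

/-- A trivialisation that is linear on fibres. -/
def IsLinear (e : Bundle.Trivialization (vecMfd 𝕜 p q) V.bundle.proj) : Prop :=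
  ∀ m ∈ e.baseSet, IsLinearMap 𝕜 fun x : V.Fibre m => ((e x.1).2 : 𝔼)

/-- A trivialisation that is linear and isometric on fibres. -/
def IsIsometric (e : Bundle.Trivialization (vecMfd 𝕜 p q) V.bundle.proj) : Prop :=
  V.IsLinear e ∧ ∀ m ∈ e.baseSet, ∀ x y : V.Fibre m, V.metric x y = pqForm (e x.1).2 (e y.1).2

variable {V}

/-- The coordinates on a fibre given by a linear trivialisation. -/
noncomputable def IsLinear.coord (h : V.IsLinear e) {m : V.bundle.base} (hm : m ∈ e.baseSet) :
    V.Fibre m ≃ₗ[𝕜] 𝔼 where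
  toFun x := (e x.1).2
  map_add' := (h m hm).map_add
  map_smul' := (h m hm).map_smul
  invFun v := ⟨e.toOpenPartialHomeomorph.symm (m, v), e.proj_symm_apply' hm⟩
  left_inv x := Subtype.ext (e.symm_eq_of_apply_eq x.2 hm rfl)
  right_inv v := e.snd_apply_symm hm v

theorem metric_add_left {m : V.bundle.base} (x y z : V.Fibre m) :
    V.metric (x + y) z = V.metric x z + V.metric y z := by
  have h : ∀ a b : V.Fibre m, V.metric a b = starRingEnd 𝕜 (V.metric b a) := fun a b =>
    V.str.metric_symm m b a
  rw [h, h x, h y, ← map_add]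
  exact congrArg _ (V.str.metric_add m z x y)

theorem metric_smul_left {m : V.bundle.base} (c : 𝕜) (x y : V.Fibre m) :
    V.metric (c • x) y = starRingEnd 𝕜 c * V.metric x y := by
  have h : ∀ a b : V.Fibre m, V.metric a b = starRingEnd 𝕜 (V.metric b a) := fun a b =>
    V.str.metric_symm m b a
  rw [h, h x, ← map_mul]
  exact congrArg _ (V.str.metric_smul m y c x)

/-- The metric as a sesquilinear map. -/
noncomputable def metricHom (m : V.bundle.base) : V.Fibre m →ₗ⋆[𝕜] V.Fibre m →ₗ[𝕜] 𝕜 :=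
  LinearMap.mk₂'ₛₗ (starRingEnd 𝕜) (RingHom.id 𝕜) V.metric metric_add_left metric_smul_left
    (V.str.metric_add m) fun c x y => V.str.metric_smul m x c y

open scoped Classical in
/-- The Gram matrix of the local frame given by a linear trivialisation. -/
noncomputable def IsLinear.gram (h : V.IsLinear e) (m : V.bundle.base) : 𝔐 :=
  if hm : m ∈ e.baseSet then Matrix.of fun i j =>
    V.metric ((h.coord hm).symm (Pi.single i 1)) ((h.coord hm).symm (Pi.single j 1)) else 0

theorem IsLinear.metric_eq (h : V.IsLinear e) {m : V.bundle.base} (hm : m ∈ e.baseSet)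
    (x y : V.Fibre m) : V.metric x y = (h.gram m).sesq (h.coord hm x) (h.coord hm y) := by
  have hx : ∀ x : V.Fibre m, x = ∑ i, h.coord hm x i • (h.coord hm).symm (Pi.single i 1) := by
    intro x
    apply (h.coord hm).injective
    rw [map_sum]
    simp only [map_smul, LinearEquiv.apply_symm_apply]
    exact pi_eq_sum_univ' _
  have h1 : V.metric x y = metricHom m x y := rfl
  rw [h1]
  conv_lhs => rw [hx x, hx y]
  simp only [map_sum, LinearMap.sum_apply, map_smulₛₗ, LinearMap.smul_apply, RingHom.id_apply,
    smul_eq_mul, Finset.mul_sum]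
  rw [Matrix.sesq, dotProduct, Finset.sum_comm]
  refine Finset.sum_congr rfl fun i _ => ?_
  rw [Matrix.mulVec, dotProduct, Finset.mul_sum]
  refine Finset.sum_congr rfl fun j _ => ?_
  rw [IsLinear.gram, dif_pos hm, Matrix.of_apply, Pi.star_apply]
  have h2 : ∀ a b : V.Fibre m, metricHom m a b = V.metric a b := fun _ _ => rfl
  rw [h2]
  simp only [RCLike.star_def]
  ring

theorem IsLinear.isHermitian_gram (h : V.IsLinear e) (m : V.bundle.base) :
    (h.gram m).IsHermitian := by
  by_cases hm : m ∈ e.baseSet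
  · ext i j
    rw [Matrix.conjTranspose_apply, IsLinear.gram, dif_pos hm]
    exact (V.str.metric_symm m _ _).symm
  · rw [IsLinear.gram, dif_neg hm]
    exact Matrix.isHermitian_zero

/-- Smoothness of the metric is only given on pairs of smooth sections. Constant coordinate vectors
provide such sections over the base set, and the entries are their products. -/
theorem IsLinear.smooth_gram (h : V.IsLinear e) (he : IsSmoothTriv e) :
    SmoothEntries h.gram e.baseSet := by
  classical
  intro i j
  -- Sections have to be defined everywhere but smooth only over the base set, so zero does outside
  -- it.
  let σ : (Fin p ⊕ Fin q) → ∀ m, V.bundle.Fibre m := fun i m =>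
    if hm : m ∈ e.baseSet then (h.coord hm).symm (Pi.single i 1) else (0 : V.Fibre m)
  have hσe : ∀ i m (hm : m ∈ e.baseSet), σ i m = (h.coord hm).symm (Pi.single i 1) :=
    fun i m hm => dif_pos hm
  have hσ : ∀ i, ContMDiffOn V.bundle.base.I V.bundle.total.I ∞ (fun m => (σ i m).1)
      e.baseSet := by
    intro i
    have h1 : ContMDiffOn V.bundle.base.I V.bundle.total.I ∞
        (fun m => e.toOpenPartialHomeomorph.symm (m, (Pi.single i 1 : 𝔼))) e.baseSet :=
      he.2.comp (contMDiffOn_id.prodMk contMDiffOn_const) fun m hm => e.mem_target.2 hm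
    refine h1.congr fun m hm => ?_
    rw [hσe i m hm]
    rfl
  refine (V.str.smooth_metric e.baseSet (σ i) (σ j) e.open_baseSet (hσ i) (hσ j)).congr
    fun m hm => ?_
  rw [hσe i m hm, hσe j m hm, IsLinear.gram, dif_pos hm]
  rfl

/-- Coordinates carry the definite subspaces that realise the two indices to `𝔼`, where Sylvester's
law applies. This is pointwise only; smoothness is supplied by `exists_smooth_conj_eq_pqMatrix`. -/
theorem IsLinear.exists_conj_gram (h : V.IsLinear e) {m : V.bundle.base} (hm : m ∈ e.baseSet) :
    ∃ C : 𝔐, Cᴴ * h.gram m * C = pqMatrix 𝕜 p q := by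
  obtain ⟨N, hNp, hN⟩ : ∃ N : Submodule 𝕜 (V.Fibre m), Module.finrank 𝕜 N = p ∧
    ∀ x ∈ N, x ≠ 0 → RCLike.re (V.metric x x) < 0 := (V.str.negative_index m).1
  obtain ⟨Q, hQq, hQ⟩ : ∃ Q : Submodule 𝕜 (V.Fibre m), Module.finrank 𝕜 Q = q ∧
    ∀ x ∈ Q, x ≠ 0 → 0 < RCLike.re (V.metric x x) := (V.str.positive_index m).1
  refine exists_conj_eq_pqMatrix (h.isHermitian_gram m)
    (N := N.map (h.coord hm).toLinearMap) (Q := Q.map (h.coord hm).toLinearMap)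
    ((LinearEquiv.finrank_map_eq _ _).trans hNp) ?_ ((LinearEquiv.finrank_map_eq _ _).trans hQq) ?_
  · rintro _ ⟨x, hx, rfl⟩ hne
    have := hN x hx fun h0 => hne (by rw [h0, map_zero])
    rwa [h.metric_eq hm] at this
  · rintro _ ⟨x, hx, rfl⟩ hne
    have := hQ x hx fun h0 => hne (by rw [h0, map_zero])
    rwa [h.metric_eq hm] at this

/-- If `P` is a smooth family of invertible matrices transforming the Gram matrix into the
standard form, then there is a corresponding isometric trivialisation. -/
theorem exists_isometric_of_gram (h : V.IsLinear e) (he : IsSmoothTriv e)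
    {U : Set V.bundle.base} (hU : IsOpen U) (hUe : U ⊆ e.baseSet) {Q : V.bundle.base → 𝔐}
    (hQ : SmoothEntries Q U) (hg : ∀ m ∈ U, (Q m)ᴴ * h.gram m * Q m = pqMatrix 𝕜 p q) :
    ∃ e' : Bundle.Trivialization (vecMfd 𝕜 p q) V.bundle.proj, e'.baseSet = U ∧
      IsSmoothTriv e' ∧ V.IsIsometric e' := by
  -- This is the inverse of `Q`, by `Qᴴ G Q = η` and `η * η = 1`, in a form whose smoothness is
  -- evident.
  set P : V.bundle.base → 𝔐 := fun m => pqMatrix 𝕜 p q * ((Q m)ᴴ * h.gram m) with hP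
  have hPs : SmoothEntries P U :=
    (SmoothEntries.const _).mul (hQ.conjTranspose.mul ((h.smooth_gram he).mono hUe))
  have hPQ : ∀ m ∈ U, P m * Q m = 1 := fun m hm => by
    rw [hP, Matrix.mul_assoc, hg m hm, pqMatrix_mul_self]
  obtain ⟨e', hb, hs, hP'⟩ := exists_matrix_twist he hU hUe hPs hQ hPQ
  have hc : ∀ m (hm : m ∈ e'.baseSet) (x : V.Fibre m),
      ((e' x.1).2 : 𝔼) = P m *ᵥ h.coord (hUe (hb ▸ hm)) x := fun m hm x => by
    have hx : V.bundle.proj x.1 = m := x.2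
    have h1 := hP' x.1 (by rw [hx]; exact hb ▸ hm)
    rwa [hx] at h1
  refine ⟨e', hb, hs, fun m hm => ⟨fun x y => ?_, fun c x => ?_⟩, fun m hm x y => ?_⟩
  · rw [hc m hm, hc m hm, hc m hm, map_add, Matrix.mulVec_add]
  · rw [hc m hm, hc m hm, map_smul, Matrix.mulVec_smul]
  · have hmU : m ∈ U := hb ▸ hm
    rw [hc m hm, hc m hm, h.metric_eq (hUe hmU), pqForm_eq_sesq, Matrix.sesq_mulVec_mulVec,
      ← hg m hmU]
    have h1 : Q m * P m = 1 := mul_eq_one_comm.1 (hPQ m hmU)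
    have h2 : (P m)ᴴ * (Q m)ᴴ = 1 := by
      rw [← Matrix.conjTranspose_mul, h1, Matrix.conjTranspose_one]
    have h3 : (P m)ᴴ * ((Q m)ᴴ * h.gram m * Q m) * P m =
        ((P m)ᴴ * (Q m)ᴴ) * h.gram m * (Q m * P m) := by simp only [Matrix.mul_assoc]
    rw [h3, h1, h2, Matrix.one_mul, Matrix.mul_one]

variable (V) in
/-- Local existence of smooth orthonormal frames. -/
theorem exists_isometric (m : V.bundle.base) :
    ∃ e : Bundle.Trivialization (vecMfd 𝕜 p q) V.bundle.proj,
      m ∈ e.baseSet ∧ IsSmoothTriv e ∧ V.IsIsometric e := by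
  obtain ⟨e, hm, he, h⟩ : ∃ e : Bundle.Trivialization (vecMfd 𝕜 p q) V.bundle.proj,
    m ∈ e.baseSet ∧ IsSmoothTriv e ∧ V.IsLinear e := V.str.locally_linear m
  -- A constant matrix `C` normalises the Gram matrix at `m`. Near `m` the result lies in the
  -- neighbourhood `W` of `η`, and `R` corrects the remaining deviation.
  obtain ⟨C, hC⟩ := h.exists_conj_gram hm
  obtain ⟨W, R, hW, hWη, hR, hRW⟩ := exists_smooth_conj_eq_pqMatrix 𝕜 p q
  have hA : SmoothEntries (fun x => Cᴴ * h.gram x * C) e.baseSet :=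
    ((SmoothEntries.const _).mul (h.smooth_gram he)).mul (SmoothEntries.const _)
  set U := e.baseSet ∩ (fun x => Cᴴ * h.gram x * C) ⁻¹' W with hU
  have hUo : IsOpen U := hA.continuousOn.isOpen_inter_preimage e.open_baseSet hW
  have hRs : SmoothEntries (fun x => C * R (Cᴴ * h.gram x * C)) U :=
    (SmoothEntries.const _).mul ((hA.mono Set.inter_subset_left).comp_contDiffOn hR
      fun x hx => hx.2)
  obtain ⟨e', hb, hs, hi⟩ := exists_isometric_of_gram h he hUo Set.inter_subset_left hRs
    fun x hx => by
      have h1 := hRW _ hx.2 (Matrix.isHermitian_conjTranspose_mul_mul C (h.isHermitian_gram x))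
      rw [← h1, Matrix.conjTranspose_mul]
      simp only [Matrix.mul_assoc]
  refine ⟨e', hb ▸ ⟨hm, ?_⟩, hs, hi⟩
  rw [Set.mem_preimage, hC]
  exact hWη

end MVB

end MetricBundles

/-! ### The atlas of isometric trivialisations. -/

section MetricFunctors

variable {𝕜 : Type} [RCLike 𝕜] {p q : ℕ}

attribute [local instance] Matrix.linftyOpNormedRing Matrix.linftyOpNormedAlgebra
  completeSpace_matrix

local notation "𝔼" => Fin p ⊕ Fin q → 𝕜
local notation "𝔐" => Matrix (Fin p ⊕ Fin q) (Fin p ⊕ Fin q) 𝕜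

theorem Compatible.exists_snd_eq {G : LieGrp} {S : Mfd.{0}} {lam : EffectiveAction G S}
    {F M : Mfd.{u}} {π : F → M} {e e' : Bundle.Trivialization S π} (h : Compatible lam e e') {m : M}
    (hm : m ∈ e.baseSet) (hm' : m ∈ e'.baseSet) :
    ∃ g : G, ∀ x, π x = m → (e x).2 = lam.act g (e' x).2 := by
  obtain ⟨g, -, hg⟩ := h
  refine ⟨g m, fun x hx => ?_⟩
  have h1 := congrArg Prod.snd (hg m ⟨hm, hm'⟩ (e' x).2)
  rwa [e'.symm_eq_of_apply_eq hx hm' rfl] at h1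

namespace MVB

variable {V W : MVB.{u} 𝕜 p q}

/-- In isometric trivialisations, a map of metrised bundles is given by elements of
`O(𝕜, (p, q))`. -/
theorem exists_pqO_of_hom (f : V ⟶ W) {e : Bundle.Trivialization (vecMfd 𝕜 p q) V.bundle.proj}
    (h : V.IsIsometric e) {e' : Bundle.Trivialization (vecMfd 𝕜 p q) W.bundle.proj}
    (h' : W.IsIsometric e') {m : V.bundle.base} (hm : m ∈ e.baseSet)
    (hm' : f.hom.base.toFun m ∈ e'.baseSet) : ∃ g ∈ pqO 𝕜 p q, ∀ v : 𝔼,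
      ((e' (f.hom.total.toFun (e.toOpenPartialHomeomorph.symm (m, v)))).2 : 𝔼) =
        (g : 𝔐) *ᵥ v := by
  refine exists_pqO_of_isometry (T := fun v =>
    h'.1.coord hm' (onFibre f.hom m ((h.1.coord hm).symm v))) ⟨fun x y => ?_, fun c x => ?_⟩
    fun v w => ?_
  · rw [map_add, (f.linear m).map_add, map_add]
  · rw [map_smul, (f.linear m).map_smul, map_smul]
  · have h1 := h'.2 _ hm' (onFibre f.hom m ((h.1.coord hm).symm v))
      (onFibre f.hom m ((h.1.coord hm).symm w))
    have h2 := h.2 _ hm ((h.1.coord hm).symm v) ((h.1.coord hm).symm w)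
    refine h1.symm.trans ((f.isometry m _ _).trans (h2.trans ?_))
    exact congrArg₂ pqForm ((h.1.coord hm).apply_symm_apply v)
      ((h.1.coord hm).apply_symm_apply w)

/-- A trivialisation that differs from isometric ones by isometries is isometric. -/
theorem isIsometric_of_exists_act {e : Bundle.Trivialization (vecMfd 𝕜 p q) V.bundle.proj}
    (H : ∀ m ∈ e.baseSet, ∃ e' : Bundle.Trivialization (vecMfd 𝕜 p q) V.bundle.proj,
      V.IsIsometric e' ∧ m ∈ e'.baseSet ∧ ∃ g ∈ pqO 𝕜 p q, ∀ x, V.bundle.proj x = m →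
        ((e x).2 : 𝔼) = (g : 𝔐) *ᵥ (e' x).2) : V.IsIsometric e := by
  refine ⟨fun m hm => ?_, fun m hm x y => ?_⟩
  · obtain ⟨e', h', hm', g, hg, hx⟩ := H m hm
    have h1 : ∀ x : V.Fibre m, ((e x.1).2 : 𝔼) = (g : 𝔐) *ᵥ h'.1.coord hm' x :=
      fun x => hx x.1 x.2
    exact ⟨fun x y => by rw [h1, h1, h1, map_add, Matrix.mulVec_add],
      fun c x => by rw [h1, h1, map_smul, Matrix.mulVec_smul]⟩
  · obtain ⟨e', h', hm', g, hg, hx⟩ := H m hm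
    rw [h'.2 m hm', hx x.1 x.2, hx y.1 y.2, pqForm_mulVec_of_mem hg]

variable (V) in
/-- The bundle atlas of isometric trivialisations. -/
noncomputable def isometricStructure : GStructure (actO 𝕜 p q) V.bundle where
  atlas := {e | IsSmoothTriv e ∧ V.str.IsIsometricTriv e}
  smooth _ he := he.1
  cover m := let ⟨e, hm, he, h⟩ := V.exists_isometric m; ⟨e, ⟨he, h⟩, hm⟩
  compatible e he e' he' := by
    -- A change of trivialisation is the identity map of the bundle written in two trivialisations.
    obtain ⟨g, hg, h⟩ := locallyG_of_matrix (isExpModel_pqO 𝕜 p q) (𝟙 V.bundle) he'.1 he.1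
      fun m hm hm' => exists_pqO_of_hom (𝟙 V) he'.2 he.2 hm hm'
    exact ⟨g, hg.mono fun x hx => ⟨hx.2, hx.1⟩, fun m hm s => h m ⟨hm.2, hm.1⟩ s⟩
  maximal e hs he := by
    -- Around each point the given trivialisation differs from an isometric one by orthogonal
    -- matrices, so it is isometric itself.
    refine ⟨hs, isIsometric_of_exists_act fun m hm => ?_⟩
    obtain ⟨e', hm', he', h'⟩ := V.exists_isometric m
    obtain ⟨g, hg⟩ := (he e' ⟨he', h'⟩).exists_snd_eq hm hm'
    exact ⟨e', h', hm', g.1, g.2, hg⟩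

end MVB

/-! ### The metric determined by an atlas. -/

section OfStructure

variable {H : Subgroup (Matrix (Fin p ⊕ Fin q) (Fin p ⊕ Fin q) 𝕜)ˣ}
  {L : Submodule ℝ (Matrix (Fin p ⊕ Fin q) (Fin p ⊕ Fin q) 𝕜)} {h : LinLie.IsExpModel H L}
  {B : FibreBundle.{u} (vecMfd 𝕜 p q)} (A : GStructure (matrixAction h) B)

namespace GStructure

/-- A trivialisation of the atlas around a point. -/
noncomputable def trivAt (m : B.base) : Bundle.Trivialization (vecMfd 𝕜 p q) B.proj :=
  (A.cover m).choose

theorem trivAt_mem (m : B.base) : A.trivAt m ∈ A.atlas := (A.cover m).choose_spec.1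

theorem mem_trivAt (m : B.base) : m ∈ (A.trivAt m).baseSet := (A.cover m).choose_spec.2

/-- Coordinates on a fibre. -/
noncomputable def fibreEquiv (m : B.base) : B.Fibre m ≃ (Fin p ⊕ Fin q → 𝕜) where
  toFun x := (A.trivAt m x.1).2
  invFun v := ⟨(A.trivAt m).toOpenPartialHomeomorph.symm (m, v),
    (A.trivAt m).proj_symm_apply' (A.mem_trivAt m)⟩
  left_inv x := Subtype.ext ((A.trivAt m).symm_eq_of_apply_eq x.2 (A.mem_trivAt m) rfl)
  right_inv v := (A.trivAt m).snd_apply_symm (A.mem_trivAt m) v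

/-- The additive group structure on a fibre. -/
noncomputable abbrev fibreAddCommGroup (m : B.base) : AddCommGroup (B.Fibre m) :=
  (A.fibreEquiv m).addCommGroup

/-- The vector space structure on a fibre. -/
noncomputable abbrev fibreModule (m : B.base) :
    @Module 𝕜 (B.Fibre m) _ (A.fibreAddCommGroup m).toAddCommMonoid :=
  (A.fibreEquiv m).module 𝕜

theorem fibreEquiv_add (m : B.base) (x y : B.Fibre m) :
    letI := A.fibreAddCommGroup m
    A.fibreEquiv m (x + y) = A.fibreEquiv m x + A.fibreEquiv m y :=
  (A.fibreEquiv m).apply_symm_apply _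

theorem fibreEquiv_smul (m : B.base) (c : 𝕜) (x : B.Fibre m) :
    letI := A.fibreAddCommGroup m
    letI := A.fibreModule m
    A.fibreEquiv m (c • x) = c • A.fibreEquiv m x :=
  (A.fibreEquiv m).apply_symm_apply _

theorem exists_snd_eq_fibreEquiv {e : Bundle.Trivialization (vecMfd 𝕜 p q) B.proj}
    (he : e ∈ A.atlas) {m : B.base} (hm : m ∈ e.baseSet) :
    ∃ g ∈ H, ∀ x : B.Fibre m, ((e x.1).2 : 𝔼) = (g : 𝔐) *ᵥ A.fibreEquiv m x := by
  obtain ⟨g, hg⟩ := (A.compatible e he _ (A.trivAt_mem m)).exists_snd_eq hm (A.mem_trivAt m)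
  exact ⟨g.1, g.2, fun x => hg x.1 x.2⟩

/-- The metric on a fibre. -/
noncomputable def fibreMetric (m : B.base) (x y : B.Fibre m) : 𝕜 :=
  pqForm (A.fibreEquiv m x) (A.fibreEquiv m y)

/-- The metric is transported by one chosen trivialisation at each point, but transitions are
isometries, so every trivialisation of the atlas gives the same metric. -/
theorem fibreMetric_eq (hH : H ≤ pqO 𝕜 p q) {e : Bundle.Trivialization (vecMfd 𝕜 p q) B.proj}
    (he : e ∈ A.atlas) {m : B.base} (hm : m ∈ e.baseSet) (x y : B.Fibre m) :
    A.fibreMetric m x y = pqForm (e x.1).2 (e y.1).2 := by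
  obtain ⟨g, hg, h1⟩ := A.exists_snd_eq_fibreEquiv he hm
  rw [h1, h1, pqForm_mulVec_of_mem (hH hg)]
  rfl

theorem isLinearMap_of_mem {e : Bundle.Trivialization (vecMfd 𝕜 p q) B.proj}
    (he : e ∈ A.atlas) {m : B.base} (hm : m ∈ e.baseSet) :
    letI := A.fibreAddCommGroup m
    letI := A.fibreModule m
    IsLinearMap 𝕜 fun x : B.Fibre m => ((e x.1).2 : 𝔼) := by
  obtain ⟨g, hg, h1⟩ := A.exists_snd_eq_fibreEquiv he hm
  refine @IsLinearMap.mk 𝕜 (B.Fibre m) 𝔼 _ (A.fibreAddCommGroup m).toAddCommMonoid _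
    (A.fibreModule m) _ _ (fun x y => ?_) fun c x => ?_
  · rw [h1, h1, h1, A.fibreEquiv_add, Matrix.mulVec_add]
  · rw [h1, h1, A.fibreEquiv_smul, Matrix.mulVec_smul]

/-- The trivialisation chosen at a point varies without any continuity. Near `m` all products are
therefore computed in the single trivialisation chosen at `m`. -/
theorem contMDiffOn_fibreMetric (hH : H ≤ pqO 𝕜 p q) {U : Set B.base}
    {σ τ : ∀ m, B.Fibre m} (hU : IsOpen U)
    (hσ : ContMDiffOn B.base.I B.total.I ∞ (fun m => (σ m).1) U)
    (hτ : ContMDiffOn B.base.I B.total.I ∞ (fun m => (τ m).1) U) :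
    ContMDiffOn B.base.I 𝓘(ℝ, 𝕜) ∞ (fun m => A.fibreMetric m (σ m) (τ m)) U := by
  intro m hm
  set e := A.trivAt m
  have he := A.trivAt_mem m
  have hsec : ∀ ρ : ∀ m, B.Fibre m, ContMDiffOn B.base.I B.total.I ∞ (fun m => (ρ m).1) U →
      ContMDiffOn B.base.I 𝓘(ℝ, 𝔼) ∞ (fun m => (e (ρ m).1).2) (U ∩ e.baseSet) := fun ρ hρ =>
    contMDiff_snd.comp_contMDiffOn ((A.smooth e he).1.comp (hρ.mono Set.inter_subset_left)
      fun x hx => e.mem_source.2 ((ρ x).2.symm ▸ hx.2))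
  have h1 := contDiff_pqForm.contMDiff.comp_contMDiffOn ((hsec σ hσ).prodMk_space (hsec τ hτ))
  have h2 : ContMDiffOn B.base.I 𝓘(ℝ, 𝕜) ∞ (fun m => A.fibreMetric m (σ m) (τ m))
      (U ∩ e.baseSet) := h1.congr fun x hx => A.fibreMetric_eq hH he hx.2 _ _
  exact (h2.contMDiffAt ((hU.inter e.open_baseSet).mem_nhds
    ⟨hm, A.mem_trivAt m⟩)).contMDiffWithinAt

/-- The linear coordinates on a fibre. -/
noncomputable def fibreLinearEquiv (m : B.base) :
    letI := A.fibreAddCommGroup m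
    letI := A.fibreModule m
    B.Fibre m ≃ₗ[𝕜] (Fin p ⊕ Fin q → 𝕜) :=
  letI := A.fibreAddCommGroup m
  letI := A.fibreModule m
  { A.fibreEquiv m with
    map_add' := A.fibreEquiv_add m
    map_smul' := A.fibreEquiv_smul m }

/-- A linear isomorphism matches subspaces with their dimensions. The predicate is left general so
that both signs of definiteness are covered. -/
theorem isGreatest_index {E F : Type*} [AddCommGroup E] [Module 𝕜 E] [AddCommGroup F] [Module 𝕜 F]
    (f : E ≃ₗ[𝕜] F) {P : E → Prop} {P' : F → Prop} (hP : ∀ x, P x ↔ P' (f x)) {n : ℕ}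
    (hn : IsGreatest {d | ∃ N : Submodule 𝕜 F, Module.finrank 𝕜 N = d ∧
      ∀ x ∈ N, x ≠ 0 → P' x} n) :
    IsGreatest {d | ∃ N : Submodule 𝕜 E, Module.finrank 𝕜 N = d ∧ ∀ x ∈ N, x ≠ 0 → P x} n := by
  constructor
  · obtain ⟨N, hN, hx⟩ := hn.1
    refine ⟨N.map f.symm.toLinearMap, (LinearEquiv.finrank_map_eq f.symm N).trans hN, ?_⟩
    rintro _ ⟨x, hxN, rfl⟩ hne
    have h1 := hx x hxN fun h => hne (by rw [h, map_zero])
    rw [hP]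
    simpa using h1
  · rintro d ⟨N, rfl, hx⟩
    refine hn.2 ⟨N.map f.toLinearMap, LinearEquiv.finrank_map_eq f N, ?_⟩
    rintro _ ⟨x, hxN, rfl⟩ hne
    exact (hP x).1 (hx x hxN fun h => hne (by rw [h, map_zero]))

/-- The metrised vector bundle structure determined by a bundle atlas with structure group
contained in `O(𝕜, (p, q))`. -/
noncomputable def toMetricStructure (hH : H ≤ pqO 𝕜 p q) : MetricStructure 𝕜 p q B where
  acg := A.fibreAddCommGroup
  mod := A.fibreModule
  locally_linear m := ⟨A.trivAt m, A.mem_trivAt m, A.smooth _ (A.trivAt_mem m),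
    fun _ hm' => A.isLinearMap_of_mem (A.trivAt_mem m) hm'⟩
  metric := A.fibreMetric
  metric_add m x y z := by
    rw [fibreMetric, A.fibreEquiv_add]
    exact Matrix.sesq_add_right _ _ _ _
  metric_smul m x c y := by
    rw [fibreMetric, A.fibreEquiv_smul]
    exact Matrix.sesq_smul_right _ _ _ _
  metric_symm m x y := (pqMatrix_isHermitian 𝕜 p q).sesq_symm _ _
  nondegenerate m x hx := by
    let _ := A.fibreAddCommGroup m
    let _ := A.fibreModule m
    refine (A.fibreLinearEquiv m).map_eq_zero_iff.1 (pqForm_nondegenerate _ fun w => ?_)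
    have h1 := hx ((A.fibreEquiv m).symm w)
    rwa [fibreMetric, Equiv.apply_symm_apply] at h1
  smooth_metric U σ τ hU hσ hτ := A.contMDiffOn_fibreMetric hH hU hσ hτ
  negative_index m :=
    letI := A.fibreAddCommGroup m
    letI := A.fibreModule m
    isGreatest_index (A.fibreLinearEquiv m) (fun _ => Iff.rfl) (pqForm_negative_index 𝕜 p q)
  positive_index m :=
    letI := A.fibreAddCommGroup m
    letI := A.fibreModule m
    isGreatest_index (A.fibreLinearEquiv m) (fun _ => Iff.rfl) (pqForm_positive_index 𝕜 p q)

theorem isIsometricTriv_of_mem (hH : H ≤ pqO 𝕜 p q)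
    {e : Bundle.Trivialization (vecMfd 𝕜 p q) B.proj} (he : e ∈ A.atlas) :
    (A.toMetricStructure hH).IsIsometricTriv e :=
  ⟨fun _ hm => A.isLinearMap_of_mem he hm, fun _ hm => A.fibreMetric_eq hH he hm⟩

end GStructure

end OfStructure

end MetricFunctors

/-! ### The isomorphism between metrised bundles and `O(𝕜, (p, q))`-bundles. -/

section

variable {𝕜 : Type} [RCLike 𝕜] {p q : ℕ}

attribute [local instance] Matrix.linftyOpNormedRing Matrix.linftyOpNormedAlgebra
  completeSpace_matrix

local notation "𝔼" => Fin p ⊕ Fin q → 𝕜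
local notation "𝔐" => Matrix (Fin p ⊕ Fin q) (Fin p ⊕ Fin q) 𝕜

/-- Members of the larger atlas are compatible with the smaller one, hence belong to it by
maximality. -/
theorem GStructure.eq_of_subset {G : LieGrp} {S : Mfd.{0}} {lam : EffectiveAction G S}
    {B : FibreBundle.{u} S} {A A' : GStructure lam B} (h : A.atlas ⊆ A'.atlas) : A = A' :=
  ext_atlas (h.antisymm fun e he =>
    A.maximal e (A'.smooth e he) fun e' he' => A'.compatible e he e' (h he'))

/-- A trivialisation is injective on fibres, so one that is isometric for both structures forces
their additions, scalar multiplications and metrics to coincide. This yields equality of objects, as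
an isomorphism of categories requires. -/
theorem MetricStructure.eq_of_isIsometricTriv {B : FibreBundle.{u} (vecMfd 𝕜 p q)}
    {s s' : MetricStructure 𝕜 p q B}
    (H : ∀ m, ∃ e : Bundle.Trivialization (vecMfd 𝕜 p q) B.proj, m ∈ e.baseSet ∧
      s.IsIsometricTriv e ∧ s'.IsIsometricTriv e) : s = s' := by
  obtain @⟨acg, mod, ll, g, ga, gs, gsymm, nd, sm, ni, pi⟩ := s
  obtain @⟨acg', mod', ll', g', ga', gs', gsymm', nd', sm', ni', pi'⟩ := s'
  have inj : ∀ {m : B.base} {e : Bundle.Trivialization (vecMfd 𝕜 p q) B.proj}, m ∈ e.baseSet →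
      ∀ x y : B.Fibre m, ((e x.1).2 : 𝔼) = (e y.1).2 → x = y := fun hm x y h =>
    Subtype.ext (Bundle.Trivialization.ext_of_mem _ (x.2.symm ▸ hm) (x.2.trans y.2.symm) h)
  obtain rfl : acg = acg' := funext fun m => by
    obtain ⟨e, hm, h, h'⟩ := H m
    refine AddCommGroup.ext (funext fun x => funext fun y => inj hm _ _ ?_)
    exact (@IsLinearMap.map_add _ _ _ _ (acg m).toAddCommMonoid _ (mod m) _ _ (h.1 m hm) x y).trans
      (@IsLinearMap.map_add _ _ _ _ (acg' m).toAddCommMonoid _ (mod' m) _ _ (h'.1 m hm) x y).symm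
  obtain rfl : mod = mod' := funext fun m => by
    obtain ⟨e, hm, h, h'⟩ := H m
    refine Module.ext' _ _ fun c x => inj hm _ _ ?_
    exact (@IsLinearMap.map_smul _ _ _ _ (acg m).toAddCommMonoid _ (mod m) _ _ (h.1 m hm) c x).trans
      (@IsLinearMap.map_smul _ _ _ _ (acg m).toAddCommMonoid _ (mod' m) _ _ (h'.1 m hm) c x).symm
  obtain rfl : g = g' := funext fun m => funext fun x => funext fun y => by
    obtain ⟨e, hm, h, h'⟩ := H m
    exact (h.2 m hm x y).trans (h'.2 m hm x y).symm
  rfl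

namespace MVB

/-- A map of bundles given by isometries in isometric trivialisations is a map of metrised vector
bundles. -/
theorem linear_isometry_of_exists_act {V W : MVB.{u} 𝕜 p q} (f : V.bundle ⟶ W.bundle)
    (H : ∀ m, ∃ e : Bundle.Trivialization (vecMfd 𝕜 p q) V.bundle.proj, V.IsIsometric e ∧
      m ∈ e.baseSet ∧ ∃ e' : Bundle.Trivialization (vecMfd 𝕜 p q) W.bundle.proj,
      W.IsIsometric e' ∧ f.base.toFun m ∈ e'.baseSet ∧ ∃ g ∈ pqO 𝕜 p q, ∀ x : V.Fibre m,
        ((e' (f.total.toFun x.1)).2 : 𝔼) = (g : 𝔐) *ᵥ (e x.1).2) :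
    (∀ m, IsLinearMap 𝕜 (onFibre f m : V.Fibre m → W.Fibre (f.base.toFun m))) ∧
    ∀ m (x y : V.Fibre m), W.metric (onFibre f m x) (onFibre f m y) = V.metric x y := by
  refine ⟨fun m => ?_, fun m x y => ?_⟩
  · obtain ⟨e, h, hm, e', h', hm', g, hg, hx⟩ := H m
    have h1 : ∀ x : V.Fibre m, h'.1.coord hm' (onFibre f m x) = (g : 𝔐) *ᵥ h.1.coord hm x := hx
    refine ⟨fun x y => (h'.1.coord hm').injective ?_, fun c x => (h'.1.coord hm').injective ?_⟩
    · rw [h1, map_add, map_add, h1, h1, Matrix.mulVec_add]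
    · rw [h1, map_smul, map_smul, h1, Matrix.mulVec_smul]
  · obtain ⟨e, h, hm, e', h', hm', g, hg, hx⟩ := H m
    rw [h'.2 _ hm', h.2 _ hm]
    refine (congrArg₂ pqForm (hx x) (hx y)).trans (pqForm_mulVec_of_mem hg _ _)

section OfGHom

variable {H : Subgroup (Matrix (Fin p ⊕ Fin q) (Fin p ⊕ Fin q) 𝕜)ˣ}
  {L : Submodule ℝ (Matrix (Fin p ⊕ Fin q) (Fin p ⊕ Fin q) 𝕜)} {h : LinLie.IsExpModel H L}
  {V W : MVB.{u} 𝕜 p q} {A : GStructure (matrixAction h) V.bundle}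
  {A' : GStructure (matrixAction h) W.bundle}

theorem exists_mulVec_of_gHom
    (F : (⟨V.bundle, A⟩ : GBundle.{u} (matrixAction h)) ⟶ ⟨W.bundle, A'⟩)
    {e : Bundle.Trivialization (vecMfd 𝕜 p q) V.bundle.proj} (he : e ∈ A.atlas)
    {e' : Bundle.Trivialization (vecMfd 𝕜 p q) W.bundle.proj} (he' : e' ∈ A'.atlas)
    {m : V.bundle.base} (hm : m ∈ e.baseSet) (hm' : F.hom.base.toFun m ∈ e'.baseSet) :
    ∃ g ∈ H, ∀ x : V.Fibre m,
      ((e' (F.hom.total.toFun x.1)).2 : 𝔼) = (g : 𝔐) *ᵥ (e x.1).2 := by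
  obtain ⟨k, -, hk⟩ := F.locally_G e he e' he'
  refine ⟨(k m).1, (k m).2, fun x => ?_⟩
  have h1 := congrArg Prod.snd (hk m ⟨hm, hm'⟩ (e x.1).2)
  rwa [e.symm_eq_of_apply_eq x.2 hm rfl] at h1

/-- A map of bundles with structure group contained in `O(𝕜, (p, q))`, as a map of metrised vector
bundles. -/
noncomputable def homOfGHom (hH : H ≤ pqO 𝕜 p q) (hA : ∀ e ∈ A.atlas, V.IsIsometric e)
    (hA' : ∀ e ∈ A'.atlas, W.IsIsometric e)
    (F : (⟨V.bundle, A⟩ : GBundle.{u} (matrixAction h)) ⟶ ⟨W.bundle, A'⟩) : V ⟶ W :=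
  have key := linear_isometry_of_exists_act F.hom fun m => by
    obtain ⟨e, he, hm⟩ := A.cover m
    obtain ⟨e', he', hm'⟩ := A'.cover (F.hom.base.toFun m)
    obtain ⟨g, hg, hx⟩ := exists_mulVec_of_gHom F he he' hm hm'
    exact ⟨e, hA e he, hm, e', hA' e' he', hm', g, hH hg, hx⟩
  { hom := F.hom
    linear := key.1
    isometry := key.2 }

end OfGHom

variable (𝕜 p q) in
/-- The functor sending a metrised vector bundle to the underlying bundle with the atlas of
isometric trivialisations. -/
noncomputable def toGBundle : MVB.{u} 𝕜 p q ⥤ GBundle.{u} (actO 𝕜 p q) where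
  obj V := ⟨V.bundle, V.isometricStructure⟩
  map f := ⟨f.hom, fun _ he _ he' => locallyG_of_matrix (isExpModel_pqO 𝕜 p q) f.hom he.1 he'.1
    fun _ hm hm' => exists_pqO_of_hom f he.2 he'.2 hm hm'⟩

variable (𝕜 p q) in
/-- The functor sending a bundle with structure group `O(𝕜, (p, q))` to the underlying bundle with
the metric and the vector space structure of the standard fibre. -/
noncomputable def ofGBundle : GBundle.{u} (actO 𝕜 p q) ⥤ MVB.{u} 𝕜 p q where
  obj X := ⟨X.bundle, X.str.toMetricStructure le_rfl⟩
  map {X Y} f := homOfGHom (V := ⟨X.bundle, X.str.toMetricStructure le_rfl⟩)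
    (W := ⟨Y.bundle, Y.str.toMetricStructure le_rfl⟩) (A := X.str) (A' := Y.str) le_rfl
    (fun _ he => X.str.isIsometricTriv_of_mem le_rfl he)
    (fun _ he => Y.str.isIsometricTriv_of_mem le_rfl he) f

instance : (MVB.forget (𝕜 := 𝕜) (p := p) (q := q)).Faithful where
  map_injective h := Hom.ext h

instance _root_.GBundle.faithful_forget {G : LieGrp} {S : Mfd.{0}} {lam : EffectiveAction G S} :
    (GBundle.forget.{u} (lam := lam)).Faithful where
  map_injective h := GBundle.Hom.ext h

theorem toGBundle_ofGBundle_obj (V : MVB.{u} 𝕜 p q) :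
    (ofGBundle 𝕜 p q).obj ((toGBundle 𝕜 p q).obj V) = V :=
  congrArg (fun s => (⟨V.bundle, s⟩ : MVB.{u} 𝕜 p q)) <|
    MetricStructure.eq_of_isIsometricTriv fun m => by
      obtain ⟨e, he, hm⟩ := V.isometricStructure.cover m
      exact ⟨e, hm, V.isometricStructure.isIsometricTriv_of_mem le_rfl he, he.2⟩

theorem ofGBundle_toGBundle_obj (X : GBundle.{u} (actO 𝕜 p q)) :
    (toGBundle 𝕜 p q).obj ((ofGBundle 𝕜 p q).obj X) = X :=
  congrArg (fun A => (⟨X.bundle, A⟩ : GBundle.{u} (actO 𝕜 p q))) <| Eq.symm <|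
    GStructure.eq_of_subset fun e he =>
      ⟨X.str.smooth e he, X.str.isIsometricTriv_of_mem le_rfl he⟩

/-- Objects agree by the preceding equalities; morphisms may be compared after the faithful
forgetful functor, where the objects agree definitionally and the transports are identities. -/
theorem toGBundle_comp_ofGBundle : toGBundle.{u} 𝕜 p q ⋙ ofGBundle 𝕜 p q = 𝟭 _ := by
  refine CategoryTheory.Functor.ext toGBundle_ofGBundle_obj fun V W f => MVB.forget.map_injective ?_
  rw [Functor.map_comp, Functor.map_comp, eqToHom_map, eqToHom_map]
  rfl

theorem ofGBundle_comp_toGBundle : ofGBundle.{u} 𝕜 p q ⋙ toGBundle 𝕜 p q = 𝟭 _ := by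
  refine CategoryTheory.Functor.ext ofGBundle_toGBundle_obj fun V W f => GBundle.forget.map_injective ?_
  rw [Functor.map_comp, Functor.map_comp, eqToHom_map, eqToHom_map]
  rfl

variable (𝕜 p q) in
/-- Metrised vector bundles are equivalent to bundles with structure group `O(𝕜, (p, q))`. -/
noncomputable def equivGBundle : MVB.{u} 𝕜 p q ≌ GBundle.{u} (actO 𝕜 p q) :=
  CategoryTheory.Equivalence.mk (toGBundle 𝕜 p q) (ofGBundle 𝕜 p q)
    (eqToIso toGBundle_comp_ofGBundle.symm) (eqToIso ofGBundle_comp_toGBundle)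

end MVB

end

/-! ### Determinants, orientations and positive orthonormal frames. -/

section

variable {𝕜 : Type} [RCLike 𝕜] {p q : ℕ}

attribute [local instance] Matrix.linftyOpNormedRing Matrix.linftyOpNormedAlgebra
  completeSpace_matrix

local notation "𝔼" => Fin p ⊕ Fin q → 𝕜
local notation "𝔐" => Matrix (Fin p ⊕ Fin q) (Fin p ⊕ Fin q) 𝕜

/-- The positive real elements of `𝕜`. -/
def IsPosReal (z : 𝕜) : Prop := ∃ r : ℝ, 0 < r ∧ z = (r : 𝕜)

namespace IsPosReal

variable {a b : 𝕜}

theorem one : IsPosReal (1 : 𝕜) := ⟨1, one_pos, by simp⟩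

theorem mul (ha : IsPosReal a) (hb : IsPosReal b) : IsPosReal (a * b) := by
  obtain ⟨r, hr, rfl⟩ := ha
  obtain ⟨s, hs, rfl⟩ := hb
  exact ⟨r * s, mul_pos hr hs, by push_cast; rfl⟩

theorem inv (ha : IsPosReal a) : IsPosReal a⁻¹ := by
  obtain ⟨r, hr, rfl⟩ := ha
  exact ⟨r⁻¹, inv_pos.2 hr, by push_cast; rfl⟩

theorem ne_zero (ha : IsPosReal a) : a ≠ 0 := by
  obtain ⟨r, hr, rfl⟩ := ha
  exact_mod_cast hr.ne'

theorem mul_iff_right (ha : IsPosReal a) : IsPosReal (a * b) ↔ IsPosReal b :=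
  ⟨fun h => by simpa [ha.ne_zero] using ha.inv.mul h, ha.mul⟩

theorem eq_one_of_norm (ha : IsPosReal a) (h : ‖a‖ = 1) : a = 1 := by
  obtain ⟨r, hr, rfl⟩ := ha
  rw [RCLike.norm_ofReal, abs_of_pos hr] at h
  rw [h, RCLike.ofReal_one]

end IsPosReal

/-- Determinants in `gᴴ η g = η` give `|det g| ^ 2 = 1`, as `det η ≠ 0`. -/
theorem norm_det_of_mem_pqO {g : (Matrix (Fin p ⊕ Fin q) (Fin p ⊕ Fin q) 𝕜)ˣ}
    (hg : g ∈ pqO 𝕜 p q) : ‖(g : 𝔐).det‖ = 1 := by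
  have h1 : (g : 𝔐)ᴴ * pqMatrix 𝕜 p q * g = pqMatrix 𝕜 p q := hg
  have h2 : (pqMatrix 𝕜 p q).det ≠ 0 := fun h => by
    have h3 := congrArg Matrix.det (pqMatrix_mul_self 𝕜 p q)
    rw [Matrix.det_mul, h, zero_mul, Matrix.det_one] at h3
    exact zero_ne_one h3
  have h3 := congrArg Matrix.det h1
  rw [Matrix.det_mul, Matrix.det_mul, Matrix.det_conjTranspose, mul_right_comm,
    mul_eq_right₀ h2] at h3
  have h4 := congrArg norm h3
  rw [norm_mul, norm_star, norm_one] at h4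
  nlinarith [norm_nonneg (g : 𝔐).det]

/-- This is how an orientation reduces the structure group: a positive real number of absolute value
one is `1`. -/
theorem mem_pqSO_of_isPosReal {g : (Matrix (Fin p ⊕ Fin q) (Fin p ⊕ Fin q) 𝕜)ˣ}
    (hg : g ∈ pqO 𝕜 p q) (h : IsPosReal (g : 𝔐).det) : g ∈ pqSO 𝕜 p q :=
  ⟨hg, h.eq_one_of_norm (norm_det_of_mem_pqO hg)⟩

theorem pqSO_le_pqO : pqSO 𝕜 p q ≤ pqO 𝕜 p q := fun _ h => h.1

namespace MVB.IsLinear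

variable {V : MVB.{u} 𝕜 p q} {e e' : Bundle.Trivialization (vecMfd 𝕜 p q) V.bundle.proj}

/-- The basis of a fibre given by a linear trivialisation. -/
noncomputable def basis (h : V.IsLinear e) {m : V.bundle.base} (hm : m ∈ e.baseSet) :
    Module.Basis (Fin p ⊕ Fin q) 𝕜 (V.Fibre m) :=
  .ofEquivFun (h.coord hm)

theorem apply_basis (h : V.IsLinear e) {m : V.bundle.base} (hm : m ∈ e.baseSet)
    (i : Fin p ⊕ Fin q) : ((e (h.basis hm i).1).2 : 𝔼) = Pi.single i 1 := by
  change h.coord hm (h.basis hm i) = _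
  rw [basis, Module.Basis.coe_ofEquivFun, LinearEquiv.apply_symm_apply]

theorem eq_basis (h : V.IsLinear e) {m : V.bundle.base} (hm : m ∈ e.baseSet)
    {b : Module.Basis (Fin p ⊕ Fin q) 𝕜 (V.Fibre m)}
    (hb : ∀ i, ((e (b i).1).2 : 𝔼) = Pi.single i 1) : b = h.basis hm :=
  Module.Basis.eq_of_apply_eq fun i =>
    (h.coord hm).injective ((hb i).trans (h.apply_basis hm i).symm)

theorem det_basis (h : V.IsLinear e) {m : V.bundle.base} (hm : m ∈ e.baseSet)
    (v : Fin p ⊕ Fin q → V.Fibre m) :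
    (h.basis hm).det v = (Matrix.of fun i j => ((e (v j).1).2 : 𝔼) i).det := by
  rw [Module.Basis.det_apply]
  rfl

theorem det_basis_of_mulVec (h : V.IsLinear e) {m : V.bundle.base} (hm : m ∈ e.baseSet) {A : 𝔐}
    {v : Fin p ⊕ Fin q → V.Fibre m} {w : Fin p ⊕ Fin q → 𝔼}
    (hA : ∀ j, ((e (v j).1).2 : 𝔼) = A *ᵥ w j) :
    (h.basis hm).det v = A.det * (Matrix.of fun i j => w j i).det := by
  rw [h.det_basis hm, ← Matrix.det_mul]
  congr 1
  ext i j
  rw [Matrix.of_apply, hA]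
  rfl

theorem det_basis_of_mulVec_single (h : V.IsLinear e) {m : V.bundle.base} (hm : m ∈ e.baseSet)
    {A : 𝔐} {v : Fin p ⊕ Fin q → V.Fibre m}
    (hA : ∀ j, ((e (v j).1).2 : 𝔼) = A *ᵥ Pi.single j 1) : (h.basis hm).det v = A.det := by
  have h1 : (Matrix.of fun i j : Fin p ⊕ Fin q => (Pi.single j 1 : 𝔼) i) = 1 := by
    ext i j
    rw [Matrix.of_apply, Matrix.one_apply, Pi.single_apply]
  rw [h.det_basis_of_mulVec hm hA, h1, Matrix.det_one, mul_one]

/-- The determinant of the change of basis between linear trivialisations. -/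
theorem det_basis_basis (h : V.IsLinear e) (h' : V.IsLinear e') {m : V.bundle.base}
    (hm : m ∈ e.baseSet) (hm' : m ∈ e'.baseSet) {A : 𝔐}
    (hA : ∀ x : V.Fibre m, ((e x.1).2 : 𝔼) = A *ᵥ (e' x.1).2) :
    (h.basis hm).det (fun i => h'.basis hm' i) = A.det :=
  h.det_basis_of_mulVec_single hm fun j => by rw [hA, h'.apply_basis hm']

end MVB.IsLinear

namespace OrientationStructure

variable {V : MVB.{u} 𝕜 p q} (o : OrientationStructure V) {m : V.bundle.base}

/-- Any positive basis can serve as the reference, because determinants of changes of basis multiply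
and a positive real factor may be cancelled. -/
theorem mem_positive_iff {b b' : Module.Basis (Fin p ⊕ Fin q) 𝕜 (V.Fibre m)}
    (hb : b ∈ o.positive m) : b' ∈ o.positive m ↔ IsPosReal (b.det fun i => b' i) := by
  obtain ⟨b₀, h₀⟩ := o.is_class m
  rw [h₀] at hb ⊢
  have hb : IsPosReal (b₀.det fun i => b i) := hb
  have h1 : b₀.det (fun i => b' i) = b₀.det (fun i => b i) * b.det fun i => b' i := by
    rw [Module.Basis.det_apply, Module.Basis.det_apply, Module.Basis.det_apply, ← Matrix.det_mul]
    exact congrArg _ (b₀.toMatrix_mul_toMatrix b (fun i => b' i)).symm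
  change IsPosReal (b₀.det fun i => b' i) ↔ _
  rw [h1, hb.mul_iff_right]

theorem mem_positive_of_isPosReal {b b' : Module.Basis (Fin p ⊕ Fin q) 𝕜 (V.Fibre m)}
    (hb : b ∈ o.positive m) (h : IsPosReal (b'.det fun i => b i)) : b' ∈ o.positive m := by
  rw [o.mem_positive_iff hb]
  have h1 : b'.det (fun i => b i) * b.det (fun i => b' i) = 1 := by
    rw [Module.Basis.det_apply, Module.Basis.det_apply, ← Matrix.det_mul]
    exact (congrArg _ (b'.toMatrix_mul_toMatrix_flip b)).trans Matrix.det_one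
  rw [← h.mul_iff_right, h1]
  exact .one

/-- A trivialisation given by a positively oriented frame. -/
def IsOriented (e : Bundle.Trivialization (vecMfd 𝕜 p q) V.bundle.proj) : Prop :=
  ∀ m ∈ e.baseSet, ∀ b : Module.Basis (Fin p ⊕ Fin q) 𝕜 (V.Fibre m),
    (∀ i, (e (b i).1).2 = Pi.single i (1 : 𝕜)) → b ∈ o.positive m

variable {o} {e e' : Bundle.Trivialization (vecMfd 𝕜 p q) V.bundle.proj}

theorem IsOriented.basis_mem (ho : o.IsOriented e) (h : V.IsLinear e) (hm : m ∈ e.baseSet) :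
    h.basis hm ∈ o.positive m :=
  ho m hm _ fun i => h.apply_basis hm i

theorem isOriented_of_basis_mem (h : V.IsLinear e)
    (H : ∀ m (hm : m ∈ e.baseSet), h.basis hm ∈ o.positive m) : o.IsOriented e :=
  fun m hm _ hb => h.eq_basis hm hb ▸ H m hm

end OrientationStructure

/-- A smooth choice of a phase. -/
theorem contDiffOn_star_mul_norm_inv :
    ContDiffOn ℝ ∞ (fun z : 𝕜 => starRingEnd 𝕜 z * ((‖z‖⁻¹ : ℝ) : 𝕜)) {z | z ≠ 0} := by
  intro z hz
  refine ContDiffAt.contDiffWithinAt ?_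
  refine ((RCLike.conjCLE (K := 𝕜)).contDiff.contDiffAt).mul ?_
  refine (RCLike.ofRealCLM (K := 𝕜)).contDiff.contDiffAt.comp z ?_
  exact (contDiffAt_norm 𝕜 hz).inv (norm_ne_zero_iff.2 hz)

/-- The diagonal matrix that multiplies one coordinate by the phase inverse to that of `z`. -/
noncomputable def phaseMatrix (i₀ : Fin p ⊕ Fin q) (z : 𝕜) : 𝔐 :=
  Matrix.diagonal (Function.update 1 i₀ (starRingEnd 𝕜 z * ((‖z‖⁻¹ : ℝ) : 𝕜)))

/-- The determinant is `conj z / |z|`, and its product with `z` is `|z|`. -/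
theorem isPosReal_det_phaseMatrix (i₀ : Fin p ⊕ Fin q) {z : 𝕜} (hz : z ≠ 0) :
    IsPosReal ((phaseMatrix i₀ z : 𝔐).det * z) := by
  have h : (phaseMatrix i₀ z : 𝔐).det = starRingEnd 𝕜 z * ((‖z‖⁻¹ : ℝ) : 𝕜) := by
    rw [phaseMatrix, Matrix.det_diagonal, Finset.prod_update_of_mem (Finset.mem_univ i₀)]
    simp
  refine ⟨‖z‖, norm_pos_iff.2 hz, ?_⟩
  have h1 : (‖z‖ : 𝕜) ≠ 0 := by exact_mod_cast norm_ne_zero_iff.2 hz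
  rw [h, mul_right_comm, RCLike.conj_mul]
  push_cast
  field_simp

/-- Diagonal matrices commute and the phase has modulus one. So every diagonal form is preserved,
whatever the sign of its entry at `i₀`. -/
theorem conjTranspose_phaseMatrix_mul_diagonal_mul (i₀ : Fin p ⊕ Fin q) {z : 𝕜} (hz : z ≠ 0)
    (d : 𝔼) : (phaseMatrix i₀ z : 𝔐)ᴴ * Matrix.diagonal d * phaseMatrix i₀ z =
      Matrix.diagonal d := by
  rw [phaseMatrix, Matrix.diagonal_conjTranspose, Matrix.diagonal_mul_diagonal,
    Matrix.diagonal_mul_diagonal]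
  congr 1
  funext i
  have h1 : (‖z‖ : 𝕜) ≠ 0 := by exact_mod_cast norm_ne_zero_iff.2 hz
  rcases eq_or_ne i i₀ with rfl | hi
  · rw [Pi.star_apply, Function.update_self]
    simp only [RCLike.star_def, map_mul, RCLike.conj_conj, RCLike.conj_ofReal]
    have h2 := RCLike.mul_conj z
    push_cast
    field_simp
    linear_combination d i * h2
  · rw [Pi.star_apply, Function.update_of_ne hi]
    simp

theorem phaseMatrix_mul_conjTranspose (i₀ : Fin p ⊕ Fin q) {z : 𝕜} (hz : z ≠ 0) :
    (phaseMatrix i₀ z : 𝔐) * (phaseMatrix i₀ z)ᴴ = 1 := by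
  have h := conjTranspose_phaseMatrix_mul_diagonal_mul (p := p) (q := q) i₀ hz 1
  rw [Matrix.diagonal_one', Matrix.mul_one] at h
  exact mul_eq_one_comm.1 h

theorem smoothEntries_phaseMatrix (i₀ : Fin p ⊕ Fin q) {N : Mfd.{u}} {U : Set N} {d : N → 𝕜}
    (hd : ContMDiffOn N.I 𝓘(ℝ, 𝕜) ∞ d U) (h0 : ∀ x ∈ U, d x ≠ 0) :
    SmoothEntries (fun x => (phaseMatrix i₀ (d x) : 𝔐)) U := by
  intro i j
  simp only [phaseMatrix, Matrix.diagonal_apply, Function.update_apply]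
  split_ifs
  · exact contDiffOn_star_mul_norm_inv.contMDiffOn.comp hd h0
  all_goals exact contMDiffOn_const

namespace MVB

variable {V : MVB.{u} 𝕜 p q} {e e' : Bundle.Trivialization (vecMfd 𝕜 p q) V.bundle.proj}

/-- The change of coordinates between linear trivialisations. -/
theorem IsLinear.exists_transition (h : V.IsLinear e) (he : IsSmoothTriv e) (h' : V.IsLinear e')
    (he' : IsSmoothTriv e') : ∃ T : V.bundle.base → 𝔐,
      SmoothEntries T (e.baseSet ∩ e'.baseSet) ∧ ∀ m ∈ e.baseSet ∩ e'.baseSet, ∀ x : V.Fibre m,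
        ((e x.1).2 : 𝔼) = T m *ᵥ (e' x.1).2 := by
  refine ⟨fun m => Matrix.of fun i j =>
    ((e (e'.toOpenPartialHomeomorph.symm (m, (Pi.single j 1 : 𝔼)))).2 : 𝔼) i, fun i j => ?_,
    fun m hm x => ?_⟩
  · have h1 : ContMDiffOn V.bundle.base.I V.bundle.total.I ∞
        (fun m => e'.toOpenPartialHomeomorph.symm (m, (Pi.single j 1 : 𝔼)))
        (e.baseSet ∩ e'.baseSet) :=
      he'.2.comp (contMDiffOn_id.prodMk contMDiffOn_const) fun m hm => e'.mem_target.2 hm.2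
    have h2 : ContMDiffOn V.bundle.base.I 𝓘(ℝ, 𝔼) ∞
        (fun m => (e (e'.toOpenPartialHomeomorph.symm (m, (Pi.single j 1 : 𝔼)))).2)
        (e.baseSet ∩ e'.baseSet) :=
      contMDiff_snd.comp_contMDiffOn (he.1.comp h1 fun m hm => e.mem_source.2 (by
        rw [e'.proj_symm_apply' hm.2]; exact hm.1))
    exact contMDiffOn_pi_space.1 h2 i
  · let R : 𝔼 →ₗ[𝕜] 𝔼 := (h.coord hm.1).toLinearMap ∘ₗ (h'.coord hm.2).symm.toLinearMap
    have h1 : h.coord hm.1 x = R (h'.coord hm.2 x) := by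
      simp only [R, LinearMap.comp_apply, LinearEquiv.coe_coe, LinearEquiv.symm_apply_apply]
    refine h1.trans ?_
    rw [← Matrix.toLin'_toMatrix' R, Matrix.toLin'_apply]
    rfl

end MVB

namespace OrientationStructure

variable {V : MVB.{u} 𝕜 p q} (o : OrientationStructure V)

/-- Local existence of positively oriented smooth orthonormal frames. -/
theorem exists_isometric (m : V.bundle.base) :
    ∃ e : Bundle.Trivialization (vecMfd 𝕜 p q) V.bundle.proj,
      m ∈ e.baseSet ∧ IsSmoothTriv e ∧ V.IsIsometric e ∧ o.IsOriented e := by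
  obtain ⟨e, hm, he, h⟩ := V.exists_isometric m
  obtain ⟨e₁, hm₁, he₁, h₁⟩ := o.locally_framed m
  have hl : V.IsLinear e₁ := fun m hm => (h₁ m hm).1
  have ho : o.IsOriented e₁ := fun m hm => (h₁ m hm).2
  obtain ⟨T, hT, hx⟩ := h.1.exists_transition he hl he₁
  set U := e.baseSet ∩ e₁.baseSet
  have hU : IsOpen U := e.open_baseSet.inter e₁.open_baseSet
  -- `T` compares the isometric frame with an oriented linear one. A smooth family of isometries `P`
  -- is needed that makes the determinant of this comparison positive.
  suffices H : ∃ P : V.bundle.base → 𝔐, SmoothEntries P U ∧ (∀ m ∈ U, P m * (P m)ᴴ = 1) ∧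
      (∀ m ∈ U, (P m)ᴴ * pqMatrix 𝕜 p q * P m = pqMatrix 𝕜 p q) ∧
      ∀ m ∈ U, IsPosReal ((P m).det * (T m).det) by
    obtain ⟨P, hP, hPP, hPη, hPT⟩ := H
    obtain ⟨e', hU', he', hx'⟩ := exists_matrix_twist he hU Set.inter_subset_left hP
      hP.conjTranspose hPP
    have h' : V.IsIsometric e' := MVB.isIsometric_of_exists_act fun m hm => by
      rw [hU'] at hm
      obtain ⟨g, hg, hPg⟩ := exists_pqO_of_isometry (p := p) (q := q) (T := fun v => P m *ᵥ v)
        ⟨Matrix.mulVec_add _, fun c x => Matrix.mulVec_smul _ c x⟩ fun v w => by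
          rw [pqForm_eq_sesq, Matrix.sesq_mulVec_mulVec, hPη m hm, pqForm_eq_sesq]
      refine ⟨e, h, hm.1, g, hg, ?_⟩
      rintro x rfl
      rw [hx' x hm]
      exact hPg _
    refine ⟨e', hU' ▸ ⟨hm, hm₁⟩, he', h', isOriented_of_basis_mem h'.1 fun m hm => ?_⟩
    have hmU : m ∈ U := hU' ▸ hm
    refine o.mem_positive_of_isPosReal (ho.basis_mem hl hmU.2) ?_
    rw [h'.1.det_basis_basis hl hm hmU.2 (A := P m * T m), Matrix.det_mul]
    · exact hPT m hmU
    · rintro ⟨x, rfl⟩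
      rw [hx' x hmU, hx _ hmU ⟨x, rfl⟩, Matrix.mulVec_mulVec]
  rcases isEmpty_or_nonempty (Fin p ⊕ Fin q) with _ | ⟨⟨i₀⟩⟩
  -- In rank zero there is no coordinate to rotate, but empty determinants are already `1`.
  · refine ⟨fun _ => 1, .const 1, fun _ _ => by simp, fun _ _ => by simp, fun _ _ => ?_⟩
    rw [Matrix.det_isEmpty, Matrix.det_isEmpty, mul_one]
    exact .one
  · have h0 : ∀ m ∈ U, (T m).det ≠ 0 := fun m hm => by
      rw [← h.1.det_basis_basis hl hm.1 hm.2 (hx m hm)]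
      exact ((h.1.basis hm.1).isUnit_det (hl.basis hm.2)).ne_zero
    exact ⟨fun m => phaseMatrix i₀ (T m).det, smoothEntries_phaseMatrix i₀ hT.det h0,
      fun m hm => phaseMatrix_mul_conjTranspose i₀ (h0 m hm),
      fun m hm => conjTranspose_phaseMatrix_mul_diagonal_mul i₀ (h0 m hm) _,
      fun m hm => isPosReal_det_phaseMatrix i₀ (h0 m hm)⟩

end OrientationStructure

end

/-! ### Oriented metrised bundles and `SO(𝕜, (p, q))`-bundles. -/

section

variable {𝕜 : Type} [RCLike 𝕜] {p q : ℕ}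

attribute [local instance] Matrix.linftyOpNormedRing Matrix.linftyOpNormedAlgebra
  completeSpace_matrix

local notation "𝔼" => Fin p ⊕ Fin q → 𝕜
local notation "𝔐" => Matrix (Fin p ⊕ Fin q) (Fin p ⊕ Fin q) 𝕜

namespace OMVB

variable {V W : OMVB.{u} 𝕜 p q}

/-- The determinant of `g` is that of the image of a positive frame relative to a positive frame,
hence positive, hence one. -/
theorem exists_pqSO_of_hom (f : V ⟶ W)
    {e : Bundle.Trivialization (vecMfd 𝕜 p q) V.toMVB.bundle.proj}
    (h : V.toMVB.IsIsometric e) (ho : V.orientation.IsOriented e)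
    {e' : Bundle.Trivialization (vecMfd 𝕜 p q) W.toMVB.bundle.proj}
    (h' : W.toMVB.IsIsometric e') (ho' : W.orientation.IsOriented e')
    {m : V.toMVB.bundle.base} (hm : m ∈ e.baseSet) (hm' : f.hom.hom.base.toFun m ∈ e'.baseSet) :
    ∃ g ∈ pqSO 𝕜 p q, ∀ v : 𝔼,
      ((e' (f.hom.hom.total.toFun (e.toOpenPartialHomeomorph.symm (m, v)))).2 : 𝔼) =
        (g : 𝔐) *ᵥ v := by
  obtain ⟨g, hg, hgv⟩ := MVB.exists_pqO_of_hom f.hom h h' hm hm'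
  refine ⟨g, mem_pqSO_of_isPosReal hg ?_, hgv⟩
  obtain ⟨b', hb'⟩ := exists_image_basis f.hom m (h.1.basis hm) (h'.1.basis hm')
  have h1 := f.orientation_preserving m _ (ho.basis_mem h.1 hm) b' hb'
  rw [W.orientation.mem_positive_iff (ho'.basis_mem h'.1 hm'),
    h'.1.det_basis_of_mulVec hm' (A := g) (w := fun j => ((e (h.1.basis hm j).1).2 : 𝔼))] at h1
  · have h2 := h.1.det_basis hm fun i => h.1.basis hm i
    rw [Module.Basis.det_self] at h2
    rwa [← h2, mul_one] at h1
  · intro j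
    have h2 := hgv (e (h.1.basis hm j).1).2
    rw [e.symm_eq_of_apply_eq (h.1.basis hm j).2 hm rfl] at h2
    exact (congrArg (fun x : W.toMVB.Fibre _ => ((e' x.1).2 : 𝔼)) (hb' j)).trans h2

variable (V) in
/-- The bundle atlas of oriented isometric trivialisations. -/
noncomputable def orientedStructure : GStructure (actSO 𝕜 p q) V.toMVB.bundle where
  atlas := {e | IsSmoothTriv e ∧ V.toMVB.IsIsometric e ∧ V.orientation.IsOriented e}
  smooth _ he := he.1
  cover m := let ⟨e, hm, he⟩ := V.orientation.exists_isometric m; ⟨e, he, hm⟩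
  compatible e he e' he' := by
    obtain ⟨g, hg, h⟩ := locallyG_of_matrix (isExpModel_pqSO 𝕜 p q) (𝟙 V.toMVB.bundle) he'.1 he.1
      fun m hm hm' => exists_pqSO_of_hom (𝟙 V) he'.2.1 he'.2.2 he.2.1 he.2.2 hm hm'
    exact ⟨g, hg.mono fun x hx => ⟨hx.2, hx.1⟩, fun m hm s => h m ⟨hm.2, hm.1⟩ s⟩
  maximal e hs he := by
    have key : ∀ m ∈ e.baseSet, ∃ e' : Bundle.Trivialization (vecMfd 𝕜 p q) V.toMVB.bundle.proj,
        V.toMVB.IsIsometric e' ∧ V.orientation.IsOriented e' ∧ m ∈ e'.baseSet ∧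
        ∃ g ∈ pqSO 𝕜 p q, ∀ x, V.toMVB.bundle.proj x = m →
          ((e x).2 : 𝔼) = (g : 𝔐) *ᵥ (e' x).2 := fun m hm => by
      obtain ⟨e', hm', he'⟩ := V.orientation.exists_isometric m
      obtain ⟨g, hg⟩ := (he e' he').exists_snd_eq hm hm'
      exact ⟨e', he'.2.1, he'.2.2, hm', g.1, g.2, hg⟩
    have h : V.toMVB.IsIsometric e := MVB.isIsometric_of_exists_act fun m hm => by
      obtain ⟨e', h', -, hm', g, hg, hx⟩ := key m hm
      exact ⟨e', h', hm', g, pqSO_le_pqO hg, hx⟩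
    refine ⟨hs, h, OrientationStructure.isOriented_of_basis_mem h.1 fun m hm => ?_⟩
    obtain ⟨e', h', ho', hm', g, hg, hx⟩ := key m hm
    refine V.orientation.mem_positive_of_isPosReal (ho'.basis_mem h'.1 hm') ?_
    -- The trivialisation differs from an oriented one by a matrix of determinant one, so its frame
    -- is positive as well.
    rw [h.1.det_basis_basis h'.1 hm hm' fun x => hx x.1 x.2, hg.2]
    exact .one

variable (𝕜 p q) in
/-- The functor sending an oriented metrised vector bundle to the underlying bundle with the atlas
of oriented isometric trivialisations. -/
noncomputable def toGBundle : OMVB.{u} 𝕜 p q ⥤ GBundle.{u} (actSO 𝕜 p q) where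
  obj V := ⟨V.toMVB.bundle, V.orientedStructure⟩
  map f := ⟨f.hom.hom, fun _ he _ he' => locallyG_of_matrix (isExpModel_pqSO 𝕜 p q) f.hom.hom
    he.1 he'.1 fun _ hm hm' => exists_pqSO_of_hom f he.2.1 he.2.2 he'.2.1 he'.2.2 hm hm'⟩

instance : (toGBundle.{u} 𝕜 p q).Faithful where
  map_injective h := Hom.ext (MVB.Hom.ext (congrArg GBundle.Hom.hom h))

instance : (toGBundle.{u} 𝕜 p q).Full where
  map_surjective {V W} F := by
    refine ⟨⟨MVB.homOfGHom (A := V.orientedStructure) (A' := W.orientedStructure) pqSO_le_pqO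
      (fun _ he => he.2.1) (fun _ he => he.2.1) F, fun m b hb b' hb' => ?_⟩, rfl⟩
    obtain ⟨e, he, hm⟩ := V.orientedStructure.cover m
    obtain ⟨e', he', hm'⟩ := W.orientedStructure.cover (F.hom.base.toFun m)
    obtain ⟨g, hg, hx⟩ := MVB.exists_mulVec_of_gHom (A := V.orientedStructure)
      (A' := W.orientedStructure) F he he' hm hm'
    rw [V.orientation.mem_positive_iff (he.2.2.basis_mem he.2.1.1 hm),
      he.2.1.1.det_basis hm] at hb
    refine (W.orientation.mem_positive_iff (m := F.hom.base.toFun m) (b' := b')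
      (he'.2.2.basis_mem he'.2.1.1 hm')).2 ?_
    -- In oriented orthonormal frames the map has determinant one, so the image basis has the same
    -- determinant as `b`.
    rw [he'.2.1.1.det_basis_of_mulVec hm' (A := g) (w := fun j => ((e (b j).1).2 : 𝔼)), hg.2,
      one_mul]
    · exact hb
    · intro j
      exact (congrArg (fun x : W.toMVB.Fibre _ => ((e' x.1).2 : 𝔼)) (hb' j)).trans (hx (b j))

section EssSurj

variable (X : GBundle.{u} (actSO 𝕜 p q))

/-- The metrised vector bundle underlying a bundle with structure group `SO(𝕜, (p, q))`. -/
noncomputable def underlyingMVB : MVB.{u} 𝕜 p q :=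
  ⟨X.bundle, X.str.toMetricStructure pqSO_le_pqO⟩

variable {X} in
theorem isIsometric_underlyingMVB
    {e : Bundle.Trivialization (vecMfd 𝕜 p q) X.bundle.proj} (he : e ∈ X.str.atlas) :
    (underlyingMVB X).IsIsometric e :=
  X.str.isIsometricTriv_of_mem pqSO_le_pqO he

/-- The basis of a fibre given by a trivialisation of the atlas. -/
noncomputable def basisAt (m : (underlyingMVB X).bundle.base) :
    Module.Basis (Fin p ⊕ Fin q) 𝕜 ((underlyingMVB X).Fibre m) :=
  (isIsometric_underlyingMVB (X.str.trivAt_mem m)).1.basis (X.str.mem_trivAt m)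

variable {X} in
-- Frames of the atlas over a point differ by determinant one, so all of them lie in the class of
-- the chosen one and the orientation is locally framed.
theorem det_basisAt {e : Bundle.Trivialization (vecMfd 𝕜 p q) X.bundle.proj}
    (he : e ∈ X.str.atlas) {m : (underlyingMVB X).bundle.base} (hm : m ∈ e.baseSet)
    {b : Module.Basis (Fin p ⊕ Fin q) 𝕜 ((underlyingMVB X).Fibre m)}
    (hb : ∀ i, ((e (b i).1).2 : 𝔼) = Pi.single i 1) : (basisAt X m).det (fun i => b i) = 1 := by
  obtain ⟨g, hg⟩ := (X.str.compatible _ (X.str.trivAt_mem m) e he).exists_snd_eq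
    (X.str.mem_trivAt m) hm
  have h := isIsometric_underlyingMVB he
  rw [h.1.eq_basis hm hb]
  exact ((isIsometric_underlyingMVB (X.str.trivAt_mem m)).1.det_basis_basis h.1
    (X.str.mem_trivAt m) hm fun x => hg x.1 x.2).trans g.2.2

/-- The oriented metrised vector bundle determined by a bundle with structure group
`SO(𝕜, (p, q))`. -/
noncomputable def ofGBundle : OMVB.{u} 𝕜 p q where
  toMVB := underlyingMVB X
  orientation :=
    { positive := fun m => {b | IsPosReal ((basisAt X m).det fun i => b i)}
      is_class := fun m => ⟨basisAt X m, rfl⟩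
      locally_framed := fun m => ⟨X.str.trivAt m, X.str.mem_trivAt m,
        X.str.smooth _ (X.str.trivAt_mem m), fun m' hm' =>
        ⟨(isIsometric_underlyingMVB (X.str.trivAt_mem m)).1 m' hm', fun b hb => by
          change IsPosReal _
          rw [det_basisAt (X.str.trivAt_mem m) hm' hb]
          exact .one⟩⟩ }

theorem toGBundle_ofGBundle : (toGBundle 𝕜 p q).obj (ofGBundle X) = X :=
  congrArg (fun A => (⟨X.bundle, A⟩ : GBundle.{u} (actSO 𝕜 p q))) <| Eq.symm <|
    GStructure.eq_of_subset fun e he =>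
      ⟨X.str.smooth e he, isIsometric_underlyingMVB he, fun m hm b hb => by
        change IsPosReal _
        rw [det_basisAt he hm hb]
        exact .one⟩

end EssSurj

instance : (toGBundle.{u} 𝕜 p q).EssSurj where
  mem_essImage X := ⟨ofGBundle X, ⟨eqToIso (toGBundle_ofGBundle X)⟩⟩

instance : (toGBundle.{u} 𝕜 p q).IsEquivalence where

end OMVB

end

/-! ### Frames as linear isometries, and the final equivalences. -/

/-- Equivariance has to hold in every trivialisation of the maximal atlas, not only in those coming
from `X`. Transitions multiply on the left and so do not disturb the right factor `h`. -/
theorem GBundle.frame_symm_mul {G : LieGrp} {S : Mfd.{0}} {lam : EffectiveAction G S}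
    {X : GBundle.{u} lam} {e : Bundle.Trivialization G.toMfd X.frameBundle.bundle.proj}
    (he : e ∈ X.frameBundle.str.atlas) {m : X.frameBundle.bundle.base} (hm : m ∈ e.baseSet)
    (g h : G) (s : S) : frame (e.toOpenPartialHomeomorph.symm (m, g * h)) s =
      frame (e.toOpenPartialHomeomorph.symm (m, g)) (lam.act h s) := by
  obtain ⟨e₀, he₀, hm₀⟩ := X.str.cover m
  obtain ⟨k, -, hk⟩ := X.frameBundle.exists_transition he (X.frameTriv_mem ⟨e₀, he₀⟩)
  have h1 : ∀ g, e.toOpenPartialHomeomorph.symm (m, g) = X.mkFrame ⟨e₀, he₀⟩ m (k m * g) :=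
    fun g => hk m ⟨hm, hm₀⟩ g
  rw [h1, h1, frame_mkFrame ⟨e₀, he₀⟩ hm₀, frame_mkFrame ⟨e₀, he₀⟩ hm₀, ← mul_assoc, lam.mul_act]

section

variable {𝕜 : Type} [RCLike 𝕜] {p q : ℕ}

attribute [local instance] Matrix.linftyOpNormedRing Matrix.linftyOpNormedAlgebra
  completeSpace_matrix

local notation "𝔼" => Fin p ⊕ Fin q → 𝕜
local notation "𝔐" => Matrix (Fin p ⊕ Fin q) (Fin p ⊕ Fin q) 𝕜

namespace MVB

variable {H : Subgroup (Matrix (Fin p ⊕ Fin q) (Fin p ⊕ Fin q) 𝕜)ˣ}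
  {L : Submodule ℝ (Matrix (Fin p ⊕ Fin q) (Fin p ⊕ Fin q) 𝕜)} {h : LinLie.IsExpModel H L}
  {V : MVB.{u} 𝕜 p q} {A : GStructure (matrixAction h) V.bundle}
  (a : (⟨V.bundle, A⟩ : GBundle.{u} (matrixAction h)).frameBundle.bundle.total)

/-- Linearity, isometry and orientation of a frame are all read off from this matrix in `H`. -/
theorem exists_frame_eq_mulVec : ∃ e ∈ A.atlas, GBundle.frameProj _ a ∈ e.baseSet ∧ ∃ g ∈ H,
    ∀ v, ((e (GBundle.frame a v)).2 : 𝔼) = (g : 𝔐) *ᵥ v := by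
  obtain ⟨e, m, hm, g, rfl⟩ := GBundle.exists_eq_mkFrame a
  refine ⟨e.1, e.2, by rwa [GBundle.frameProj_mkFrame e hm], g.1, g.2, fun v => ?_⟩
  rw [GBundle.frame_mkFrame e hm, e.1.snd_apply_symm hm]
  rfl

variable {a} {m : V.bundle.base} (hp : ∀ v, V.bundle.proj (GBundle.frame a v) = m)

include hp in
theorem frameProj_eq : GBundle.frameProj _ a = m :=
  (GBundle.proj_frame a 0).symm.trans (hp 0)

theorem isLinearMap_frame (hA : ∀ e ∈ A.atlas, V.IsIsometric e) :
    IsLinearMap 𝕜 fun v => V.pt (GBundle.frame a v) (hp v) := by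
  obtain ⟨e, he, hm, g, -, hg⟩ := exists_frame_eq_mulVec a
  rw [frameProj_eq hp] at hm
  have h1 : ∀ v, (hA e he).1.coord hm (V.pt (GBundle.frame a v) (hp v)) = (g : 𝔐) *ᵥ v := hg
  refine ⟨fun x y => ((hA e he).1.coord hm).injective ?_,
    fun c x => ((hA e he).1.coord hm).injective ?_⟩
  · rw [map_add, h1, h1, h1, Matrix.mulVec_add]
  · rw [map_smul, h1, h1, Matrix.mulVec_smul]

theorem metric_frame (hH : H ≤ pqO 𝕜 p q) (hA : ∀ e ∈ A.atlas, V.IsIsometric e) (v w : 𝔼) :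
    V.metric (V.pt (GBundle.frame a v) (hp v)) (V.pt (GBundle.frame a w) (hp w)) =
      pqForm v w := by
  obtain ⟨e, he, hm, g, hgH, hg⟩ := exists_frame_eq_mulVec a
  rw [frameProj_eq hp] at hm
  refine ((hA e he).2 m hm _ _).trans ((congrArg₂ pqForm (hg v) (hg w)).trans ?_)
  exact pqForm_mulVec_of_mem (hH hgH) v w

end MVB

variable (𝕜 p q) in
/-- Metrised vector bundles are equivalent to principal `O(𝕜, (p, q))`-bundles. -/
noncomputable def MVB.equivPrincipal : MVB.{u} 𝕜 p q ≌ PrincipalBundle.{u} (lieO 𝕜 p q) :=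
  (MVB.equivGBundle 𝕜 p q).trans (GBundle.frameFunctor (actO 𝕜 p q)).asEquivalence

variable (𝕜 p q) in
/-- The points of the principal bundle of a metrised vector bundle are its orthonormal frames. -/
noncomputable def MVB.frameIdentification : FrameIdentification (actO 𝕜 p q)
    (𝟭 (MVB.{u} 𝕜 p q)) (MVB.equivPrincipal 𝕜 p q).functor where
  baseIso := NatIso.ofComponents (fun _ => Iso.refl _) fun _ => rfl
  frame V := GBundle.frame (X := (MVB.toGBundle 𝕜 p q).obj V)
  smooth V := GBundle.contMDiff_frame ((MVB.toGBundle 𝕜 p q).obj V)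
  proj_frame V := GBundle.proj_frame (X := (MVB.toGBundle 𝕜 p q).obj V)
  linear V _ _ hp := MVB.isLinearMap_frame (A := V.isometricStructure) hp fun _ he => he.2
  isometry V _ _ hp :=
    MVB.metric_frame (A := V.isometricStructure) hp le_rfl fun _ he => he.2
  equivariant V _ he _ hm :=
    GBundle.frame_symm_mul (X := (MVB.toGBundle 𝕜 p q).obj V) he hm
  natural f := GBundle.frame_frameMapFun ((MVB.toGBundle 𝕜 p q).map f)

variable (𝕜 p q) in
/-- Oriented metrised vector bundles are equivalent to principal `SO(𝕜, (p, q))`-bundles. -/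
noncomputable def OMVB.equivPrincipal : OMVB.{u} 𝕜 p q ≌ PrincipalBundle.{u} (lieSO 𝕜 p q) :=
  (OMVB.toGBundle 𝕜 p q).asEquivalence.trans (GBundle.frameFunctor (actSO 𝕜 p q)).asEquivalence

variable (𝕜 p q) in
/-- The points of the principal bundle of an oriented metrised vector bundle are its positively
oriented orthonormal frames. -/
noncomputable def OMVB.frameIdentification : FrameIdentification (actSO 𝕜 p q)
    (OMVB.forget (𝕜 := 𝕜) (p := p) (q := q)) (OMVB.equivPrincipal.{u} 𝕜 p q).functor where
  baseIso := NatIso.ofComponents (fun _ => Iso.refl _) fun _ => rfl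
  frame V := GBundle.frame (X := (OMVB.toGBundle 𝕜 p q).obj V)
  smooth V := GBundle.contMDiff_frame ((OMVB.toGBundle 𝕜 p q).obj V)
  proj_frame V := GBundle.proj_frame (X := (OMVB.toGBundle 𝕜 p q).obj V)
  linear V _ _ hp :=
    MVB.isLinearMap_frame (V := V.toMVB) (A := V.orientedStructure) hp fun _ he => he.2.1
  isometry V _ _ hp :=
    MVB.metric_frame (V := V.toMVB) (A := V.orientedStructure) hp pqSO_le_pqO fun _ he => he.2.1
  equivariant V _ he _ hm :=
    GBundle.frame_symm_mul (X := (OMVB.toGBundle 𝕜 p q).obj V) he hm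
  natural f := GBundle.frame_frameMapFun ((OMVB.toGBundle 𝕜 p q).map f)

theorem OMVB.mem_positive_of_eq_frame (V : OMVB.{u} 𝕜 p q)
    (a : ((OMVB.toGBundle 𝕜 p q).obj V).frameBundle.bundle.total) {m : V.toMVB.bundle.base}
    (b : Module.Basis (Fin p ⊕ Fin q) 𝕜 (V.toMVB.Fibre m))
    (hb : ∀ i, (b i).1 = GBundle.frame a (Pi.single i 1)) : b ∈ V.orientation.positive m := by
  -- In rank zero `hb` is empty and does not even place `a` over `m`, but then every basis has
  -- determinant `1` and belongs to the class.
  rcases isEmpty_or_nonempty (Fin p ⊕ Fin q) with _ | ⟨⟨i₀⟩⟩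
  · obtain ⟨b₀, h₀⟩ := V.orientation.is_class m
    rw [h₀]
    exact ⟨1, one_pos, by rw [Module.Basis.det_apply, Matrix.det_isEmpty, RCLike.ofReal_one]⟩
  · obtain ⟨e, he, hm, g, hgH, hg⟩ :=
      MVB.exists_frame_eq_mulVec (V := V.toMVB) (A := V.orientedStructure) a
    have hp : GBundle.frameProj _ a = m :=
      (GBundle.proj_frame a _).symm.trans ((congrArg _ (hb i₀)).symm.trans (b i₀).2)
    replace hm : m ∈ e.baseSet := hp ▸ hm
    refine (V.orientation.mem_positive_iff (he.2.2.basis_mem he.2.1.1 hm)).2 ?_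
    refine (he.2.1.1.det_basis_of_mulVec_single hm (A := g) (v := fun i => b i) fun j =>
      (congrArg (fun x => ((e x).2 : 𝔼)) (hb j)).trans (hg _)).symm ▸ ?_
    rw [hgH.2]
    exact .one

end

theorem mainTheorem12 (𝕜 : Type) [RCLike 𝕜] (p q : ℕ) :
    (∃ (D : MVB.{u} 𝕜 p q ⥤ GBundle.{u} (actO 𝕜 p q))
        (M : GBundle.{u} (actO 𝕜 p q) ⥤ MVB.{u} 𝕜 p q),
      D ⋙ M = 𝟭 _ ∧ M ⋙ D = 𝟭 _ ∧ D ⋙ GBundle.forget = MVB.forget ∧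
      ∀ (B : FibreBundle.{u} (vecMfd 𝕜 p q)) (s : MetricStructure 𝕜 p q B),
        ∃ A : GStructure (actO 𝕜 p q) B, D.obj ⟨B, s⟩ = ⟨B, A⟩ ∧
          ∀ e, e ∈ A.atlas ↔ IsSmoothTriv e ∧ s.IsIsometricTriv e) ∧
    (∃ Φ : MVB.{u} 𝕜 p q ≌ PrincipalBundle.{u} (lieO 𝕜 p q),
      Nonempty (FrameIdentification (actO 𝕜 p q) (𝟭 _) Φ.functor)) ∧
    (∃ Φ : OMVB.{u} 𝕜 p q ≌ PrincipalBundle.{u} (lieSO 𝕜 p q),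
      ∃ θ : FrameIdentification (actSO 𝕜 p q) OMVB.forget Φ.functor,
        ∀ (V : OMVB.{u} 𝕜 p q) (a : (Φ.functor.obj V).bundle.total)
          (m : V.toMVB.bundle.base) (b : Module.Basis (Fin p ⊕ Fin q) 𝕜 (V.toMVB.Fibre m)),
          (∀ i, (b i).1 = θ.frame V a (Pi.single i 1)) → b ∈ V.orientation.positive m) :=
  ⟨⟨MVB.toGBundle 𝕜 p q, MVB.ofGBundle 𝕜 p q, MVB.toGBundle_comp_ofGBundle,
      MVB.ofGBundle_comp_toGBundle, rfl,
      fun B s => ⟨MVB.isometricStructure ⟨B, s⟩, rfl, fun _ => Iff.rfl⟩⟩,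
    ⟨MVB.equivPrincipal 𝕜 p q, ⟨MVB.frameIdentification 𝕜 p q⟩⟩,
    ⟨OMVB.equivPrincipal 𝕜 p q, OMVB.frameIdentification 𝕜 p q, fun V a _ b hb =>
      V.mem_positive_of_eq_frame a b hb⟩⟩
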